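/- Let $k$ be a field. All rings are $k$-algebras, $k$ acts centrally on all bimodules, and $D=\operatorname{Hom}_k(-,k)$. For an algebra $\Gamma$ and a $\Gamma$-bimodule $B$ write $T_\Gamma(B)$ for the tensor algebra, and for an algebra homomorphism $A\to\Gamma$ let $\Omega_A(\Gamma)$ be the kernel of the multiplication map $\Gamma\otimes_A\Gamma\to\Gamma$, with elements $dt=1\otimes t-t\otimes 1$ for $t\in\Gamma$. Let $A$ be a finite dimensional semisimple algebra and $\sigma\in DA$ a symmetrising element: $\sigma(ab)=\sigma(ba)$, and $\sigma(a-)=0$ implies $a=0$. For a functional $\xi$ on a left (resp. right) $A$-module $N$ let ${}_\ell\xi$ (resp. ${}_r\xi$) be the unique homomorphism of left (resp. right) $A$-modules $N\to A$ with $\sigma\circ{}_\ell\xi=\xi$ (resp. $\sigma\circ{}_r\xi=\xi$). Suppose that we are in one of the following two cases. (1) $\Lambda$ is a finite dimensional hereditary algebra with Jacobson radical $J$, and $A\subseteq\Lambda$ is a semisimple subalgebra with $\Lambda=A\oplus J$. Put $\Omega=\Omega_A(\Lambda)$ and $\mho=D(D\Lambda\otimes_\Lambda\Omega\otimes_\Lambda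 D\Lambda)$, and let $\bar c\in\mho$ be given by $\theta\otimes d\lambda\otimes\phi\mapsto\theta({}_\ell\phi(\lambda))-\phi({}_r\theta(\lambda))$. (2) $\Lambda=T_A(M)$ for a finite dimensional $A$-bimodule $M$. Put $\mho=\Lambda\otimes_A DM\otimes_A\Lambda$ and $\bar c=\sum_i m_i\otimes\mu_i\otimes1-\sum_j1\otimes\nu_j\otimes n_j$, where $\rho=\sum_i m_i\otimes\mu_i\in M\otimes_ADM$ and $\ell=\sum_j\nu_j\otimes n_j\in DM\otimes_AM$ represent the identities of $M_A$ and ${}_AM$, that is, $x=\sum_i m_i\,{}_r\mu_i(x)$ and $x=\sum_j{}_\ell\nu_j(x)\,n_j$ for all $x\in M$. Let $\Pi_1$ be the cokernel of the bimodule homomorphism $\Lambda\otimes_A\Lambda\to\mho$ with $1\otimes1\mapsto\bar c$, let $\Pi=T_\Lambda(\Pi_1)$ be the preprojective algebra, let $T=T_\Lambda(\mho)$ with its canonical map $T\to\Pi$, and let $\widetilde\Omega=\Omega_A(T)$. **Theorem.** Every right $\Pi$-module $X$ has a projective presentation, functorial in $X$, $$X\otimes_A\Pi\xrightarrow{d_2}X\otimes_T\widetilde\Omega\otimes_T\Pi\xrightarrow{d_1}X\otimes_A\Pi\xrightarrow{d_0}X\to0;$$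 that is, the sequence of right $\Pi$-modules is exact, the modules $X\otimes_A\Pi$ and $X\otimes_T\widetilde\Omega\otimes_T\Pi$ are projective, and all maps are natural in $X$. Here $d_2(x\otimes1)=x\otimes d\bar c\otimes1$, $d_1(x\otimes dt\otimes p)=x\otimes tp-xt\otimes p$ and $d_0(x\otimes p)=xp$. In case (2) there are isomorphisms $X\otimes_A(M\oplus DM)\otimes_A\Pi\cong X\otimes_T\widetilde\Omega\otimes_T\Pi$, $x\otimes\gamma\otimes p\mapsto x\otimes d\gamma\otimes p$, where $M\oplus DM$ is mapped to $T$ by $m\mapsto m$ and $\mu\mapsto1\otimes\mu\otimes1$. Under these the presentation becomes a functorial projective presentation $$X\otimes_A\Pi\to X\otimes_A(M\oplus DM)\otimes_A\Pi\to X\otimes_A\Pi\to X\to0$$ whose middle map sends $x\otimes\gamma\otimes p$ to $x\otimes\gamma p-x\gamma\otimes p$ and whose left map sends $x\otimes1$ to $$\sum_i\bigl(xm_i\otimes\mu_i\otimes1+x\otimes m_i\otimes\mu_i\bigr)-\sum_j\bigl(x\nu_j\otimes n_j\otimes1+x\otimes\nu_j\otimes n_j\bigr).$$ -/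

import Mathlib

open MulOpposite
open scoped TensorProduct

universe w

noncomputable section

/-!
Conventions. `k` is a field (or a commutative ring), all rings are `k`-algebras, and `k` acts
centrally on all bimodules. A right `R`-module is a module over `Rᵐᵒᵖ`; the element written `x r`
in mathematics is `op r • x`. An `S`-`R`-bimodule carries commuting actions of `S` and of `Rᵐᵒᵖ`.
-/

/-! ### Tensor products over a noncommutative algebra -/

section BalancedTensor

variable {k C S R : Type*} [CommRing k] [Ring C] [Ring S] [Ring R]
  [Algebra k C] [Algebra k S] [Algebra k R]

/-- The relations `x c ⊗ y = x ⊗ c y`, where `c ∈ C` acts on the right of `X` through `f`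
and on the left of `Y` through `g`. -/
def balancedRel (f : C →ₐ[k] S) (g : C →ₐ[k] R) (X Y : Type*)
    [AddCommGroup X] [Module k X] [Module Sᵐᵒᵖ X]
    [AddCommGroup Y] [Module k Y] [Module R Y] : Submodule k (X ⊗[k] Y) :=
  Submodule.span k {z | ∃ (x : X) (c : C) (y : Y), z = (op (f c) • x) ⊗ₜ[k] y - x ⊗ₜ[k] (g c • y)}

/-- `X ⊗_C Y`, for a right `S`-module `X` and a left `R`-module `Y`, both regarded as
`C`-modules along algebra homomorphisms `f : C → S` and `g : C → R`. -/
def BT (f : C →ₐ[k] S) (g : C →ₐ[k] R) (X Y : Type*)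
    [AddCommGroup X] [Module k X] [Module Sᵐᵒᵖ X]
    [AddCommGroup Y] [Module k Y] [Module R Y] : Type _ :=
  (X ⊗[k] Y) ⧸ balancedRel f g X Y

namespace BT

variable (f : C →ₐ[k] S) (g : C →ₐ[k] R) {X Y Z : Type*}
  [AddCommGroup X] [Module k X] [Module Sᵐᵒᵖ X]
  [AddCommGroup Y] [Module k Y] [Module R Y] [AddCommGroup Z] [Module k Z]

instance : AddCommGroup (BT f g X Y) :=
  inferInstanceAs (AddCommGroup ((X ⊗[k] Y) ⧸ balancedRel f g X Y))

instance : Module k (BT f g X Y) :=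
  inferInstanceAs (Module k ((X ⊗[k] Y) ⧸ balancedRel f g X Y))

/-- The quotient map `X ⊗_k Y → X ⊗_C Y`. -/
def mk : X ⊗[k] Y →ₗ[k] BT f g X Y := (balancedRel f g X Y).mkQ

/-- The element `x ⊗ y` of `X ⊗_C Y`. -/
def tmul (x : X) (y : Y) : BT f g X Y := mk f g (x ⊗ₜ[k] y)

variable {f g}

theorem mk_surjective : Function.Surjective (mk f g : X ⊗[k] Y →ₗ[k] BT f g X Y) :=
  (balancedRel f g X Y).mkQ_surjective

theorem tmul_balanced (x : X) (c : C) (y : Y) :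
    tmul f g (op (f c) • x) y = tmul f g x (g c • y) := by
  refine (Submodule.Quotient.eq _).2 (Submodule.subset_span ⟨x, c, y, rfl⟩)

theorem hom_ext {φ ψ : BT f g X Y →ₗ[k] Z}
    (h : ∀ x y, φ (tmul f g x y) = ψ (tmul f g x y)) : φ = ψ := by
  have : φ ∘ₗ mk f g = ψ ∘ₗ mk f g := TensorProduct.ext' h
  ext z
  obtain ⟨z, rfl⟩ := mk_surjective z
  exact LinearMap.congr_fun this z

/-- A `k`-bilinear `C`-balanced map induces a `k`-linear map on `X ⊗_C Y`. -/
def lift (φ : X →ₗ[k] Y →ₗ[k] Z)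
    (h : ∀ (x : X) (c : C) (y : Y), φ (op (f c) • x) y = φ x (g c • y)) : BT f g X Y →ₗ[k] Z :=
  (balancedRel f g X Y).liftQ (TensorProduct.lift φ) <| by
    refine Submodule.span_le.2 ?_
    rintro _ ⟨x, c, y, rfl⟩
    simp [h]

@[simp] theorem lift_tmul (φ : X →ₗ[k] Y →ₗ[k] Z)
    (h : ∀ (x : X) (c : C) (y : Y), φ (op (f c) • x) y = φ x (g c • y)) (x : X) (y : Y) :
    lift φ h (tmul f g x y) = φ x y := rfl

@[elab_as_elim]
theorem induction {p : BT f g X Y → Prop} (z : BT f g X Y) (h0 : p 0)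
    (ht : ∀ x y, p (tmul f g x y)) (ha : ∀ a b, p a → p b → p (a + b)) : p z := by
  obtain ⟨z, rfl⟩ := mk_surjective z
  induction z with
  | zero => simpa using h0
  | tmul x y => exact ht x y
  | add a b ha' hb' => rw [map_add]; exact ha _ _ ha' hb'

theorem add_tmul (x x' : X) (y : Y) :
    tmul f g (x + x') y = tmul f g x y + tmul f g x' y := by
  simp only [tmul, TensorProduct.add_tmul, map_add]

theorem tmul_add (x : X) (y y' : Y) :
    tmul f g x (y + y') = tmul f g x y + tmul f g x y' := by
  simp only [tmul, TensorProduct.tmul_add, map_add]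

theorem zero_tmul (y : Y) : tmul f g (0 : X) y = 0 := by
  simp only [tmul, TensorProduct.zero_tmul, map_zero]

theorem tmul_zero (x : X) : tmul f g x (0 : Y) = 0 := by
  simp only [tmul, TensorProduct.tmul_zero, map_zero]

theorem smulk_tmul (r : k) (x : X) (y : Y) :
    tmul f g (r • x) y = r • tmul f g x y := by
  simp only [tmul]
  rw [← TensorProduct.smul_tmul', map_smul]

theorem tmul_smulk (r : k) (x : X) (y : Y) :
    tmul f g x (r • y) = r • tmul f g x y := by
  simp only [tmul]
  rw [TensorProduct.tmul_smul, map_smul]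

/-! The left action on `X ⊗_C Y` inherited from `X`. -/

section Left

variable {L : Type*} [Ring L] [Algebra k L] [Module L X] [IsScalarTower k L X]
  [SMulCommClass L Sᵐᵒᵖ X]

variable (f g X Y) in
/-- `l ↦ (x ⊗ y ↦ l x ⊗ y)`. -/
def leftEnd (l : L) : BT f g X Y →ₗ[k] BT f g X Y :=
  (balancedRel f g X Y).mapQ (balancedRel f g X Y)
    ((Algebra.lsmul k k X l).rTensor Y) <| by
    refine Submodule.span_le.2 ?_
    rintro _ ⟨x, c, y, rfl⟩
    refine Submodule.subset_span ⟨l • x, c, y, ?_⟩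
    simp [smul_comm l (op (f c)) x]

theorem leftEnd_tmul (l : L) (x : X) (y : Y) :
    leftEnd f g X Y l (tmul f g x y) = tmul f g (l • x) y := rfl

instance (priority := 500) leftModule : Module L (BT f g X Y) where
  smul l z := leftEnd f g X Y l z
  one_smul z := by
    change leftEnd f g X Y (1 : L) z = z
    induction z using BT.induction with
    | h0 => simp
    | ht x y => rw [leftEnd_tmul, one_smul]
    | ha a b ha hb => rw [map_add, ha, hb]
  mul_smul l m z := by
    change leftEnd f g X Y (l * m) z = leftEnd f g X Y l (leftEnd f g X Y m z)
    induction z using BT.induction with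
    | h0 => simp
    | ht x y => simp only [leftEnd_tmul, mul_smul]
    | ha a b ha hb => rw [map_add, ha, hb, map_add, map_add]
  smul_zero l := (leftEnd f g X Y l).map_zero
  smul_add l a b := (leftEnd f g X Y l).map_add a b
  add_smul l m z := by
    change leftEnd f g X Y (l + m) z = leftEnd f g X Y l z + leftEnd f g X Y m z
    induction z using BT.induction with
    | h0 => simp
    | ht x y => simp only [leftEnd_tmul, add_smul, add_tmul]
    | ha a b ha hb => rw [map_add, ha, hb, map_add, map_add]; abel
  zero_smul z := by
    change leftEnd f g X Y (0 : L) z = 0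
    induction z using BT.induction with
    | h0 => simp
    | ht x y => simp only [leftEnd_tmul, zero_smul, zero_tmul]
    | ha a b ha hb => rw [map_add, ha, hb, add_zero]

theorem smul_tmul_left (l : L) (x : X) (y : Y) :
    l • tmul f g x y = tmul f g (l • x) y := rfl

instance (priority := 500) leftTower : IsScalarTower k L (BT f g X Y) where
  smul_assoc r l z := by
    change leftEnd f g X Y (r • l) z = r • leftEnd f g X Y l z
    induction z using BT.induction with
    | h0 => simp
    | ht x y => simp only [leftEnd_tmul, smul_assoc, smulk_tmul]
    | ha a b ha hb => rw [map_add, ha, hb, map_add, smul_add]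

end Left

/-! The right action on `X ⊗_C Y` inherited from `Y`. -/

section Right

variable {Q : Type*} [Ring Q] [Algebra k Q] [Module Qᵐᵒᵖ Y] [IsScalarTower k Qᵐᵒᵖ Y]
  [SMulCommClass R Qᵐᵒᵖ Y]

variable (f g X Y) in
/-- `q ↦ (x ⊗ y ↦ x ⊗ y q)`. -/
def rightEnd (q : Qᵐᵒᵖ) : BT f g X Y →ₗ[k] BT f g X Y :=
  (balancedRel f g X Y).mapQ (balancedRel f g X Y)
    ((Algebra.lsmul k k Y q).lTensor X) <| by
    refine Submodule.span_le.2 ?_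
    rintro _ ⟨x, c, y, rfl⟩
    refine Submodule.subset_span ⟨x, c, q • y, ?_⟩
    simp [smul_comm (g c) q y]

theorem rightEnd_tmul (q : Qᵐᵒᵖ) (x : X) (y : Y) :
    rightEnd f g X Y q (tmul f g x y) = tmul f g x (q • y) := rfl

instance rightModule : Module Qᵐᵒᵖ (BT f g X Y) where
  smul q z := rightEnd f g X Y q z
  one_smul z := by
    change rightEnd f g X Y (1 : Qᵐᵒᵖ) z = z
    induction z using BT.induction with
    | h0 => simp
    | ht x y => rw [rightEnd_tmul, one_smul]
    | ha a b ha hb => rw [map_add, ha, hb]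
  mul_smul l m z := by
    change rightEnd f g X Y (l * m) z = rightEnd f g X Y l (rightEnd f g X Y m z)
    induction z using BT.induction with
    | h0 => simp
    | ht x y => simp only [rightEnd_tmul, mul_smul]
    | ha a b ha hb => rw [map_add, ha, hb, map_add, map_add]
  smul_zero l := (rightEnd f g X Y l).map_zero
  smul_add l a b := (rightEnd f g X Y l).map_add a b
  add_smul l m z := by
    change rightEnd f g X Y (l + m) z = rightEnd f g X Y l z + rightEnd f g X Y m z
    induction z using BT.induction with
    | h0 => simp
    | ht x y => simp only [rightEnd_tmul, add_smul, tmul_add]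
    | ha a b ha hb => rw [map_add, ha, hb, map_add, map_add]; abel
  zero_smul z := by
    change rightEnd f g X Y (0 : Qᵐᵒᵖ) z = 0
    induction z using BT.induction with
    | h0 => simp
    | ht x y => simp only [rightEnd_tmul, zero_smul, tmul_zero]
    | ha a b ha hb => rw [map_add, ha, hb, add_zero]

theorem smul_tmul_right (q : Qᵐᵒᵖ) (x : X) (y : Y) :
    q • tmul f g x y = tmul f g x (q • y) := rfl

instance rightTower : IsScalarTower k Qᵐᵒᵖ (BT f g X Y) where
  smul_assoc r q z := by
    change rightEnd f g X Y (r • q) z = r • rightEnd f g X Y q z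
    induction z using BT.induction with
    | h0 => simp
    | ht x y => simp only [rightEnd_tmul, smul_assoc, tmul_smulk]
    | ha a b ha hb => rw [map_add, ha, hb, map_add, smul_add]

instance smulComm {L : Type*} [Ring L] [Algebra k L] [Module L X] [IsScalarTower k L X]
    [SMulCommClass L Sᵐᵒᵖ X] : SMulCommClass L Qᵐᵒᵖ (BT f g X Y) where
  smul_comm l q z := by
    change leftEnd f g X Y l (rightEnd f g X Y q z) = rightEnd f g X Y q (leftEnd f g X Y l z)
    induction z using BT.induction with
    | h0 => simp
    | ht x y => rfl
    | ha a b ha hb => simp only [map_add, ha, hb]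

variable {X' : Type*} [AddCommGroup X'] [Module k X'] [Module Sᵐᵒᵖ X']
  [IsScalarTower k Sᵐᵒᵖ X] [IsScalarTower k Sᵐᵒᵖ X']

variable (f g Y) in
/-- The homomorphism `φ ⊗ 1 : X ⊗_C Y → X' ⊗_C Y` of right `Q`-modules. -/
def map (φ : X →ₗ[Sᵐᵒᵖ] X') : BT f g X Y →ₗ[Qᵐᵒᵖ] BT f g X' Y :=
  let F : BT f g X Y →ₗ[k] BT f g X' Y :=
    (balancedRel f g X Y).mapQ (balancedRel f g X' Y) ((φ.restrictScalars k).rTensor Y) <| by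
      refine Submodule.span_le.2 ?_
      rintro _ ⟨x, c, y, rfl⟩
      refine Submodule.subset_span ⟨φ x, c, y, ?_⟩
      simp
  { toFun := F
    map_add' := F.map_add
    map_smul' := fun q z => by
      change F (rightEnd f g X Y q z) = rightEnd f g X' Y q (F z)
      induction z using BT.induction with
      | h0 => simp
      | ht x y => rfl
      | ha a b ha hb => simp only [map_add, ha, hb] }

theorem map_tmul (φ : X →ₗ[Sᵐᵒᵖ] X') (x : X) (y : Y) :
    map (Q := Q) f g Y φ (tmul f g x y) = tmul f g (φ x) y := rfl

end Right

end BT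

end BalancedTensor

/-! ### The `k`-dual of a (bi)module -/

section Dual

/-- `D N = Hom_k(N, k)`. -/
def KDual (k N : Type*) [CommRing k] [AddCommGroup N] [Module k N] : Type _ := N →ₗ[k] k

namespace KDual

variable {k N : Type*} [CommRing k] [AddCommGroup N] [Module k N]

instance : AddCommGroup (KDual k N) := inferInstanceAs (AddCommGroup (N →ₗ[k] k))
instance : Module k (KDual k N) := inferInstanceAs (Module k (N →ₗ[k] k))
instance : FunLike (KDual k N) N k := inferInstanceAs (FunLike (N →ₗ[k] k) N k)
instance : LinearMapClass (KDual k N) k N k :=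
  inferInstanceAs (LinearMapClass (N →ₗ[k] k) k N k)

/-- The underlying linear functional. -/
def toLin (ξ : KDual k N) : N →ₗ[k] k := ξ

@[ext] theorem ext {ξ η : KDual k N} (h : ∀ x, ξ x = η x) : ξ = η := LinearMap.ext h

@[simp] theorem toLin_apply (ξ : KDual k N) (x : N) : ξ.toLin x = ξ x := rfl
@[simp] theorem add_apply (ξ η : KDual k N) (x : N) : (ξ + η) x = ξ x + η x := rfl
@[simp] theorem zero_apply (x : N) : (0 : KDual k N) x = 0 := rfl
@[simp] theorem smulk_apply (r : k) (ξ : KDual k N) (x : N) : (r • ξ) x = r * ξ x := rfl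

/-- `(ξ l)(x) = ξ(l x)`. -/
instance (priority := 500) rightModule {L : Type*} [Ring L] [Algebra k L] [Module L N]
    [IsScalarTower k L N] : Module Lᵐᵒᵖ (KDual k N) where
  smul l ξ := ξ.toLin ∘ₗ Algebra.lsmul k k N l.unop
  one_smul ξ := by ext x; change ξ ((1 : L) • x) = ξ x; rw [one_smul]
  mul_smul l m ξ := by
    ext x; change ξ ((m.unop * l.unop) • x) = ξ (m.unop • l.unop • x); rw [mul_smul]
  smul_zero l := by ext x; rfl
  smul_add l ξ η := by ext x; rfl
  add_smul l m ξ := by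
    ext x; change ξ ((l.unop + m.unop) • x) = ξ (l.unop • x) + ξ (m.unop • x)
    rw [add_smul, map_add]
  zero_smul ξ := by ext x; change ξ ((0 : L) • x) = 0; rw [zero_smul, map_zero]

/-- `(r ξ)(x) = ξ(x r)`. -/
instance (priority := 500) leftModule {R : Type*} [Ring R] [Algebra k R] [Module Rᵐᵒᵖ N]
    [IsScalarTower k Rᵐᵒᵖ N] : Module R (KDual k N) where
  smul r ξ := ξ.toLin ∘ₗ Algebra.lsmul k k N (op r)
  one_smul ξ := by ext x; change ξ ((1 : Rᵐᵒᵖ) • x) = ξ x; rw [one_smul]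
  mul_smul l m ξ := by
    ext x; change ξ ((op m * op l) • x) = ξ (op m • op l • x); rw [mul_smul]
  smul_zero l := by ext x; rfl
  smul_add l ξ η := by ext x; rfl
  add_smul l m ξ := by
    ext x; change ξ ((op l + op m) • x) = ξ (op l • x) + ξ (op m • x)
    rw [add_smul, map_add]
  zero_smul ξ := by ext x; change ξ ((0 : Rᵐᵒᵖ) • x) = 0; rw [zero_smul, map_zero]

theorem right_smul_apply {L : Type*} [Ring L] [Algebra k L] [Module L N]
    [IsScalarTower k L N] (l : L) (ξ : KDual k N) (x : N) : (op l • ξ) x = ξ (l • x) := rfl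

theorem left_smul_apply {R : Type*} [Ring R] [Algebra k R] [Module Rᵐᵒᵖ N]
    [IsScalarTower k Rᵐᵒᵖ N] (r : R) (ξ : KDual k N) (x : N) : (r • ξ) x = ξ (op r • x) := rfl

instance (priority := 500) rightTower {L : Type*} [Ring L] [Algebra k L] [Module L N]
    [IsScalarTower k L N] : IsScalarTower k Lᵐᵒᵖ (KDual k N) where
  smul_assoc r l ξ := by
    ext x; change ξ ((r • l.unop) • x) = r * ξ (l.unop • x)
    rw [smul_assoc, map_smul, smul_eq_mul]

instance (priority := 500) leftTower {R : Type*} [Ring R] [Algebra k R] [Module Rᵐᵒᵖ N]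
    [IsScalarTower k Rᵐᵒᵖ N] : IsScalarTower k R (KDual k N) where
  smul_assoc r l ξ := by
    ext x; change ξ ((r • op l) • x) = r * ξ (op l • x)
    rw [smul_assoc, map_smul, smul_eq_mul]

instance smulComm {L R : Type*} [Ring L] [Algebra k L] [Ring R] [Algebra k R]
    [Module L N] [IsScalarTower k L N] [Module Rᵐᵒᵖ N] [IsScalarTower k Rᵐᵒᵖ N]
    [SMulCommClass L Rᵐᵒᵖ N] : SMulCommClass R Lᵐᵒᵖ (KDual k N) where
  smul_comm r l ξ := by
    ext x; change ξ (l.unop • op r • x) = ξ (op r • l.unop • x); rw [smul_comm]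

end KDual

end Dual

/-! ### Noncommutative 1-forms -/

section Forms

variable {k A Γ : Type*} [CommRing k] [Ring A] [Ring Γ] [Algebra k A] [Algebra k Γ]

/-- The multiplication map `Γ ⊗_A Γ → Γ`. -/
def mulMap (ι : A →ₐ[k] Γ) : BT ι ι Γ Γ →ₗ[k] Γ :=
  BT.lift (LinearMap.mul k Γ) fun x c y => by simp [mul_assoc]

@[simp] theorem mulMap_tmul (ι : A →ₐ[k] Γ) (x y : Γ) :
    mulMap ι (BT.tmul ι ι x y) = x * y := rfl

theorem mulMap_smul_left (ι : A →ₐ[k] Γ) (l : Γ) (z : BT ι ι Γ Γ) :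
    mulMap ι (l • z) = l * mulMap ι z := by
  induction z using BT.induction with
  | h0 => simp
  | ht x y => rw [BT.smul_tmul_left]; simp [mul_assoc]
  | ha a b ha hb => simp only [smul_add, map_add, ha, hb, mul_add]

theorem mulMap_smul_right (ι : A →ₐ[k] Γ) (l : Γᵐᵒᵖ) (z : BT ι ι Γ Γ) :
    mulMap ι (l • z) = mulMap ι z * l.unop := by
  induction z using BT.induction with
  | h0 => simp
  | ht x y => rw [BT.smul_tmul_right]; simp [mul_assoc]
  | ha a b ha hb => simp only [smul_add, map_add, ha, hb, add_mul]

/-- The bimodule of noncommutative 1-forms on `Γ` over `A`: the kernel of the multiplication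
map `Γ ⊗_A Γ → Γ`. -/
def Omega (ι : A →ₐ[k] Γ) : Type _ := LinearMap.ker (mulMap ι)

namespace Omega

variable {ι : A →ₐ[k] Γ}

instance : AddCommGroup (Omega ι) := inferInstanceAs (AddCommGroup (LinearMap.ker (mulMap ι)))
instance : Module k (Omega ι) := inferInstanceAs (Module k (LinearMap.ker (mulMap ι)))

variable (ι) in
/-- The inclusion `Ω → Γ ⊗_A Γ`. -/
def val : Omega ι →ₗ[k] BT ι ι Γ Γ := (LinearMap.ker (mulMap ι)).subtype

theorem val_injective : Function.Injective (val ι) := Subtype.val_injective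

theorem mulMap_val (z : Omega ι) : mulMap ι (val ι z) = 0 := z.2

instance : SMul Γ (Omega ι) where
  smul l z := ⟨l • val ι z, by rw [LinearMap.mem_ker, mulMap_smul_left, mulMap_val, mul_zero]⟩

instance : SMul Γᵐᵒᵖ (Omega ι) where
  smul l z := ⟨l • val ι z, by rw [LinearMap.mem_ker, mulMap_smul_right, mulMap_val, zero_mul]⟩

theorem val_smul_left (l : Γ) (z : Omega ι) : val ι (l • z) = l • val ι z := rfl
theorem val_smul_right (l : Γᵐᵒᵖ) (z : Omega ι) : val ι (l • z) = l • val ι z := rfl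

instance (priority := 500) leftModule : Module Γ (Omega ι) :=
  Function.Injective.module Γ (val ι).toAddMonoidHom val_injective fun l z => val_smul_left l z

instance rightModule : Module Γᵐᵒᵖ (Omega ι) :=
  Function.Injective.module Γᵐᵒᵖ (val ι).toAddMonoidHom val_injective
    fun l z => val_smul_right l z

instance (priority := 500) leftTower : IsScalarTower k Γ (Omega ι) where
  smul_assoc r l z := val_injective (by
    rw [val_smul_left, map_smul, val_smul_left, smul_assoc])

instance rightTower : IsScalarTower k Γᵐᵒᵖ (Omega ι) where
  smul_assoc r l z := val_injective (by
    rw [val_smul_right, map_smul, val_smul_right, smul_assoc])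

instance smulComm : SMulCommClass Γ Γᵐᵒᵖ (Omega ι) where
  smul_comm l m z := val_injective (by
    rw [val_smul_left, val_smul_right, val_smul_right, val_smul_left, smul_comm])

variable (ι) in
/-- `d t = 1 ⊗ t - t ⊗ 1`. -/
def d (t : Γ) : Omega ι := ⟨BT.tmul ι ι 1 t - BT.tmul ι ι t 1, by simp⟩

theorem val_d (t : Γ) : val ι (d ι t) = BT.tmul ι ι 1 t - BT.tmul ι ι t 1 := rfl

end Omega

end Forms

/-! ### The tensor algebra of a bimodule -/

section TensorAlg

variable (k Γ B : Type*) [CommRing k] [Ring Γ] [Algebra k Γ]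
  [AddCommGroup B] [Module k B] [Module Γ B] [Module Γᵐᵒᵖ B]

/-- The relations which make `Γ` a subalgebra and `B` a sub-`Γ`-bimodule. -/
inductive TensorAlg.Rel : FreeAlgebra k (Γ ⊕ B) → FreeAlgebra k (Γ ⊕ B) → Prop
  | scalar (r : k) : Rel (FreeAlgebra.ι k (Sum.inl (algebraMap k Γ r))) (algebraMap k _ r)
  | add (x y : Γ) : Rel (FreeAlgebra.ι k (Sum.inl (x + y)))
      (FreeAlgebra.ι k (Sum.inl x) + FreeAlgebra.ι k (Sum.inl y))
  | mul (x y : Γ) : Rel (FreeAlgebra.ι k (Sum.inl (x * y)))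
      (FreeAlgebra.ι k (Sum.inl x) * FreeAlgebra.ι k (Sum.inl y))
  | incl_add (b b' : B) : Rel (FreeAlgebra.ι k (Sum.inr (b + b')))
      (FreeAlgebra.ι k (Sum.inr b) + FreeAlgebra.ι k (Sum.inr b'))
  | smul_left (x : Γ) (b : B) : Rel (FreeAlgebra.ι k (Sum.inr (x • b)))
      (FreeAlgebra.ι k (Sum.inl x) * FreeAlgebra.ι k (Sum.inr b))
  | smul_right (x : Γ) (b : B) : Rel (FreeAlgebra.ι k (Sum.inr (op x • b)))
      (FreeAlgebra.ι k (Sum.inr b) * FreeAlgebra.ι k (Sum.inl x))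

/-- The tensor algebra `T_Γ(B) = Γ ⊕ B ⊕ (B ⊗_Γ B) ⊕ ⋯` of a `Γ`-bimodule `B`, constructed (like
Mathlib's `TensorAlgebra` over a commutative ring) as the universal algebra receiving an algebra
homomorphism from `Γ` and a bimodule homomorphism from `B`. -/
def TensorAlg : Type _ := RingQuot (TensorAlg.Rel k Γ B)

namespace TensorAlg

instance : Ring (TensorAlg k Γ B) := inferInstanceAs (Ring (RingQuot (Rel k Γ B)))
instance : Algebra k (TensorAlg k Γ B) := inferInstanceAs (Algebra k (RingQuot (Rel k Γ B)))

/-- The quotient map from the free algebra. -/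
def proj : FreeAlgebra k (Γ ⊕ B) →ₐ[k] TensorAlg k Γ B := RingQuot.mkAlgHom k (Rel k Γ B)

variable {k Γ B} in
theorem proj_rel {x y : FreeAlgebra k (Γ ⊕ B)} (h : Rel k Γ B x y) :
    proj k Γ B x = proj k Γ B y := RingQuot.mkAlgHom_rel k h

/-- The structure homomorphism `Γ → T_Γ(B)`. -/
def of : Γ →ₐ[k] TensorAlg k Γ B :=
  AlgHom.ofLinearMap
    { toFun := fun x => proj k Γ B (FreeAlgebra.ι k (Sum.inl x))
      map_add' := fun x y => by rw [proj_rel (.add x y), map_add]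
      map_smul' := fun r x => by
        rw [Algebra.smul_def, proj_rel (.mul _ x), map_mul, proj_rel (.scalar r),
          AlgHom.commutes, RingHom.id_apply, Algebra.smul_def] }
    (by
      change proj k Γ B (FreeAlgebra.ι k (Sum.inl 1)) = 1
      rw [← map_one (algebraMap k Γ), proj_rel (.scalar 1), map_one, map_one])
    (fun x y => by
      change proj k Γ B (FreeAlgebra.ι k (Sum.inl (x * y))) = _
      rw [proj_rel (.mul x y), map_mul]; rfl)

theorem of_apply (x : Γ) : of k Γ B x = proj k Γ B (FreeAlgebra.ι k (Sum.inl x)) := rfl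

variable [IsScalarTower k Γ B]

/-- The inclusion `B → T_Γ(B)` in degree one. -/
def incl : B →ₗ[k] TensorAlg k Γ B where
  toFun b := proj k Γ B (FreeAlgebra.ι k (Sum.inr b))
  map_add' b b' := by rw [proj_rel (.incl_add b b'), map_add]
  map_smul' r b := by
    rw [← algebraMap_smul Γ r b, proj_rel (.smul_left _ b), map_mul, proj_rel (.scalar r),
      AlgHom.commutes, RingHom.id_apply, Algebra.smul_def]

theorem incl_smul_left (x : Γ) (b : B) : incl k Γ B (x • b) = of k Γ B x * incl k Γ B b := by
  change proj k Γ B _ = _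
  rw [proj_rel (.smul_left x b), map_mul]; rfl

theorem incl_smul_right (x : Γ) (b : B) :
    incl k Γ B (op x • b) = incl k Γ B b * of k Γ B x := by
  change proj k Γ B _ = _
  rw [proj_rel (.smul_right x b), map_mul]; rfl

variable {k Γ B} {S : Type*} [Ring S] [Algebra k S]

/-- The universal property of the tensor algebra. -/
def lift (f : Γ →ₐ[k] S) (g : B →ₗ[k] S) (hl : ∀ x b, g (x • b) = f x * g b)
    (hr : ∀ (x : Γ) b, g (op x • b) = g b * f x) : TensorAlg k Γ B →ₐ[k] S :=
  RingQuot.liftAlgHom k ⟨FreeAlgebra.lift k (Sum.elim f g), by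
    intro x y h
    cases h <;> simp [hl, hr]⟩

theorem lift_of (f : Γ →ₐ[k] S) (g : B →ₗ[k] S) (hl : ∀ x b, g (x • b) = f x * g b)
    (hr : ∀ (x : Γ) b, g (op x • b) = g b * f x) (x : Γ) :
    lift f g hl hr (of k Γ B x) = f x := by
  change RingQuot.liftAlgHom k _ (RingQuot.mkAlgHom k _ _) = _
  simp

theorem lift_incl (f : Γ →ₐ[k] S) (g : B →ₗ[k] S) (hl : ∀ x b, g (x • b) = f x * g b)
    (hr : ∀ (x : Γ) b, g (op x • b) = g b * f x) (b : B) :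
    lift f g hl hr (incl k Γ B b) = g b := by
  change RingQuot.liftAlgHom k _ (RingQuot.mkAlgHom k _ _) = _
  simp

theorem hom_ext {φ ψ : TensorAlg k Γ B →ₐ[k] S} (h₁ : ∀ x, φ (of k Γ B x) = ψ (of k Γ B x))
    (h₂ : ∀ b, φ (incl k Γ B b) = ψ (incl k Γ B b)) : φ = ψ := by
  refine RingQuot.ringQuot_ext' k φ ψ (FreeAlgebra.hom_ext ?_)
  funext z
  cases z with
  | inl x => exact h₁ x
  | inr b => exact h₂ b

end TensorAlg

end TensorAlg

/-! ### The preprojective algebra attached to a bimodule `W = ℧` and an element `c ∈ W` -/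

section Preprojective

variable {k : Type*} (Λ : Type*) {W : Type*} [CommRing k] [Ring Λ] [Algebra k Λ]
  [AddCommGroup W] [Module k W] [Module Λ W] [Module Λᵐᵒᵖ W]
  [IsScalarTower k Λ W] [IsScalarTower k Λᵐᵒᵖ W] [SMulCommClass Λ Λᵐᵒᵖ W]

variable (k) in
/-- The sub-bimodule `Λ c Λ` of `W` generated by `c`. When `c` commutes with a subalgebra `A`,
it is the image of the bimodule homomorphism `Λ ⊗_A Λ → W` sending `1 ⊗ 1` to `c`. -/
def bimodSpan (c : W) : Submodule k W :=
  Submodule.span k {w | ∃ x y : Λ, w = x • op y • c}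

variable (k) in
/-- The cokernel `Π₁` of the bimodule homomorphism `Λ ⊗_A Λ → W` sending `1 ⊗ 1` to `c`. -/
def PiOne (c : W) : Type _ := W ⧸ bimodSpan k Λ c

variable {Λ}

namespace PiOne

variable {c : W}

instance : AddCommGroup (PiOne k Λ c) := inferInstanceAs (AddCommGroup (W ⧸ bimodSpan k Λ c))
instance : Module k (PiOne k Λ c) := inferInstanceAs (Module k (W ⧸ bimodSpan k Λ c))

variable (k Λ c) in
/-- The quotient map `W → Π₁`. -/
def mk : W →ₗ[k] PiOne k Λ c := (bimodSpan k Λ c).mkQ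

theorem mk_surjective : Function.Surjective (mk k Λ c) := (bimodSpan k Λ c).mkQ_surjective

instance : SMul Λ (PiOne k Λ c) where
  smul l := (bimodSpan k Λ c).mapQ (bimodSpan k Λ c) (Algebra.lsmul k k W l) <| by
    refine Submodule.span_le.2 ?_
    rintro _ ⟨x, y, rfl⟩
    exact Submodule.subset_span ⟨l * x, y, by simp [mul_smul]⟩

instance : SMul Λᵐᵒᵖ (PiOne k Λ c) where
  smul l := (bimodSpan k Λ c).mapQ (bimodSpan k Λ c) (Algebra.lsmul k k W l) <| by
    refine Submodule.span_le.2 ?_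
    rintro _ ⟨x, y, rfl⟩
    refine Submodule.subset_span ⟨x, y * l.unop, ?_⟩
    change l • x • op y • c = x • op (y * l.unop) • c
    rw [← smul_comm x l, op_mul, mul_smul, op_unop]

theorem mk_smul_left (l : Λ) (w : W) : mk k Λ c (l • w) = l • mk k Λ c w := rfl
theorem mk_smul_right (l : Λᵐᵒᵖ) (w : W) : mk k Λ c (l • w) = l • mk k Λ c w := rfl

instance (priority := 500) leftModule : Module Λ (PiOne k Λ c) :=
  Function.Surjective.module Λ (mk k Λ c).toAddMonoidHom mk_surjective fun l w => mk_smul_left l w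

instance rightModule : Module Λᵐᵒᵖ (PiOne k Λ c) :=
  Function.Surjective.module Λᵐᵒᵖ (mk k Λ c).toAddMonoidHom mk_surjective
    fun l w => mk_smul_right l w

instance (priority := 500) leftTower : IsScalarTower k Λ (PiOne k Λ c) where
  smul_assoc r l z := by
    obtain ⟨w, rfl⟩ := mk_surjective z
    rw [← mk_smul_left, ← mk_smul_left, ← map_smul, smul_assoc]

instance rightTower : IsScalarTower k Λᵐᵒᵖ (PiOne k Λ c) where
  smul_assoc r l z := by
    obtain ⟨w, rfl⟩ := mk_surjective z
    rw [← mk_smul_right, ← mk_smul_right, ← map_smul, smul_assoc]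

instance smulComm : SMulCommClass Λ Λᵐᵒᵖ (PiOne k Λ c) where
  smul_comm l m z := by
    obtain ⟨w, rfl⟩ := mk_surjective z
    rw [← mk_smul_right, ← mk_smul_left, ← mk_smul_left, ← mk_smul_right, smul_comm]

end PiOne

variable (k Λ) in
/-- The preprojective algebra `Π = T_Λ(Π₁)`. -/
def Preproj (c : W) : Type _ := TensorAlg k Λ (PiOne k Λ c)

instance (c : W) : Ring (Preproj k Λ c) := inferInstanceAs (Ring (TensorAlg k Λ (PiOne k Λ c)))
instance (c : W) : Algebra k (Preproj k Λ c) :=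
  inferInstanceAs (Algebra k (TensorAlg k Λ (PiOne k Λ c)))

variable (k Λ) in
/-- The structure homomorphism `Λ → Π`. -/
def Preproj.of (c : W) : Λ →ₐ[k] Preproj k Λ c := TensorAlg.of k Λ (PiOne k Λ c)

variable (k Λ) in
/-- The inclusion `Π₁ → Π`. -/
def Preproj.incl (c : W) : PiOne k Λ c →ₗ[k] Preproj k Λ c := TensorAlg.incl k Λ (PiOne k Λ c)

variable (k Λ) in
/-- The canonical surjection `T = T_Λ(W) → T_Λ(Π₁) = Π`. -/
def toPreproj (c : W) : TensorAlg k Λ W →ₐ[k] Preproj k Λ c :=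
  TensorAlg.lift (Preproj.of k Λ c) (Preproj.incl k Λ c ∘ₗ PiOne.mk k Λ c)
    (fun x b => by
      rw [LinearMap.comp_apply, LinearMap.comp_apply, PiOne.mk_smul_left]
      exact TensorAlg.incl_smul_left k Λ (PiOne k Λ c) x _)
    (fun x b => by
      rw [LinearMap.comp_apply, LinearMap.comp_apply, PiOne.mk_smul_right]
      exact TensorAlg.incl_smul_right k Λ (PiOne k Λ c) x _)

variable {A : Type*} [Ring A] [Algebra k A]

variable (W) in
/-- The composite `A → Λ → T`. -/
def baseToT (ι : A →ₐ[k] Λ) : A →ₐ[k] TensorAlg k Λ W := (TensorAlg.of k Λ W).comp ι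

/-- The composite `A → Λ → T → Π`. -/
def baseToPi (ι : A →ₐ[k] Λ) (c : W) : A →ₐ[k] Preproj k Λ c :=
  (toPreproj k Λ c).comp (baseToT W ι)

variable (W) in
/-- The bimodule `Ω̃` of noncommutative 1-forms on `T` over `A`. -/
abbrev OmegaT (ι : A →ₐ[k] Λ) : Type _ := Omega (baseToT W ι)

section Terms

variable (ι : A →ₐ[k] Λ) (c : W) (X : Type w) [AddCommGroup X] [Module k X]
  [Module (Preproj k Λ c)ᵐᵒᵖ X] [IsScalarTower k (Preproj k Λ c)ᵐᵒᵖ X]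

/-- `X ⊗_A Π`, for a right `Π`-module `X`. -/
def TermP : Type _ := BT (baseToPi ι c) (baseToPi ι c) X (Preproj k Λ c)

instance : AddCommGroup (TermP ι c X) :=
  inferInstanceAs (AddCommGroup (BT (baseToPi ι c) (baseToPi ι c) X (Preproj k Λ c)))
instance : Module k (TermP ι c X) :=
  inferInstanceAs (Module k (BT (baseToPi ι c) (baseToPi ι c) X (Preproj k Λ c)))
instance : Module (Preproj k Λ c)ᵐᵒᵖ (TermP ι c X) :=
  inferInstanceAs (Module (Preproj k Λ c)ᵐᵒᵖ
    (BT (baseToPi ι c) (baseToPi ι c) X (Preproj k Λ c)))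
instance : IsScalarTower k (Preproj k Λ c)ᵐᵒᵖ (TermP ι c X) :=
  inferInstanceAs (IsScalarTower k (Preproj k Λ c)ᵐᵒᵖ
    (BT (baseToPi ι c) (baseToPi ι c) X (Preproj k Λ c)))

/-- `X ⊗_T Ω̃`, a right `T`-module, for a right `Π`-module `X`. -/
def TermXO : Type _ :=
  BT (toPreproj k Λ c) (AlgHom.id k (TensorAlg k Λ W)) X (OmegaT W ι)

instance : AddCommGroup (TermXO ι c X) :=
  inferInstanceAs (AddCommGroup
    (BT (toPreproj k Λ c) (AlgHom.id k (TensorAlg k Λ W)) X (OmegaT W ι)))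
instance : Module k (TermXO ι c X) :=
  inferInstanceAs (Module k
    (BT (toPreproj k Λ c) (AlgHom.id k (TensorAlg k Λ W)) X (OmegaT W ι)))
instance : Module (TensorAlg k Λ W)ᵐᵒᵖ (TermXO ι c X) :=
  inferInstanceAs (Module (TensorAlg k Λ W)ᵐᵒᵖ
    (BT (toPreproj k Λ c) (AlgHom.id k (TensorAlg k Λ W)) X (OmegaT W ι)))
instance : IsScalarTower k (TensorAlg k Λ W)ᵐᵒᵖ (TermXO ι c X) :=
  inferInstanceAs (IsScalarTower k (TensorAlg k Λ W)ᵐᵒᵖ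
    (BT (toPreproj k Λ c) (AlgHom.id k (TensorAlg k Λ W)) X (OmegaT W ι)))

/-- `X ⊗_T Ω̃ ⊗_T Π`, for a right `Π`-module `X`. -/
def TermQ : Type _ :=
  BT (AlgHom.id k (TensorAlg k Λ W)) (toPreproj k Λ c) (TermXO ι c X) (Preproj k Λ c)

instance : AddCommGroup (TermQ ι c X) :=
  inferInstanceAs (AddCommGroup
    (BT (AlgHom.id k (TensorAlg k Λ W)) (toPreproj k Λ c) (TermXO ι c X) (Preproj k Λ c)))
instance : Module k (TermQ ι c X) :=
  inferInstanceAs (Module k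
    (BT (AlgHom.id k (TensorAlg k Λ W)) (toPreproj k Λ c) (TermXO ι c X) (Preproj k Λ c)))
instance : Module (Preproj k Λ c)ᵐᵒᵖ (TermQ ι c X) :=
  inferInstanceAs (Module (Preproj k Λ c)ᵐᵒᵖ
    (BT (AlgHom.id k (TensorAlg k Λ W)) (toPreproj k Λ c) (TermXO ι c X) (Preproj k Λ c)))
instance : IsScalarTower k (Preproj k Λ c)ᵐᵒᵖ (TermQ ι c X) :=
  inferInstanceAs (IsScalarTower k (Preproj k Λ c)ᵐᵒᵖ
    (BT (AlgHom.id k (TensorAlg k Λ W)) (toPreproj k Λ c) (TermXO ι c X) (Preproj k Λ c)))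

variable {X}

/-- The element `x ⊗ p` of `X ⊗_A Π`. -/
def elemP (x : X) (p : Preproj k Λ c) : TermP ι c X :=
  BT.tmul (baseToPi ι c) (baseToPi ι c) x p

/-- The element `x ⊗ ω` of `X ⊗_T Ω̃`. -/
def elemXO (x : X) (ω : OmegaT W ι) : TermXO ι c X :=
  BT.tmul (toPreproj k Λ c) (AlgHom.id k (TensorAlg k Λ W)) x ω

/-- The element `x ⊗ ω ⊗ p` of `X ⊗_T Ω̃ ⊗_T Π`. -/
def elemQ (x : X) (ω : OmegaT W ι) (p : Preproj k Λ c) : TermQ ι c X :=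
  BT.tmul (AlgHom.id k (TensorAlg k Λ W)) (toPreproj k Λ c) (elemXO ι c x ω) p

variable {Y : Type w} [AddCommGroup Y] [Module k Y]
  [Module (Preproj k Λ c)ᵐᵒᵖ Y] [IsScalarTower k (Preproj k Λ c)ᵐᵒᵖ Y]

/-- `φ ⊗ 1 : X ⊗_A Π → Y ⊗_A Π`. -/
def mapP (φ : X →ₗ[(Preproj k Λ c)ᵐᵒᵖ] Y) :
    TermP ι c X →ₗ[(Preproj k Λ c)ᵐᵒᵖ] TermP ι c Y :=
  BT.map (baseToPi ι c) (baseToPi ι c) (Preproj k Λ c) φ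

/-- `φ ⊗ 1 : X ⊗_T Ω̃ → Y ⊗_T Ω̃`. -/
def mapXO (φ : X →ₗ[(Preproj k Λ c)ᵐᵒᵖ] Y) :
    TermXO ι c X →ₗ[(TensorAlg k Λ W)ᵐᵒᵖ] TermXO ι c Y :=
  BT.map (toPreproj k Λ c) (AlgHom.id k (TensorAlg k Λ W)) (OmegaT W ι) φ

/-- `φ ⊗ 1 ⊗ 1 : X ⊗_T Ω̃ ⊗_T Π → Y ⊗_T Ω̃ ⊗_T Π`. -/
def mapQ (φ : X →ₗ[(Preproj k Λ c)ᵐᵒᵖ] Y) :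
    TermQ ι c X →ₗ[(Preproj k Λ c)ᵐᵒᵖ] TermQ ι c Y :=
  BT.map (AlgHom.id k (TensorAlg k Λ W)) (toPreproj k Λ c) (Preproj k Λ c) (mapXO ι c φ)

end Terms

end Preprojective

/-! ### Hereditary rings and functorial projective presentations -/

/-- A ring is hereditary if all its left ideals and all its right ideals are projective. -/
def IsHereditaryRing (R : Type*) [Ring R] : Prop :=
  (∀ I : Submodule R R, Module.Projective R I) ∧
    (∀ I : Submodule Rᵐᵒᵖ R, Module.Projective Rᵐᵒᵖ I)

/-- A functorial projective presentation `P X → Q X → P X → X → 0` of all right `R`-modules `X`: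
the sequence is exact, `P X` and `Q X` are projective, and all maps are natural in `X`. -/
structure FunctorialPresentation (R : Type*) [Ring R] (P Q : ModuleCat.{w} Rᵐᵒᵖ → Type*)
    [∀ X, AddCommGroup (P X)] [∀ X, AddCommGroup (Q X)]
    [∀ X, Module Rᵐᵒᵖ (P X)] [∀ X, Module Rᵐᵒᵖ (Q X)]
    (mapP : ∀ X Y : ModuleCat.{w} Rᵐᵒᵖ, (X →ₗ[Rᵐᵒᵖ] Y) → (P X →ₗ[Rᵐᵒᵖ] P Y))
    (mapQ : ∀ X Y : ModuleCat.{w} Rᵐᵒᵖ, (X →ₗ[Rᵐᵒᵖ] Y) → (Q X →ₗ[Rᵐᵒᵖ] Q Y)) where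
  /-- The left hand map. -/
  d₂ : ∀ X : ModuleCat.{w} Rᵐᵒᵖ, P X →ₗ[Rᵐᵒᵖ] Q X
  /-- The middle map. -/
  d₁ : ∀ X : ModuleCat.{w} Rᵐᵒᵖ, Q X →ₗ[Rᵐᵒᵖ] P X
  /-- The augmentation. -/
  d₀ : ∀ X : ModuleCat.{w} Rᵐᵒᵖ, P X →ₗ[Rᵐᵒᵖ] X
  exact₁ : ∀ X, Function.Exact (d₂ X) (d₁ X)
  exact₀ : ∀ X, Function.Exact (d₁ X) (d₀ X)
  surjective : ∀ X, Function.Surjective (d₀ X)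
  projective_P : ∀ X, Module.Projective Rᵐᵒᵖ (P X)
  projective_Q : ∀ X, Module.Projective Rᵐᵒᵖ (Q X)
  natural₂ : ∀ (X Y : ModuleCat.{w} Rᵐᵒᵖ) (φ : X →ₗ[Rᵐᵒᵖ] Y), d₂ Y ∘ₗ mapP X Y φ = mapQ X Y φ ∘ₗ d₂ X
  natural₁ : ∀ (X Y : ModuleCat.{w} Rᵐᵒᵖ) (φ : X →ₗ[Rᵐᵒᵖ] Y), d₁ Y ∘ₗ mapQ X Y φ = mapP X Y φ ∘ₗ d₁ X
  natural₀ : ∀ (X Y : ModuleCat.{w} Rᵐᵒᵖ) (φ : X →ₗ[Rᵐᵒᵖ] Y), d₀ Y ∘ₗ mapP X Y φ = φ ∘ₗ d₀ X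

section Standard

open scoped ModuleCat

variable {k Λ W A : Type*} [Field k] [Ring Λ] [Algebra k Λ]
  [AddCommGroup W] [Module k W] [Module Λ W] [Module Λᵐᵒᵖ W]
  [IsScalarTower k Λ W] [IsScalarTower k Λᵐᵒᵖ W] [SMulCommClass Λ Λᵐᵒᵖ W]
  [Ring A] [Algebra k A]

/-- Functorial projective presentations of the form
`X ⊗_A Π → X ⊗_T Ω̃ ⊗_T Π → X ⊗_A Π → X → 0`. -/
abbrev PresentationPi (ι : A →ₐ[k] Λ) (c : W) : Type _ :=
  FunctorialPresentation.{w} (Preproj k Λ c) (fun X => TermP ι c X) (fun X => TermQ ι c X)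
    (fun _ _ φ => mapP ι c φ) (fun _ _ φ => mapQ ι c φ)

/-- The maps of the presentation are the standard ones: the left map sends `x ⊗ 1` to
`x ⊗ d c ⊗ 1`, the middle map sends `x ⊗ d t ⊗ p` to `x ⊗ t p - x t ⊗ p` (so it is induced by
the inclusion of `Ω̃` into `T ⊗_A T`), and the augmentation is `x ⊗ p ↦ x p`. -/
structure PresentationPi.IsStandard {ι : A →ₐ[k] Λ} {c : W} (P : PresentationPi.{w} ι c) :
    Prop where
  d₂_elem : ∀ (X : ModuleCat.{w} (Preproj k Λ c)ᵐᵒᵖ) (x : X),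
    P.d₂ X (elemP ι c x 1) =
      elemQ ι c x (Omega.d (baseToT W ι) (TensorAlg.incl k Λ W c)) 1
  d₁_elem : ∀ (X : ModuleCat.{w} (Preproj k Λ c)ᵐᵒᵖ) (x : X) (t : TensorAlg k Λ W)
    (p : Preproj k Λ c),
    P.d₁ X (elemQ ι c x (Omega.d (baseToT W ι) t) p) =
      elemP ι c x (toPreproj k Λ c t * p) - elemP ι c (op (toPreproj k Λ c t) • x) p
  d₀_elem : ∀ (X : ModuleCat.{w} (Preproj k Λ c)ᵐᵒᵖ) (x : X) (p : Preproj k Λ c),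
    P.d₀ X (elemP ι c x p) = op p • x

end Standard

/-! ### Symmetrising elements -/

/-- A symmetrising element `σ ∈ DA`: `σ(a b) = σ(b a)`, and `σ(a -) = 0` implies `a = 0`. -/
structure SymmetrisingElement (k A : Type*) [Field k] [Ring A] [Algebra k A] where
  /-- The linear functional. -/
  toLin : A →ₗ[k] k
  symm : ∀ a b, toLin (a * b) = toLin (b * a)
  nondeg : ∀ a, (∀ b, toLin (a * b) = 0) → a = 0

namespace SymmetrisingElement

variable {k A R N : Type*} [Field k] [Ring A] [Algebra k A] [FiniteDimensional k A]
  [Ring R] [Algebra k R] [AddCommGroup N] [Module k N]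
  (σ : SymmetrisingElement k A)

/-- The isomorphism `A ≅ DA`, `a ↦ σ(- a) = σ(a -)`. -/
def equiv : A ≃ₗ[k] (A →ₗ[k] k) :=
  LinearEquiv.ofInjectiveOfFinrankEq
    (LinearMap.mk₂ k (fun a b => σ.toLin (b * a)) (by simp [mul_add]) (by simp)
      (by simp [add_mul]) (by simp))
    (by
      rw [injective_iff_map_eq_zero]
      intro a h
      refine σ.nondeg a fun b => ?_
      rw [σ.symm]
      exact LinearMap.congr_fun h b)
    (Subspace.dual_finrank_eq (K := k) (V := A)).symm

theorem equiv_apply (a b : A) : σ.equiv a b = σ.toLin (b * a) := rfl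

theorem ext_iff {a a' : A} : a = a' ↔ ∀ b, σ.toLin (b * a) = σ.toLin (b * a') :=
  ⟨fun h _ => by rw [h], fun h => σ.equiv.injective (LinearMap.ext h)⟩

/-- For a functional `ξ` on a left module `N` (acted on by `A` through `f`), the homomorphism of
left `A`-modules `N → A` whose composite with `σ` is `ξ`. -/
def lmod (f : A →ₐ[k] R) [Module R N] [IsScalarTower k R N] :
    KDual k N →ₗ[k] N →ₗ[k] A :=
  LinearMap.mk₂ k
    (fun ξ y => σ.equiv.symm
      { toFun := fun b => ξ (f b • y)
        map_add' := fun b b' => by rw [map_add, add_smul, map_add]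
        map_smul' := fun r b => by
          rw [map_smul f, smul_assoc, map_smul ξ, RingHom.id_apply] })
    (fun ξ ξ' y => by rw [← map_add]; rfl)
    (fun r ξ y => by rw [← map_smul]; rfl)
    (fun ξ y y' => by
      rw [← map_add]; congr 1; ext b
      change ξ (f b • (y + y')) = ξ (f b • y) + ξ (f b • y')
      rw [smul_add, map_add])
    (fun r ξ y => by
      rw [← map_smul]; congr 1; ext b
      change ξ (f b • r • y) = r * ξ (f b • y)
      rw [smul_comm, map_smul, smul_eq_mul])

theorem apply_mul_lmod (f : A →ₐ[k] R) [Module R N] [IsScalarTower k R N] (ξ : KDual k N)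
    (y : N) (b : A) : σ.toLin (b * σ.lmod f ξ y) = ξ (f b • y) := by
  rw [← equiv_apply]
  exact LinearMap.congr_fun (σ.equiv.apply_symm_apply _) b

theorem apply_lmod (f : A →ₐ[k] R) [Module R N] [IsScalarTower k R N] (ξ : KDual k N)
    (y : N) : σ.toLin (σ.lmod f ξ y) = ξ y := by
  rw [← one_mul (σ.lmod f ξ y), apply_mul_lmod, map_one, one_smul]

theorem lmod_smul (f : A →ₐ[k] R) [Module R N] [IsScalarTower k R N] (ξ : KDual k N)
    (a : A) (y : N) : σ.lmod f ξ (f a • y) = a * σ.lmod f ξ y := by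
  rw [σ.ext_iff]
  intro b
  rw [apply_mul_lmod, ← mul_assoc, apply_mul_lmod, map_mul, mul_smul]

/-- For a functional `ξ` on a right module `N` (acted on by `A` through `f`), the homomorphism of
right `A`-modules `N → A` whose composite with `σ` is `ξ`. -/
def rmod (f : A →ₐ[k] R) [Module Rᵐᵒᵖ N] [IsScalarTower k Rᵐᵒᵖ N] :
    KDual k N →ₗ[k] N →ₗ[k] A :=
  LinearMap.mk₂ k
    (fun ξ y => σ.equiv.symm
      { toFun := fun b => ξ (op (f b) • y)
        map_add' := fun b b' => by rw [map_add, op_add, add_smul, map_add]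
        map_smul' := fun r b => by
          rw [map_smul f, op_smul, smul_assoc, map_smul ξ, RingHom.id_apply] })
    (fun ξ ξ' y => by rw [← map_add]; rfl)
    (fun r ξ y => by rw [← map_smul]; rfl)
    (fun ξ y y' => by
      rw [← map_add]; congr 1; ext b
      change ξ (op (f b) • (y + y')) = ξ (op (f b) • y) + ξ (op (f b) • y')
      rw [smul_add, map_add])
    (fun r ξ y => by
      rw [← map_smul]; congr 1; ext b
      change ξ (op (f b) • r • y) = r * ξ (op (f b) • y)
      rw [smul_comm, map_smul, smul_eq_mul])

theorem apply_rmod_mul (f : A →ₐ[k] R) [Module Rᵐᵒᵖ N] [IsScalarTower k Rᵐᵒᵖ N] (ξ : KDual k N)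
    (y : N) (b : A) : σ.toLin (σ.rmod f ξ y * b) = ξ (op (f b) • y) := by
  rw [σ.symm, ← equiv_apply]
  exact LinearMap.congr_fun (σ.equiv.apply_symm_apply _) b

theorem apply_rmod (f : A →ₐ[k] R) [Module Rᵐᵒᵖ N] [IsScalarTower k Rᵐᵒᵖ N] (ξ : KDual k N)
    (y : N) : σ.toLin (σ.rmod f ξ y) = ξ y := by
  rw [← mul_one (σ.rmod f ξ y), apply_rmod_mul, map_one, op_one, one_smul]

theorem rmod_smul (f : A →ₐ[k] R) [Module Rᵐᵒᵖ N] [IsScalarTower k Rᵐᵒᵖ N] (ξ : KDual k N)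
    (a : A) (y : N) : σ.rmod f ξ (op (f a) • y) = σ.rmod f ξ y * a := by
  rw [σ.ext_iff]
  intro b
  rw [σ.symm, apply_rmod_mul, σ.symm b, mul_assoc, apply_rmod_mul, map_mul, op_mul, mul_smul]

end SymmetrisingElement

/-! ### The bimodule `℧` and the element `c̄` for a finite dimensional algebra -/

section FiniteDimensional

variable {k A Λ : Type*} [Field k] [Ring A] [Algebra k A] [Ring Λ] [Algebra k Λ]

/-- `DΛ ⊗_Λ Ω ⊗_Λ DΛ`. -/
abbrev PreMho (ι : A →ₐ[k] Λ) : Type _ :=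
  BT (AlgHom.id k Λ) (AlgHom.id k Λ)
    (BT (AlgHom.id k Λ) (AlgHom.id k Λ) (KDual k Λ) (Omega ι)) (KDual k Λ)

/-- The element `θ ⊗ ω ⊗ φ` of `DΛ ⊗_Λ Ω ⊗_Λ DΛ`. -/
abbrev PreMho.elem (ι : A →ₐ[k] Λ) (θ : KDual k Λ) (ω : Omega ι) (φ : KDual k Λ) : PreMho ι :=
  BT.tmul (AlgHom.id k Λ) (AlgHom.id k Λ)
    (BT.tmul (AlgHom.id k Λ) (AlgHom.id k Λ) θ ω) φ

/-- The `Λ`-bimodule `℧ = D(DΛ ⊗_Λ Ω ⊗_Λ DΛ)`. -/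
def Mho (ι : A →ₐ[k] Λ) : Type _ := KDual k (PreMho ι)

namespace Mho

variable (ι : A →ₐ[k] Λ)

instance : AddCommGroup (Mho ι) := inferInstanceAs (AddCommGroup (KDual k (PreMho ι)))
instance : Module k (Mho ι) := inferInstanceAs (Module k (KDual k (PreMho ι)))
instance : Module Λ (Mho ι) := inferInstanceAs (Module Λ (KDual k (PreMho ι)))
instance : Module Λᵐᵒᵖ (Mho ι) := inferInstanceAs (Module Λᵐᵒᵖ (KDual k (PreMho ι)))
instance : IsScalarTower k Λ (Mho ι) := inferInstanceAs (IsScalarTower k Λ (KDual k (PreMho ι)))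
instance : IsScalarTower k Λᵐᵒᵖ (Mho ι) :=
  inferInstanceAs (IsScalarTower k Λᵐᵒᵖ (KDual k (PreMho ι)))
instance : SMulCommClass Λ Λᵐᵒᵖ (Mho ι) :=
  inferInstanceAs (SMulCommClass Λ Λᵐᵒᵖ (KDual k (PreMho ι)))

variable {ι}

/-- The value of an element of `℧` at an element of `DΛ ⊗_Λ Ω ⊗_Λ DΛ`. -/
def eval (u : Mho ι) (z : PreMho ι) : k := KDual.toLin u z

end Mho

variable [FiniteDimensional k A] (σ : SymmetrisingElement k A) (ι : A →ₐ[k] Λ)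

/-- The functional `x ⊗ y ↦ θ(x lmod_φ(y))` on `Λ ⊗_A Λ`. -/
def barForm (θ φ : KDual k Λ) : BT ι ι Λ Λ →ₗ[k] k :=
  BT.lift
    (LinearMap.mk₂ k (fun x y => θ (x * ι (σ.lmod ι φ y)))
      (by simp [add_mul]) (by simp) (by simp [mul_add]) (by simp))
    (fun x a y => by
      simp only [LinearMap.mk₂_apply, op_smul_eq_mul, σ.lmod_smul, map_mul, mul_assoc])

theorem barForm_tmul (θ φ : KDual k Λ) (x y : Λ) :
    barForm σ ι θ φ (BT.tmul ι ι x y) = θ (x * ι (σ.lmod ι φ y)) := rfl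

theorem barForm_add_left (θ θ' φ : KDual k Λ) :
    barForm σ ι (θ + θ') φ = barForm σ ι θ φ + barForm σ ι θ' φ :=
  BT.hom_ext fun _ _ => rfl

theorem barForm_smul_left (r : k) (θ φ : KDual k Λ) :
    barForm σ ι (r • θ) φ = r • barForm σ ι θ φ :=
  BT.hom_ext fun _ _ => rfl

theorem barForm_add_right (θ φ φ' : KDual k Λ) :
    barForm σ ι θ (φ + φ') = barForm σ ι θ φ + barForm σ ι θ φ' :=
  BT.hom_ext fun x y => by simp [barForm_tmul, mul_add]

theorem barForm_smul_right (r : k) (θ φ : KDual k Λ) :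
    barForm σ ι θ (r • φ) = r • barForm σ ι θ φ :=
  BT.hom_ext fun x y => by simp [barForm_tmul]

theorem barForm_balanced_left (θ φ : KDual k Λ) (l : Λ) (z : BT ι ι Λ Λ) :
    barForm σ ι (op l • θ) φ z = barForm σ ι θ φ (l • z) := by
  induction z using BT.induction with
  | h0 => simp
  | ht x y =>
    rw [BT.smul_tmul_left, barForm_tmul, barForm_tmul, KDual.right_smul_apply, smul_eq_mul,
      smul_eq_mul, mul_assoc]
  | ha a b ha hb => rw [map_add, ha, hb, smul_add, map_add]

theorem barForm_balanced_right (θ φ : KDual k Λ) (l : Λ) (z : BT ι ι Λ Λ) :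
    barForm σ ι θ φ (op l • z) = barForm σ ι θ (l • φ) z := by
  induction z using BT.induction with
  | h0 => simp
  | ht x y =>
    rw [BT.smul_tmul_right, barForm_tmul, barForm_tmul]
    congr 3
    rw [σ.ext_iff]
    intro b
    rw [σ.apply_mul_lmod, σ.apply_mul_lmod, KDual.left_smul_apply, smul_eq_mul, smul_eq_mul,
      op_smul_eq_mul, op_smul_eq_mul, mul_assoc]
  | ha a b ha hb => rw [map_add, ← ha, ← hb, smul_add, map_add]

/-- The trilinear map `(θ, ω, φ) ↦ ∑ θ(x lmod_φ(y))` for `ω = ∑ x ⊗ y`. -/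
def barTri : KDual k Λ →ₗ[k] Omega ι →ₗ[k] KDual k Λ →ₗ[k] k :=
  LinearMap.mk₂ k
    (fun θ ω =>
      { toFun := fun φ => barForm σ ι θ φ (Omega.val ι ω)
        map_add' := fun φ φ' => by rw [barForm_add_right, LinearMap.add_apply]
        map_smul' := fun r φ => by
          rw [barForm_smul_right, LinearMap.smul_apply, RingHom.id_apply] })
    (fun θ θ' ω => LinearMap.ext fun φ => by
      simp only [LinearMap.coe_mk, AddHom.coe_mk, LinearMap.add_apply, barForm_add_left])
    (fun r θ ω => LinearMap.ext fun φ => by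
      simp only [LinearMap.coe_mk, AddHom.coe_mk, LinearMap.smul_apply, barForm_smul_left])
    (fun θ ω ω' => LinearMap.ext fun φ => by
      simp only [LinearMap.coe_mk, AddHom.coe_mk, LinearMap.add_apply, map_add])
    (fun r θ ω => LinearMap.ext fun φ => by
      simp only [LinearMap.coe_mk, AddHom.coe_mk, LinearMap.smul_apply, map_smul])

theorem barTri_apply (θ φ : KDual k Λ) (ω : Omega ι) :
    barTri σ ι θ ω φ = barForm σ ι θ φ (Omega.val ι ω) := rfl

/-- The map `(θ ⊗ ω, φ) ↦ ∑ θ(x lmod_φ(y))` on `(DΛ ⊗_Λ Ω) × DΛ`. -/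
def barBi : BT (AlgHom.id k Λ) (AlgHom.id k Λ) (KDual k Λ) (Omega ι) →ₗ[k] KDual k Λ →ₗ[k] k :=
  BT.lift (barTri σ ι) fun θ l ω => LinearMap.ext fun φ => by
    rw [barTri_apply, barTri_apply, Omega.val_smul_left]
    exact barForm_balanced_left σ ι θ φ l _

theorem barBi_tmul (θ φ : KDual k Λ) (ω : Omega ι) :
    barBi σ ι (BT.tmul (AlgHom.id k Λ) (AlgHom.id k Λ) θ ω) φ =
      barForm σ ι θ φ (Omega.val ι ω) := rfl

theorem barBi_balanced (z : BT (AlgHom.id k Λ) (AlgHom.id k Λ) (KDual k Λ) (Omega ι)) (l : Λ)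
    (φ : KDual k Λ) : barBi σ ι (op l • z) φ = barBi σ ι z (l • φ) := by
  induction z using BT.induction with
  | h0 => rw [smul_zero, map_zero]; rfl
  | ht θ ω =>
    rw [BT.smul_tmul_right, barBi_tmul, barBi_tmul, Omega.val_smul_right]
    exact barForm_balanced_right σ ι θ φ l _
  | ha a b ha hb =>
    rw [smul_add, map_add, map_add, LinearMap.add_apply, LinearMap.add_apply, ha, hb]

/-- The element `c̄ ∈ ℧`. It sends `θ ⊗ ω ⊗ φ`, for `ω = ∑ x ⊗ y` in `Ω ⊆ Λ ⊗_A Λ`, to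
`∑ θ(x lmod_φ(y))`. By `cbar_apply` below this is the functional
`θ ⊗ dλ ⊗ φ ↦ θ(lmod_φ(λ)) - φ(rmod_θ(λ))`, which determines it since the elements `dλ` generate
`Ω` as a bimodule. -/
def cbar : Mho ι := BT.lift (barBi σ ι) fun z l φ => barBi_balanced σ ι z l φ

theorem cbar_apply (θ φ : KDual k Λ) (l : Λ) :
    (cbar σ ι).eval (PreMho.elem ι θ (Omega.d ι l) φ) =
      θ (ι (σ.lmod ι φ l)) - φ (ι (σ.rmod ι θ l)) := by
  change barForm σ ι θ φ (Omega.val ι (Omega.d ι l)) = _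
  rw [Omega.val_d, map_sub, barForm_tmul, barForm_tmul, one_mul]
  congr 1
  have h1 := σ.apply_rmod_mul ι θ l (σ.lmod ι φ 1)
  have h2 := σ.apply_mul_lmod ι φ 1 (σ.rmod ι θ l)
  simp only [op_smul_eq_mul, smul_eq_mul, mul_one] at h1 h2
  rw [← h1, h2]

end FiniteDimensional

/-! ### The bimodule `℧` and the element `c̄` for a tensor algebra `Λ = T_A(M)` -/

section TensorCase

variable (k A M : Type*) [Field k] [Ring A] [Algebra k A]
  [AddCommGroup M] [Module k M] [Module A M] [Module Aᵐᵒᵖ M]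
  [IsScalarTower k A M] [IsScalarTower k Aᵐᵒᵖ M] [SMulCommClass A Aᵐᵒᵖ M]

/-- The `Λ`-bimodule `℧ = Λ ⊗_A DM ⊗_A Λ`, where `Λ = T_A(M)`. -/
def MhoT : Type _ :=
  BT (AlgHom.id k A) (TensorAlg.of k A M)
    (BT (TensorAlg.of k A M) (AlgHom.id k A) (TensorAlg k A M) (KDual k M)) (TensorAlg k A M)

namespace MhoT

instance : AddCommGroup (MhoT k A M) := inferInstanceAs (AddCommGroup
  (BT (AlgHom.id k A) (TensorAlg.of k A M)
    (BT (TensorAlg.of k A M) (AlgHom.id k A) (TensorAlg k A M) (KDual k M)) (TensorAlg k A M)))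
instance : Module k (MhoT k A M) := inferInstanceAs (Module k
  (BT (AlgHom.id k A) (TensorAlg.of k A M)
    (BT (TensorAlg.of k A M) (AlgHom.id k A) (TensorAlg k A M) (KDual k M)) (TensorAlg k A M)))
instance : Module (TensorAlg k A M) (MhoT k A M) := inferInstanceAs (Module (TensorAlg k A M)
  (BT (AlgHom.id k A) (TensorAlg.of k A M)
    (BT (TensorAlg.of k A M) (AlgHom.id k A) (TensorAlg k A M) (KDual k M)) (TensorAlg k A M)))
instance : Module (TensorAlg k A M)ᵐᵒᵖ (MhoT k A M) := inferInstanceAs (Module (TensorAlg k A M)ᵐᵒᵖ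
  (BT (AlgHom.id k A) (TensorAlg.of k A M)
    (BT (TensorAlg.of k A M) (AlgHom.id k A) (TensorAlg k A M) (KDual k M)) (TensorAlg k A M)))
instance : IsScalarTower k (TensorAlg k A M) (MhoT k A M) :=
  inferInstanceAs (IsScalarTower k (TensorAlg k A M)
  (BT (AlgHom.id k A) (TensorAlg.of k A M)
    (BT (TensorAlg.of k A M) (AlgHom.id k A) (TensorAlg k A M) (KDual k M)) (TensorAlg k A M)))
instance : IsScalarTower k (TensorAlg k A M)ᵐᵒᵖ (MhoT k A M) :=
  inferInstanceAs (IsScalarTower k (TensorAlg k A M)ᵐᵒᵖ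
  (BT (AlgHom.id k A) (TensorAlg.of k A M)
    (BT (TensorAlg.of k A M) (AlgHom.id k A) (TensorAlg k A M) (KDual k M)) (TensorAlg k A M)))
instance : SMulCommClass (TensorAlg k A M) (TensorAlg k A M)ᵐᵒᵖ (MhoT k A M) :=
  inferInstanceAs (SMulCommClass (TensorAlg k A M) (TensorAlg k A M)ᵐᵒᵖ
  (BT (AlgHom.id k A) (TensorAlg.of k A M)
    (BT (TensorAlg.of k A M) (AlgHom.id k A) (TensorAlg k A M) (KDual k M)) (TensorAlg k A M)))

end MhoT

variable {k A M}

/-- The element `x ⊗ μ ⊗ y` of `Λ ⊗_A DM ⊗_A Λ`. -/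
def MhoT.elem (x : TensorAlg k A M) (μ : KDual k M) (y : TensorAlg k A M) : MhoT k A M :=
  BT.tmul (AlgHom.id k A) (TensorAlg.of k A M)
    (BT.tmul (TensorAlg.of k A M) (AlgHom.id k A) x μ) y

/-- `c̄ = ∑ mᵢ ⊗ μᵢ ⊗ 1 - ∑ 1 ⊗ νⱼ ⊗ nⱼ`. -/
def cbarT {r s : ℕ} (m : Fin r → M) (μ : Fin r → KDual k M) (ν : Fin s → KDual k M)
    (n : Fin s → M) : MhoT k A M :=
  ∑ i, MhoT.elem (TensorAlg.incl k A M (m i)) (μ i) 1 -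
    ∑ j, MhoT.elem 1 (ν j) (TensorAlg.incl k A M (n j))

/-- `∑ mᵢ ⊗ μᵢ ∈ M ⊗_A DM` represents the identity of the right `A`-module `M`. -/
def RepresentsRightId [FiniteDimensional k A] (σ : SymmetrisingElement k A) {r : ℕ}
    (m : Fin r → M) (μ : Fin r → KDual k M) : Prop :=
  ∀ x : M, ∑ i, op (σ.rmod (AlgHom.id k A) (μ i) x) • m i = x

/-- `∑ νⱼ ⊗ nⱼ ∈ DM ⊗_A M` represents the identity of the left `A`-module `M`. -/
def RepresentsLeftId [FiniteDimensional k A] (σ : SymmetrisingElement k A) {s : ℕ}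
    (ν : Fin s → KDual k M) (n : Fin s → M) : Prop :=
  ∀ x : M, ∑ j, σ.lmod (AlgHom.id k A) (ν j) x • n j = x

/-- The inclusion `M ⊕ DM → T = T_Λ(Λ ⊗_A DM ⊗_A Λ)`, `(m, μ) ↦ m + 1 ⊗ μ ⊗ 1`. -/
def doubleT (γ : M × KDual k M) : TensorAlg k (TensorAlg k A M) (MhoT k A M) :=
  TensorAlg.of k (TensorAlg k A M) (MhoT k A M) (TensorAlg.incl k A M γ.1) +
    TensorAlg.incl k (TensorAlg k A M) (MhoT k A M) (MhoT.elem 1 γ.2 1)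

/-- The composite `M ⊕ DM → T → Π`. -/
def doublePi (c : MhoT k A M) (γ : M × KDual k M) : Preproj k (TensorAlg k A M) c :=
  toPreproj k (TensorAlg k A M) c (doubleT γ)

section Terms

variable (c : MhoT k A M) (X : Type w) [AddCommGroup X] [Module k X]
  [Module (Preproj k (TensorAlg k A M) c)ᵐᵒᵖ X]
  [IsScalarTower k (Preproj k (TensorAlg k A M) c)ᵐᵒᵖ X]

/-- `X ⊗_A (M ⊕ DM)`, a right `A`-module, for a right `Π`-module `X`. -/
def TermXM : Type _ :=
  BT (baseToPi (TensorAlg.of k A M) c) (AlgHom.id k A) X (M × KDual k M)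

instance : AddCommGroup (TermXM c X) := inferInstanceAs (AddCommGroup
  (BT (baseToPi (TensorAlg.of k A M) c) (AlgHom.id k A) X (M × KDual k M)))
instance : Module k (TermXM c X) := inferInstanceAs (Module k
  (BT (baseToPi (TensorAlg.of k A M) c) (AlgHom.id k A) X (M × KDual k M)))
instance : Module Aᵐᵒᵖ (TermXM c X) := inferInstanceAs (Module Aᵐᵒᵖ
  (BT (baseToPi (TensorAlg.of k A M) c) (AlgHom.id k A) X (M × KDual k M)))
instance : IsScalarTower k Aᵐᵒᵖ (TermXM c X) := inferInstanceAs (IsScalarTower k Aᵐᵒᵖ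
  (BT (baseToPi (TensorAlg.of k A M) c) (AlgHom.id k A) X (M × KDual k M)))

/-- `X ⊗_A (M ⊕ DM) ⊗_A Π`, for a right `Π`-module `X`. -/
def TermM : Type _ :=
  BT (AlgHom.id k A) (baseToPi (TensorAlg.of k A M) c) (TermXM c X)
    (Preproj k (TensorAlg k A M) c)

instance : AddCommGroup (TermM c X) := inferInstanceAs (AddCommGroup
  (BT (AlgHom.id k A) (baseToPi (TensorAlg.of k A M) c) (TermXM c X)
    (Preproj k (TensorAlg k A M) c)))
instance : Module k (TermM c X) := inferInstanceAs (Module k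
  (BT (AlgHom.id k A) (baseToPi (TensorAlg.of k A M) c) (TermXM c X)
    (Preproj k (TensorAlg k A M) c)))
instance : Module (Preproj k (TensorAlg k A M) c)ᵐᵒᵖ (TermM c X) :=
  inferInstanceAs (Module (Preproj k (TensorAlg k A M) c)ᵐᵒᵖ
  (BT (AlgHom.id k A) (baseToPi (TensorAlg.of k A M) c) (TermXM c X)
    (Preproj k (TensorAlg k A M) c)))
instance : IsScalarTower k (Preproj k (TensorAlg k A M) c)ᵐᵒᵖ (TermM c X) :=
  inferInstanceAs (IsScalarTower k (Preproj k (TensorAlg k A M) c)ᵐᵒᵖ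
  (BT (AlgHom.id k A) (baseToPi (TensorAlg.of k A M) c) (TermXM c X)
    (Preproj k (TensorAlg k A M) c)))

variable {X}

/-- The element `x ⊗ γ` of `X ⊗_A (M ⊕ DM)`. -/
def elemXM (x : X) (γ : M × KDual k M) : TermXM c X :=
  BT.tmul (baseToPi (TensorAlg.of k A M) c) (AlgHom.id k A) x γ

/-- The element `x ⊗ γ ⊗ p` of `X ⊗_A (M ⊕ DM) ⊗_A Π`. -/
def elemM (x : X) (γ : M × KDual k M) (p : Preproj k (TensorAlg k A M) c) : TermM c X :=
  BT.tmul (AlgHom.id k A) (baseToPi (TensorAlg.of k A M) c) (elemXM c x γ) p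

variable {Y : Type w} [AddCommGroup Y] [Module k Y]
  [Module (Preproj k (TensorAlg k A M) c)ᵐᵒᵖ Y]
  [IsScalarTower k (Preproj k (TensorAlg k A M) c)ᵐᵒᵖ Y]

/-- `φ ⊗ 1 : X ⊗_A (M ⊕ DM) → Y ⊗_A (M ⊕ DM)`. -/
def mapXM (φ : X →ₗ[(Preproj k (TensorAlg k A M) c)ᵐᵒᵖ] Y) :
    TermXM c X →ₗ[Aᵐᵒᵖ] TermXM c Y :=
  BT.map (baseToPi (TensorAlg.of k A M) c) (AlgHom.id k A) (M × KDual k M) φ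

/-- `φ ⊗ 1 ⊗ 1 : X ⊗_A (M ⊕ DM) ⊗_A Π → Y ⊗_A (M ⊕ DM) ⊗_A Π`. -/
def mapM (φ : X →ₗ[(Preproj k (TensorAlg k A M) c)ᵐᵒᵖ] Y) :
    TermM c X →ₗ[(Preproj k (TensorAlg k A M) c)ᵐᵒᵖ] TermM c Y :=
  BT.map (AlgHom.id k A) (baseToPi (TensorAlg.of k A M) c) (Preproj k (TensorAlg k A M) c)
    (mapXM c φ)

end Terms

open scoped ModuleCat in
/-- Functorial projective presentations of the form
`X ⊗_A Π → X ⊗_A (M ⊕ DM) ⊗_A Π → X ⊗_A Π → X → 0`. -/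
abbrev PresentationDouble (c : MhoT k A M) : Type _ :=
  FunctorialPresentation.{w} (Preproj k (TensorAlg k A M) c)
    (fun X => TermP (TensorAlg.of k A M) c X) (fun X => TermM c X)
    (fun _ _ φ => mapP (TensorAlg.of k A M) c φ) (fun _ _ φ => mapM c φ)

end TensorCase

end

open scoped ModuleCat

/-!
The standard sequence comes from the fundamental exact sequence `0 → Ω̃ → T ⊗_A T → T → 0`. Since
homomorphisms of right `Π`-modules `X ⊗_T Ω̃ ⊗_T Π → Y` are the same as derivations
`T → Hom_k(X, Y)` over `A` (`TermQ.desc`, `universalDerivation`), the sequence can be handled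
through derivations. Exactness at `X ⊗_T Ω̃ ⊗_T Π` is the statement that a derivation on `T` which
kills `c̄` is a derivation on `Π` (`exact_standardD₂_standardD₁`), and the terms `X ⊗_A Π` are
projective because `A` is semisimple. What remains is the projectivity of `X ⊗_T Ω̃ ⊗_T Π`, or that
derivations `T → Hom_k(X, Z)` over `A` lift along surjections `Y → Z`.

For `Λ = T_A(M)` the algebra `T` is the tensor algebra of `M ⊕ DM` over `A`, a derivation on it is
determined by an arbitrary bimodule map on `M ⊕ DM`, and `X ⊗_T Ω̃ ⊗_T Π` is
`X ⊗_A (M ⊕ DM) ⊗_A Π` (`exists_termM_equiv_termQ`).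

For a finite dimensional hereditary algebra `Λ` a derivation on `T = T_Λ(℧)` is a derivation on
`Λ` together with a compatible map on `℧`. Over a hereditary algebra a right module which embeds
into a projective module is projective (`IsHereditaryRing.projective_of_injective`). Hence
`X ⊗_Λ Ω ⊆ X ⊗_A Λ` is projective and the derivation on `Λ` lifts. For the map on `℧`, a
compatible pair of maps on `Λ` and `℧` is the same as an extension of right `T`-modules, so an
action of `℧` has to be lifted along a surjection of extensions of `Λ`-modules. As `DΛ ⊗_Λ Ω` is
finitely generated and projective, an action `V ⊗_Λ ℧ → V` is a homomorphism
`Hom_Λ(DΛ ⊗_Λ Ω, V) → V`. The functor `Hom_Λ(DΛ ⊗_Λ Ω, -)` is exact, and its values are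
projective since they embed into the projective modules `Hom_k(DΛ, F)` (`RHom.projective`). Hence
it splits the extensions, and the lifting is possible (`IsHereditaryRing.exists_lift_action`).
-/

set_option linter.unusedSectionVars false

/-! ### Derivations with values in spaces of linear maps -/

section Derivations

variable {k R S X Y : Type*} [CommRing k] [Ring R] [Ring S] [Algebra k R] [Algebra k S]
  [AddCommGroup X] [Module k X] [Module Sᵐᵒᵖ X]
  [AddCommGroup Y] [Module k Y] [Module Sᵐᵒᵖ Y]

/-- `D : R → Hom_k(X, Y)` is a derivation, where `R` acts on the right `S`-modules `X` and `Y`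
through `f : R → S`: `D(r r')(x) = D(r)(x) r' + D(r')(x r)`. -/
def IsDerivation (f : R →ₐ[k] S) (D : R →ₗ[k] X →ₗ[k] Y) : Prop :=
  ∀ r r' x, D (r * r') x = op (f r') • D r x + D r' (op (f r) • x)

theorem IsDerivation.map_one {f : R →ₐ[k] S} {D : R →ₗ[k] X →ₗ[k] Y} (h : IsDerivation f D)
    (x : X) : D 1 x = 0 := by
  have := h 1 1 x
  rw [mul_one, _root_.map_one f, op_one, one_smul, one_smul] at this
  simpa using this

theorem IsDerivation.comp {f : R →ₐ[k] S} {D : R →ₗ[k] X →ₗ[k] Y} (h : IsDerivation f D)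
    {R' : Type*} [Ring R'] [Algebra k R'] (g : R' →ₐ[k] R) :
    IsDerivation (f.comp g) (D ∘ₗ g.toLinearMap) := fun r r' x => by
  simp only [LinearMap.comp_apply, AlgHom.toLinearMap_apply, map_mul, h _ _ x, AlgHom.comp_apply]

section Triangular

variable [IsScalarTower k Sᵐᵒᵖ X] [IsScalarTower k Sᵐᵒᵖ Y]

/-- The endomorphism `(x, y) ↦ (x s, d(x) + y s)` of `X × Y`, as an element of the opposite of the
endomorphism algebra, so that `s ↦ triangular s _` is multiplicative. -/
def triangular (s : S) (d : X →ₗ[k] Y) : (Module.End k (X × Y))ᵐᵒᵖ :=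
  op (LinearMap.prod (Algebra.lsmul k k X (op s) ∘ₗ LinearMap.fst k X Y)
    (d ∘ₗ LinearMap.fst k X Y + Algebra.lsmul k k Y (op s) ∘ₗ LinearMap.snd k X Y))

theorem triangular_apply (s : S) (d : X →ₗ[k] Y) (z : X × Y) :
    (triangular s d).unop z = (op s • z.1, d z.1 + op s • z.2) := rfl

theorem triangular_mul {s s' : S} {d d' d'' : X →ₗ[k] Y}
    (h : ∀ x, d'' x = op s' • d x + d' (op s • x)) :
    triangular s d * triangular s' d' = triangular (s * s') d'' := by
  refine unop_injective (LinearMap.ext fun z => ?_)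
  rw [unop_mul, Module.End.mul_apply, triangular_apply, triangular_apply, triangular_apply, h,
    op_mul, mul_smul, mul_smul, smul_add]
  exact Prod.ext rfl (by dsimp only; abel)

theorem triangular_add (s s' : S) (d d' : X →ₗ[k] Y) :
    triangular (s + s') (d + d') = triangular s d + triangular s' d' := by
  refine unop_injective (LinearMap.ext fun z => ?_)
  rw [unop_add, LinearMap.add_apply, triangular_apply, triangular_apply, triangular_apply,
    op_add, add_smul, add_smul, LinearMap.add_apply]
  exact Prod.ext rfl (by dsimp only [Prod.snd_add]; abel)

theorem triangular_smul (r : k) (s : S) (d : X →ₗ[k] Y) :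
    triangular (r • s) (r • d) = r • triangular s d := by
  refine unop_injective (LinearMap.ext fun z => ?_)
  rw [unop_smul, LinearMap.smul_apply, triangular_apply, triangular_apply, op_smul, smul_assoc,
    smul_assoc, LinearMap.smul_apply, Prod.smul_mk, smul_add]

variable (k X Y) in
theorem triangular_one : triangular (1 : S) (0 : X →ₗ[k] Y) = 1 := by
  refine unop_injective (LinearMap.ext fun z => ?_)
  rw [triangular_apply, op_one, one_smul, one_smul, LinearMap.zero_apply, zero_add]
  rfl

/-- `triangular` applied to a pair of linear maps. -/
def triangularMap {V : Type*} [AddCommGroup V] [Module k V] (f : V →ₗ[k] S)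
    (d : V →ₗ[k] X →ₗ[k] Y) : V →ₗ[k] (Module.End k (X × Y))ᵐᵒᵖ where
  toFun v := triangular (f v) (d v)
  map_add' v w := by rw [map_add, map_add, triangular_add]
  map_smul' r v := by rw [map_smul, map_smul, triangular_smul, RingHom.id_apply]

/-- Derivations `R → Hom_k(X, Y)` are the off-diagonal entries of representations of `R` by
triangular endomorphisms of `X × Y`. -/
theorem exists_derivation_of_triangular (f : R →ₐ[k] S) (φ : R →ₐ[k] (Module.End k (X × Y))ᵐᵒᵖ)
    (hφ : ∀ t, ∃ d, φ t = triangular (f t) d) :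
    ∃ D : R →ₗ[k] X →ₗ[k] Y, IsDerivation f D ∧ ∀ t, φ t = triangular (f t) (D t) := by
  let D : R →ₗ[k] X →ₗ[k] Y :=
    LinearMap.mk₂ k (fun t x => ((φ t).unop (x, 0)).2)
      (fun s t x => by rw [map_add, unop_add, LinearMap.add_apply, Prod.snd_add])
      (fun r t x => by rw [map_smul, unop_smul, LinearMap.smul_apply, Prod.smul_snd])
      (fun t x y => by
        rw [← Prod.snd_add, ← map_add, Prod.mk_add_mk, add_zero])
      (fun r t x => by
        rw [← Prod.smul_snd, ← map_smul, Prod.smul_mk, smul_zero])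
  have hD {t : R} {d : X →ₗ[k] Y} (h : φ t = triangular (f t) d) : D t = d := by
    refine LinearMap.ext fun x => ?_
    change ((φ t).unop (x, 0)).2 = d x
    rw [h, triangular_apply, smul_zero, add_zero]
  have key (t : R) : φ t = triangular (f t) (D t) := by
    obtain ⟨d, h⟩ := hφ t
    rw [hD h, h]
  refine ⟨D, fun s t x => ?_, key⟩
  have hst : φ (s * t) = triangular (f (s * t))
      (Algebra.lsmul k k Y (op (f t)) ∘ₗ D s + D t ∘ₗ Algebra.lsmul k k X (op (f s))) := by
    rw [map_mul, key s, key t, map_mul]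
    exact triangular_mul fun x => rfl
  rw [hD hst]
  rfl

theorem exists_triangular_add {f : R →ₐ[k] S} {φ : R →ₐ[k] (Module.End k (X × Y))ᵐᵒᵖ} {s t : R}
    (hs : ∃ d, φ s = triangular (f s) d) (ht : ∃ d, φ t = triangular (f t) d) :
    ∃ d, φ (s + t) = triangular (f (s + t)) d := by
  obtain ⟨d, hs⟩ := hs
  obtain ⟨e, ht⟩ := ht
  exact ⟨d + e, by rw [map_add, hs, ht, map_add, triangular_add]⟩

theorem exists_triangular_mul {f : R →ₐ[k] S} {φ : R →ₐ[k] (Module.End k (X × Y))ᵐᵒᵖ} {s t : R}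
    (hs : ∃ d, φ s = triangular (f s) d) (ht : ∃ d, φ t = triangular (f t) d) :
    ∃ d, φ (s * t) = triangular (f (s * t)) d := by
  obtain ⟨d, hs⟩ := hs
  obtain ⟨e, ht⟩ := ht
  refine ⟨Algebra.lsmul k k Y (op (f t)) ∘ₗ d + e ∘ₗ Algebra.lsmul k k X (op (f s)), ?_⟩
  rw [map_mul, hs, ht, map_mul]
  exact triangular_mul fun x => rfl

theorem triangular_injective {s : S} {d d' : X →ₗ[k] Y} (h : triangular s d = triangular s d') :
    d = d' := LinearMap.ext fun x => by
  have := congrArg (fun g : (Module.End k (X × Y))ᵐᵒᵖ => (g.unop (x, 0)).2) h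
  simpa [triangular_apply] using this

end Triangular

end Derivations

namespace TensorAlg

variable {k Γ B : Type*} [CommRing k] [Ring Γ] [Algebra k Γ]
  [AddCommGroup B] [Module k B] [Module Γ B] [Module Γᵐᵒᵖ B] [IsScalarTower k Γ B]

@[elab_as_elim]
theorem induction {p : TensorAlg k Γ B → Prop} (hof : ∀ x, p (of k Γ B x))
    (hincl : ∀ b, p (incl k Γ B b)) (hadd : ∀ s t, p s → p t → p (s + t))
    (hmul : ∀ s t, p s → p t → p (s * t)) (t : TensorAlg k Γ B) : p t := by
  obtain ⟨t, rfl⟩ := RingQuot.mkAlgHom_surjective k (Rel k Γ B) t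
  change p (proj k Γ B t)
  induction t using FreeAlgebra.induction with
  | grade0 r =>
    rw [AlgHom.commutes, ← AlgHom.commutes (of k Γ B)]
    exact hof _
  | grade1 x =>
    cases x with
    | inl x => exact hof x
    | inr b => exact hincl b
  | mul a b ha hb => rw [map_mul]; exact hmul _ _ ha hb
  | add a b ha hb => rw [map_add]; exact hadd _ _ ha hb

variable {S X Y : Type*} [Ring S] [Algebra k S]
  [AddCommGroup X] [Module k X] [Module Sᵐᵒᵖ X]
  [AddCommGroup Y] [Module k Y] [Module Sᵐᵒᵖ Y]

theorem derivation_ext {f : TensorAlg k Γ B →ₐ[k] S} {D D' : TensorAlg k Γ B →ₗ[k] X →ₗ[k] Y}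
    (hD : IsDerivation f D) (hD' : IsDerivation f D')
    (hof : ∀ x, D (of k Γ B x) = D' (of k Γ B x))
    (hincl : ∀ b, D (incl k Γ B b) = D' (incl k Γ B b)) : D = D' := by
  refine LinearMap.ext fun t => ?_
  induction t using TensorAlg.induction with
  | hof x => exact hof x
  | hincl b => exact hincl b
  | hadd s t hs ht => rw [map_add, map_add, hs, ht]
  | hmul s t hs ht => exact LinearMap.ext fun x => by rw [hD, hD', hs, ht]

variable [IsScalarTower k Sᵐᵒᵖ X] [IsScalarTower k Sᵐᵒᵖ Y]

/-- A derivation on `Γ` and a compatible map on the bimodule `B` extend to a derivation on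
`T_Γ(B)`. -/
theorem exists_derivation (f : TensorAlg k Γ B →ₐ[k] S) (δ : Γ →ₗ[k] X →ₗ[k] Y)
    (ε : B →ₗ[k] X →ₗ[k] Y) (hδ : IsDerivation (f.comp (of k Γ B)) δ)
    (hl : ∀ (g : Γ) b x, ε (g • b) x =
      op (f (incl k Γ B b)) • δ g x + ε b (op (f (of k Γ B g)) • x))
    (hr : ∀ (g : Γ) b x, ε (op g • b) x =
      op (f (of k Γ B g)) • ε b x + δ g (op (f (incl k Γ B b)) • x)) :
    ∃ D : TensorAlg k Γ B →ₗ[k] X →ₗ[k] Y, IsDerivation f D ∧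
      (∀ x, D (of k Γ B x) = δ x) ∧ ∀ b, D (incl k Γ B b) = ε b := by
  have hδ1 : δ 1 = 0 := LinearMap.ext fun x => hδ.map_one x
  let F : Γ →ₐ[k] (Module.End k (X × Y))ᵐᵒᵖ :=
    AlgHom.ofLinearMap (triangularMap (f.toLinearMap ∘ₗ (of k Γ B).toLinearMap) δ)
      (by
        change triangular (f (of k Γ B 1)) (δ 1) = 1
        rw [hδ1, map_one, map_one, triangular_one])
      (fun a b => by
        change triangular (f (of k Γ B (a * b))) (δ (a * b)) =
          triangular (f (of k Γ B a)) (δ a) * triangular (f (of k Γ B b)) (δ b)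
        rw [map_mul, map_mul]
        exact (triangular_mul (hδ a b)).symm)
  let G : B →ₗ[k] (Module.End k (X × Y))ᵐᵒᵖ :=
    triangularMap (f.toLinearMap ∘ₗ incl k Γ B) ε
  let φ : TensorAlg k Γ B →ₐ[k] (Module.End k (X × Y))ᵐᵒᵖ := lift F G
    (fun g b => by
      change triangular (f (incl k Γ B (g • b))) (ε (g • b)) =
        triangular (f (of k Γ B g)) (δ g) * triangular (f (incl k Γ B b)) (ε b)
      rw [triangular_mul (hl g b), incl_smul_left, map_mul])
    (fun g b => by
      change triangular (f (incl k Γ B (op g • b))) (ε (op g • b)) =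
        triangular (f (incl k Γ B b)) (ε b) * triangular (f (of k Γ B g)) (δ g)
      rw [triangular_mul (hr g b), incl_smul_right, map_mul])
  have φof (g : Γ) : φ (of k Γ B g) = triangular (f (of k Γ B g)) (δ g) :=
    lift_of F G _ _ g
  have φincl (b : B) : φ (incl k Γ B b) = triangular (f (incl k Γ B b)) (ε b) :=
    lift_incl F G _ _ b
  obtain ⟨D, hD, h⟩ := exists_derivation_of_triangular f φ fun t => by
    induction t using TensorAlg.induction with
    | hof g => exact ⟨_, φof g⟩
    | hincl b => exact ⟨_, φincl b⟩
    | hadd s t hs ht => exact exists_triangular_add hs ht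
    | hmul s t hs ht => exact exists_triangular_mul hs ht
  exact ⟨D, hD, fun g => triangular_injective ((h _).symm.trans (φof g)),
    fun b => triangular_injective ((h _).symm.trans (φincl b))⟩

end TensorAlg

/-! ### Derivations and noncommutative 1-forms -/

section Forms

variable {k A R S : Type*} [CommRing k] [Ring A] [Ring R] [Ring S]
  [Algebra k A] [Algebra k R] [Algebra k S] {ι : A →ₐ[k] R} {f : R →ₐ[k] S}

theorem Omega.d_mul (s t : R) : Omega.d ι (s * t) = s • Omega.d ι t + op t • Omega.d ι s := by
  apply Omega.val_injective
  rw [map_add, Omega.val_smul_left, Omega.val_smul_right, Omega.val_d, Omega.val_d, Omega.val_d,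
    smul_sub, smul_sub, BT.smul_tmul_left, BT.smul_tmul_left, BT.smul_tmul_right,
    BT.smul_tmul_right]
  simp

theorem Omega.d_base (a : A) : Omega.d ι (ι a) = 0 := by
  apply Omega.val_injective
  have := BT.tmul_balanced (f := ι) (g := ι) (1 : R) a (1 : R)
  rw [Omega.val_d, map_zero, sub_eq_zero]
  simpa using this.symm

variable (ι) in
/-- The differential `t ↦ d t` as a linear map. -/
def Omega.dLin : R →ₗ[k] Omega ι where
  toFun := Omega.d ι
  map_add' s t := Omega.val_injective (by
    simp only [map_add, Omega.val_d, BT.tmul_add, BT.add_tmul]; abel)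
  map_smul' r t := Omega.val_injective (by
    simp only [map_smul, Omega.val_d, BT.tmul_smulk, BT.smulk_tmul, smul_sub, RingHom.id_apply])

variable (ι) in
/-- The retraction `s ⊗ t ↦ s dt` of the inclusion `Ω → R ⊗_A R`. -/
def Omega.retract : BT ι ι R R →ₗ[k] Omega ι :=
  BT.lift
    (LinearMap.mk₂ k (fun s t => s • Omega.dLin ι t)
      (fun _ _ _ => add_smul _ _ _) (fun _ _ _ => smul_assoc _ _ _)
      (fun _ _ _ => by rw [map_add, smul_add])
      (fun _ _ _ => by rw [map_smul, smul_comm]))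
    (fun s a t => by
      change (s * ι a) • Omega.d ι t = s • Omega.d ι (ι a * t)
      rw [Omega.d_mul, Omega.d_base, smul_zero, add_zero, mul_smul])

theorem Omega.retract_tmul (s t : R) :
    Omega.retract ι (BT.tmul ι ι s t) = s • Omega.d ι t := rfl

theorem Omega.val_retract (z : BT ι ι R R) :
    Omega.val ι (Omega.retract ι z) = z - BT.tmul ι ι (mulMap ι z) 1 := by
  induction z using BT.induction with
  | h0 => simp [BT.zero_tmul]
  | ht s t =>
    rw [Omega.retract_tmul, Omega.val_smul_left, Omega.val_d, smul_sub, BT.smul_tmul_left,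
      BT.smul_tmul_left]
    simp
  | ha a b ha hb => rw [map_add, map_add, ha, hb, map_add, BT.add_tmul]; abel

theorem Omega.retract_val (z : Omega ι) : Omega.retract ι (Omega.val ι z) = z :=
  Omega.val_injective (by rw [Omega.val_retract, Omega.mulMap_val, BT.zero_tmul, sub_zero])

/-- The elements `s dt` span `Ω`. -/
@[elab_as_elim]
theorem Omega.induction {p : Omega ι → Prop} (z : Omega ι) (h0 : p 0)
    (ht : ∀ s t : R, p (s • Omega.d ι t)) (ha : ∀ a b, p a → p b → p (a + b)) : p z := by
  rw [← Omega.retract_val z]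
  induction Omega.val ι z using BT.induction with
  | h0 => rwa [map_zero]
  | ht s t => exact ht s t
  | ha a b ha' hb' => rw [map_add]; exact ha _ _ ha' hb'

variable {X Y : Type*}
  [AddCommGroup X] [Module k X] [Module Sᵐᵒᵖ X] [IsScalarTower k Sᵐᵒᵖ X]
  [AddCommGroup Y] [Module k Y] [Module Sᵐᵒᵖ Y]

variable (f) in
/-- For a derivation `D` vanishing on `A`, the bilinear map `(x, s ⊗ t) ↦ D(t)(x s)`. Its
restriction to `Ω` is the homomorphism corresponding to `D`. -/
def derivationForm (D : R →ₗ[k] X →ₗ[k] Y) (hD : IsDerivation f D) (hA : ∀ a, D (ι a) = 0) :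
    X →ₗ[k] BT ι ι R R →ₗ[k] Y where
  toFun x := BT.lift
    (LinearMap.mk₂ k (fun s t => D t (op (f s) • x))
      (fun _ _ _ => by rw [map_add, op_add, add_smul, map_add])
      (fun _ _ _ => by rw [map_smul f, op_smul, smul_assoc, map_smul])
      (fun _ _ _ => by rw [map_add, LinearMap.add_apply])
      (fun _ _ _ => by rw [map_smul D, LinearMap.smul_apply]))
    (fun s a t => by
      change D t (op (f (s * ι a)) • x) = D (ι a * t) (op (f s) • x)
      rw [hD, hA, LinearMap.zero_apply, smul_zero, zero_add, map_mul, op_mul, mul_smul])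
  map_add' x y := BT.hom_ext fun s t => by
    change D t (op (f s) • (x + y)) = D t (op (f s) • x) + D t (op (f s) • y)
    rw [smul_add, map_add]
  map_smul' r x := BT.hom_ext fun s t => by
    change D t (op (f s) • r • x) = r • D t (op (f s) • x)
    rw [smul_comm, map_smul]

variable {D : R →ₗ[k] X →ₗ[k] Y} (hD : IsDerivation f D) (hA : ∀ a, D (ι a) = 0)

theorem derivationForm_tmul (x : X) (s t : R) :
    derivationForm f D hD hA x (BT.tmul ι ι s t) = D t (op (f s) • x) := rfl

theorem derivationForm_d (x : X) (t : R) :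
    derivationForm f D hD hA x (Omega.val ι (Omega.d ι t)) = D t x := by
  rw [Omega.val_d, map_sub, derivationForm_tmul, derivationForm_tmul, hD.map_one, map_one, op_one,
    one_smul, sub_zero]

theorem derivationForm_smul_left (x : X) (r : R) (z : BT ι ι R R) :
    derivationForm f D hD hA x (r • z) = derivationForm f D hD hA (op (f r) • x) z := by
  induction z using BT.induction with
  | h0 => simp
  | ht s t =>
    rw [BT.smul_tmul_left, derivationForm_tmul, derivationForm_tmul, smul_eq_mul, map_mul, op_mul,
      mul_smul]
  | ha a b ha hb => rw [smul_add, map_add, map_add, ha, hb]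

theorem derivationForm_smul_right (x : X) (r : R) (z : BT ι ι R R) :
    derivationForm f D hD hA x (op r • z) =
      op (f r) • derivationForm f D hD hA x z + D r (op (f (mulMap ι z)) • x) := by
  induction z using BT.induction with
  | h0 => simp
  | ht s t =>
    rw [BT.smul_tmul_right, derivationForm_tmul, derivationForm_tmul, mulMap_tmul, op_smul_eq_mul,
      hD, map_mul, op_mul, mul_smul]
  | ha a b ha hb =>
    rw [smul_add, map_add, map_add, ha, hb, smul_add, map_add, map_add, op_add, add_smul, map_add]
    abel

theorem derivationForm_val_smul_right (x : X) (r : R) (z : Omega ι) :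
    derivationForm f D hD hA x (Omega.val ι (op r • z)) =
      op (f r) • derivationForm f D hD hA x (Omega.val ι z) := by
  rw [Omega.val_smul_right, derivationForm_smul_right, Omega.mulMap_val, map_zero, op_zero,
    zero_smul, map_zero, add_zero]

end Forms

/-! ### Homomorphisms of right modules out of balanced tensor products -/

namespace BT

variable {k C S R Q : Type*} [CommRing k] [Ring C] [Ring S] [Ring R] [Ring Q]
  [Algebra k C] [Algebra k S] [Algebra k R] [Algebra k Q] {f : C →ₐ[k] S} {g : C →ₐ[k] R}
  {X Y Z : Type*} [AddCommGroup X] [Module k X] [Module Sᵐᵒᵖ X]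
  [AddCommGroup Y] [Module k Y] [Module R Y] [Module Qᵐᵒᵖ Y] [IsScalarTower k Qᵐᵒᵖ Y]
  [SMulCommClass R Qᵐᵒᵖ Y] [AddCommGroup Z] [Module k Z] [Module Qᵐᵒᵖ Z]

/-- A balanced map which is linear over `Q` in the second variable induces a homomorphism of right
`Q`-modules on the tensor product. -/
def liftRight (φ : X →ₗ[k] Y →ₗ[k] Z)
    (h : ∀ (x : X) (c : C) (y : Y), φ (op (f c) • x) y = φ x (g c • y))
    (hQ : ∀ (x : X) (q : Qᵐᵒᵖ) (y : Y), φ x (q • y) = q • φ x y) : BT f g X Y →ₗ[Qᵐᵒᵖ] Z where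
  toFun := lift φ h
  map_add' := map_add _
  map_smul' q z := by
    induction z using BT.induction with
    | h0 => simp
    | ht x y => exact hQ x q y
    | ha a b ha hb => rw [smul_add, map_add, ha, hb, map_add, smul_add]

omit [Module k Z] in
theorem hom_ext_right {φ ψ : BT f g X Y →ₗ[Qᵐᵒᵖ] Z}
    (h : ∀ x y, φ (tmul f g x y) = ψ (tmul f g x y)) : φ = ψ := by
  refine LinearMap.ext fun z => ?_
  induction z using BT.induction with
  | h0 => simp
  | ht x y => exact h x y
  | ha a b ha hb => rw [map_add, map_add, ha, hb]

variable [IsScalarTower k Qᵐᵒᵖ Z]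

/-- A homomorphism `h : X → Z` of right `C`-modules, where `Z` is a right `Q`-module, induces the
homomorphism `x ⊗ q ↦ h(x) q` on `X ⊗_C Q`. -/
def induce (g : C →ₐ[k] Q) (h : X →ₗ[k] Z) (hC : ∀ c x, h (op (f c) • x) = op (g c) • h x) :
    BT f g X Q →ₗ[Qᵐᵒᵖ] Z :=
  liftRight
    (LinearMap.mk₂ k (fun x q => op q • h x)
      (fun _ _ _ => by rw [map_add, smul_add])
      (fun _ _ _ => by rw [map_smul, smul_comm])
      (fun _ _ _ => by rw [op_add, add_smul])
      (fun _ _ _ => by rw [op_smul, smul_assoc]))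
    (fun x c q => by
      simp only [LinearMap.mk₂_apply]
      rw [hC, smul_eq_mul, op_mul, mul_smul])
    (fun x q y => by
      simp only [LinearMap.mk₂_apply]
      rw [← mul_smul]; rfl)

theorem induce_tmul (g : C →ₐ[k] Q) (h : X →ₗ[k] Z)
    (hC : ∀ c x, h (op (f c) • x) = op (g c) • h x) (x : X) (q : Q) :
    induce g h hC (tmul f g x q) = op q • h x := rfl

end BT

/-! ### The standard complex of a right `Π`-module -/

section StandardComplex

variable {k Λ W A : Type*} [CommRing k] [Ring Λ] [Algebra k Λ]
  [AddCommGroup W] [Module k W] [Module Λ W] [Module Λᵐᵒᵖ W]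
  [IsScalarTower k Λ W] [IsScalarTower k Λᵐᵒᵖ W] [SMulCommClass Λ Λᵐᵒᵖ W]
  [Ring A] [Algebra k A] {ι : A →ₐ[k] Λ} {c : W}
  {X : Type w} [AddCommGroup X] [Module k X]
  [Module (Preproj k Λ c)ᵐᵒᵖ X] [IsScalarTower k (Preproj k Λ c)ᵐᵒᵖ X]

theorem toPreproj_of (l : Λ) :
    toPreproj k Λ c (TensorAlg.of k Λ W l) = Preproj.of k Λ c l := TensorAlg.lift_of _ _ _ _ l

theorem toPreproj_incl (u : W) :
    toPreproj k Λ c (TensorAlg.incl k Λ W u) = Preproj.incl k Λ c (PiOne.mk k Λ c u) :=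
  TensorAlg.lift_incl _ _ _ _ u

theorem toPreproj_surjective : Function.Surjective (toPreproj k Λ c) := fun p => by
  change TensorAlg k Λ (PiOne k Λ c) at p
  induction p using TensorAlg.induction with
  | hof x => exact ⟨_, toPreproj_of x⟩
  | hincl b =>
    obtain ⟨u, rfl⟩ := PiOne.mk_surjective b
    exact ⟨_, toPreproj_incl u⟩
  | hadd s t hs ht =>
    obtain ⟨s, rfl⟩ := hs
    obtain ⟨t, rfl⟩ := ht
    exact ⟨s + t, map_add _ _ _⟩
  | hmul s t hs ht =>
    obtain ⟨s, rfl⟩ := hs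
    obtain ⟨t, rfl⟩ := ht
    exact ⟨s * t, map_mul _ _ _⟩

theorem PiOne.mk_self : PiOne.mk k Λ c c = 0 :=
  (Submodule.Quotient.mk_eq_zero _).2 (Submodule.subset_span ⟨1, 1, by simp⟩)

theorem toPreproj_incl_self : toPreproj k Λ c (TensorAlg.incl k Λ W c) = 0 := by
  rw [toPreproj_incl, PiOne.mk_self, map_zero]

theorem elemP_add_left (x y : X) (p : Preproj k Λ c) :
    elemP ι c (x + y) p = elemP ι c x p + elemP ι c y p := BT.add_tmul x y p

theorem elemP_add_right (x : X) (p q : Preproj k Λ c) :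
    elemP ι c x (p + q) = elemP ι c x p + elemP ι c x q := BT.tmul_add x p q

theorem elemP_smulk_left (r : k) (x : X) (p : Preproj k Λ c) :
    elemP ι c (r • x) p = r • elemP ι c x p := BT.smulk_tmul r x p

theorem elemP_smulk_right (r : k) (x : X) (p : Preproj k Λ c) :
    elemP ι c x (r • p) = r • elemP ι c x p := BT.tmul_smulk r x p

theorem smul_elemP (x : X) (p q : Preproj k Λ c) :
    op q • elemP ι c x p = elemP ι c x (p * q) := rfl

theorem elemP_balanced (x : X) (a : A) (p : Preproj k Λ c) :
    elemP ι c (op (baseToPi ι c a) • x) p = elemP ι c x (baseToPi ι c a * p) :=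
  BT.tmul_balanced x a p

@[elab_as_elim]
theorem TermP.induction {p : TermP ι c X → Prop} (z : TermP ι c X) (h0 : p 0)
    (ht : ∀ x q, p (elemP ι c x q)) (ha : ∀ a b, p a → p b → p (a + b)) : p z :=
  BT.induction z h0 ht ha

theorem elemXO_add_left (x y : X) (z : OmegaT W ι) :
    elemXO ι c (x + y) z = elemXO ι c x z + elemXO ι c y z := BT.add_tmul x y z

theorem elemXO_add_right (x : X) (z z' : OmegaT W ι) :
    elemXO ι c x (z + z') = elemXO ι c x z + elemXO ι c x z' := BT.tmul_add x z z'

theorem elemXO_smulk_left (r : k) (x : X) (z : OmegaT W ι) :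
    elemXO ι c (r • x) z = r • elemXO ι c x z := BT.smulk_tmul r x z

theorem elemXO_smulk_right (r : k) (x : X) (z : OmegaT W ι) :
    elemXO ι c x (r • z) = r • elemXO ι c x z := BT.tmul_smulk r x z

theorem smul_elemXO (x : X) (z : OmegaT W ι) (t : TensorAlg k Λ W) :
    op t • elemXO ι c x z = elemXO ι c x (op t • z) := rfl

theorem elemXO_balanced (x : X) (t : TensorAlg k Λ W) (z : OmegaT W ι) :
    elemXO ι c (op (toPreproj k Λ c t) • x) z = elemXO ι c x (t • z) :=
  BT.tmul_balanced (f := toPreproj k Λ c) (g := AlgHom.id k _) x t z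

@[elab_as_elim]
theorem TermXO.induction {p : TermXO ι c X → Prop} (z : TermXO ι c X) (h0 : p 0)
    (ht : ∀ x z, p (elemXO ι c x z)) (ha : ∀ a b, p a → p b → p (a + b)) : p z :=
  BT.induction z h0 ht ha

/-- The tensor `ζ ⊗ p` of `ζ ∈ X ⊗_T Ω̃` with `p ∈ Π`. -/
def tmulQ (z : TermXO ι c X) (p : Preproj k Λ c) : TermQ ι c X :=
  BT.tmul (AlgHom.id k (TensorAlg k Λ W)) (toPreproj k Λ c) z p

theorem tmulQ_elemXO (x : X) (z : OmegaT W ι) (p : Preproj k Λ c) :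
    tmulQ (elemXO ι c x z) p = elemQ ι c x z p := rfl

theorem tmulQ_add_left (z z' : TermXO ι c X) (p : Preproj k Λ c) :
    tmulQ (z + z') p = tmulQ z p + tmulQ z' p := BT.add_tmul z z' p

theorem tmulQ_zero_left (p : Preproj k Λ c) :
    tmulQ (0 : TermXO ι c X) p = 0 := BT.zero_tmul p

theorem tmulQ_smulk_left (r : k) (z : TermXO ι c X) (p : Preproj k Λ c) :
    tmulQ (r • z) p = r • tmulQ z p := BT.smulk_tmul r z p

theorem tmulQ_balanced (z : TermXO ι c X) (t : TensorAlg k Λ W) (p : Preproj k Λ c) :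
    tmulQ (op t • z) p = tmulQ z (toPreproj k Λ c t * p) :=
  BT.tmul_balanced (f := AlgHom.id k _) (g := toPreproj k Λ c) z t p

theorem elemQ_add_left (x y : X) (z : OmegaT W ι) (p : Preproj k Λ c) :
    elemQ ι c (x + y) z p = elemQ ι c x z p + elemQ ι c y z p := by
  simp only [← tmulQ_elemXO, elemXO_add_left, tmulQ_add_left]

theorem elemQ_add_mid (x : X) (z z' : OmegaT W ι) (p : Preproj k Λ c) :
    elemQ ι c x (z + z') p = elemQ ι c x z p + elemQ ι c x z' p := by
  simp only [← tmulQ_elemXO, elemXO_add_right, tmulQ_add_left]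

theorem elemQ_smulk_left (r : k) (x : X) (z : OmegaT W ι) (p : Preproj k Λ c) :
    elemQ ι c (r • x) z p = r • elemQ ι c x z p := by
  simp only [← tmulQ_elemXO, elemXO_smulk_left, tmulQ_smulk_left]

theorem elemQ_smulk_mid (r : k) (x : X) (z : OmegaT W ι) (p : Preproj k Λ c) :
    elemQ ι c x (r • z) p = r • elemQ ι c x z p := by
  simp only [← tmulQ_elemXO, elemXO_smulk_right, tmulQ_smulk_left]

theorem elemQ_zero_mid (x : X) (p : Preproj k Λ c) : elemQ ι c x (0 : OmegaT W ι) p = 0 := by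
  simpa using elemQ_smulk_mid (0 : k) x (0 : OmegaT W ι) p

theorem smul_elemQ (x : X) (z : OmegaT W ι) (p q : Preproj k Λ c) :
    op q • elemQ ι c x z p = elemQ ι c x z (p * q) := rfl

theorem elemQ_smul_left (x : X) (t : TensorAlg k Λ W) (z : OmegaT W ι) (p : Preproj k Λ c) :
    elemQ ι c x (t • z) p = elemQ ι c (op (toPreproj k Λ c t) • x) z p := by
  rw [← tmulQ_elemXO, ← tmulQ_elemXO, elemXO_balanced]

theorem elemQ_smul_right (x : X) (t : TensorAlg k Λ W) (z : OmegaT W ι) (p : Preproj k Λ c) :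
    elemQ ι c x (op t • z) p = elemQ ι c x z (toPreproj k Λ c t * p) := by
  rw [← tmulQ_elemXO, ← tmulQ_elemXO, ← tmulQ_balanced, smul_elemXO]

/-- The elements `x ⊗ dt ⊗ p` span `X ⊗_T Ω̃ ⊗_T Π`. -/
@[elab_as_elim]
theorem TermQ.induction {q : TermQ ι c X → Prop} (z : TermQ ι c X) (h0 : q 0)
    (ht : ∀ x t p, q (elemQ ι c x (Omega.d (baseToT W ι) t) p))
    (ha : ∀ a b, q a → q b → q (a + b)) : q z := by
  refine BT.induction (p := q) z h0 (fun y p => ?_) ha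
  change q (tmulQ y p)
  induction y using TermXO.induction with
  | h0 => rwa [tmulQ_zero_left]
  | ht x ω =>
    change q (elemQ ι c x ω p)
    induction ω using Omega.induction with
    | h0 => rwa [elemQ_zero_mid]
    | ht s t => rw [elemQ_smul_left]; exact ht _ _ _
    | ha a b hx hy => rw [elemQ_add_mid]; exact ha _ _ hx hy
  | ha a b hx hy => rw [tmulQ_add_left]; exact ha _ _ hx hy

variable {Y : Type*} [AddCommGroup Y] [Module k Y] [Module (Preproj k Λ c)ᵐᵒᵖ Y]
  [IsScalarTower k (Preproj k Λ c)ᵐᵒᵖ Y]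

/-- The homomorphism `x ⊗ p ↦ h(x) p` for a homomorphism `h : X → Y` of right `A`-modules. -/
def TermP.desc (h : X →ₗ[k] Y)
    (hA : ∀ a x, h (op (baseToPi ι c a) • x) = op (baseToPi ι c a) • h x) :
    TermP ι c X →ₗ[(Preproj k Λ c)ᵐᵒᵖ] Y :=
  BT.induce (f := baseToPi ι c) (baseToPi ι c) h hA

/-- The map `X ⊗_T Ω̃ → Y` induced by a derivation. -/
def TermXO.desc (D : TensorAlg k Λ W →ₗ[k] X →ₗ[k] Y) (hD : IsDerivation (toPreproj k Λ c) D)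
    (hA : ∀ a, D (baseToT W ι a) = 0) : TermXO ι c X →ₗ[k] Y :=
  BT.lift ((derivationForm (toPreproj k Λ c) D hD hA).compl₂ (Omega.val (baseToT W ι)))
    fun x t _ => (derivationForm_smul_left hD hA x t _).symm

theorem TermXO.desc_smul (D : TensorAlg k Λ W →ₗ[k] X →ₗ[k] Y)
    (hD : IsDerivation (toPreproj k Λ c) D) (hA : ∀ a, D (baseToT W ι a) = 0)
    (t : TensorAlg k Λ W) (z : TermXO ι c X) :
    TermXO.desc D hD hA (op t • z) = op (toPreproj k Λ c t) • TermXO.desc D hD hA z := by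
  induction z using TermXO.induction with
  | h0 => rw [smul_zero, map_zero, smul_zero]
  | ht x z => exact derivationForm_val_smul_right hD hA x t z
  | ha a b ha hb => rw [smul_add, map_add, ha, hb, map_add, smul_add]

/-- Derivations `D : T → Hom_k(X, Y)` over `A` correspond to homomorphisms of right `Π`-modules
`X ⊗_T Ω̃ ⊗_T Π → Y`, by `x ⊗ dt ⊗ p ↦ D(t)(x) p`. -/
def TermQ.desc (D : TensorAlg k Λ W →ₗ[k] X →ₗ[k] Y) (hD : IsDerivation (toPreproj k Λ c) D)
    (hA : ∀ a, D (baseToT W ι a) = 0) : TermQ ι c X →ₗ[(Preproj k Λ c)ᵐᵒᵖ] Y :=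
  BT.induce (f := AlgHom.id k (TensorAlg k Λ W)) (toPreproj k Λ c) (TermXO.desc D hD hA)
    (TermXO.desc_smul D hD hA)

theorem TermQ.desc_elem (D : TensorAlg k Λ W →ₗ[k] X →ₗ[k] Y)
    (hD : IsDerivation (toPreproj k Λ c) D) (hA : ∀ a, D (baseToT W ι a) = 0)
    (x : X) (t : TensorAlg k Λ W) (p : Preproj k Λ c) :
    TermQ.desc D hD hA (elemQ ι c x (Omega.d (baseToT W ι) t) p) = op p • D t x := by
  rw [← derivationForm_d hD hA]
  rfl

variable (ι c X) in
/-- The derivation `t ↦ (x ↦ x ⊗ dt ⊗ 1)` with values in `X ⊗_T Ω̃ ⊗_T Π`. -/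
def universalDerivation : TensorAlg k Λ W →ₗ[k] X →ₗ[k] TermQ ι c X :=
  LinearMap.mk₂ k (fun t x => elemQ ι c x (Omega.dLin (baseToT W ι) t) 1)
    (fun _ _ _ => by rw [map_add, elemQ_add_mid])
    (fun _ _ _ => by rw [map_smul, elemQ_smulk_mid])
    (fun _ _ _ => elemQ_add_left _ _ _ _)
    (fun _ _ _ => elemQ_smulk_left _ _ _ _)

theorem universalDerivation_apply (t : TensorAlg k Λ W) (x : X) :
    universalDerivation ι c X t x = elemQ ι c x (Omega.d (baseToT W ι) t) 1 := rfl

theorem isDerivation_universalDerivation :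
    IsDerivation (toPreproj k Λ c) (universalDerivation ι c X) := fun s t x => by
  simp only [universalDerivation_apply, Omega.d_mul, elemQ_add_mid, elemQ_smul_left,
    elemQ_smul_right, smul_elemQ, mul_one, one_mul]
  rw [add_comm]

theorem universalDerivation_base (a : A) : universalDerivation ι c X (baseToT W ι a) = 0 :=
  LinearMap.ext fun x => by
    rw [universalDerivation_apply, Omega.d_base, elemQ_zero_mid, LinearMap.zero_apply]

variable (ι c X) in
/-- The derivation `t ↦ (x ↦ x ⊗ t - x t ⊗ 1)` with values in `X ⊗_A Π`. -/
def innerDerivation : TensorAlg k Λ W →ₗ[k] X →ₗ[k] TermP ι c X :=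
  LinearMap.mk₂ k
    (fun t x => elemP ι c x (toPreproj k Λ c t) - elemP ι c (op (toPreproj k Λ c t) • x) 1)
    (fun _ _ _ => by
      rw [map_add, elemP_add_right, op_add, add_smul, elemP_add_left]; abel)
    (fun _ _ _ => by
      rw [map_smul, elemP_smulk_right, op_smul, smul_assoc, elemP_smulk_left, smul_sub])
    (fun _ _ _ => by
      rw [elemP_add_left, smul_add, elemP_add_left]; abel)
    (fun _ _ _ => by
      rw [elemP_smulk_left, smul_comm, elemP_smulk_left, smul_sub])

theorem innerDerivation_apply (t : TensorAlg k Λ W) (x : X) :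
    innerDerivation ι c X t x =
      elemP ι c x (toPreproj k Λ c t) - elemP ι c (op (toPreproj k Λ c t) • x) 1 := rfl

theorem isDerivation_innerDerivation :
    IsDerivation (toPreproj k Λ c) (innerDerivation ι c X) := fun s t x => by
  simp only [innerDerivation_apply, map_mul, smul_sub, smul_elemP, one_mul, op_mul, mul_smul]
  abel

theorem innerDerivation_base (a : A) : innerDerivation ι c X (baseToT W ι a) = 0 :=
  LinearMap.ext fun x => by
    have h := elemP_balanced (ι := ι) (c := c) x a 1
    rw [mul_one] at h
    rw [innerDerivation_apply, LinearMap.zero_apply, sub_eq_zero]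
    exact h.symm

variable (ι c X) in
/-- The augmentation `x ⊗ p ↦ x p`. -/
def standardD₀ : TermP ι c X →ₗ[(Preproj k Λ c)ᵐᵒᵖ] X := TermP.desc LinearMap.id fun _ _ => rfl

variable (ι c X) in
/-- The map `x ⊗ dt ⊗ p ↦ x ⊗ t p - x t ⊗ p`. -/
def standardD₁ : TermQ ι c X →ₗ[(Preproj k Λ c)ᵐᵒᵖ] TermP ι c X :=
  TermQ.desc (innerDerivation ι c X) isDerivation_innerDerivation innerDerivation_base

variable (X) in
/-- The map `x ⊗ p ↦ x ⊗ dc ⊗ p`, for an element `c` commuting with `A`. -/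
def standardD₂ (hc : ∀ a, ι a • c = op (ι a) • c) :
    TermP ι c X →ₗ[(Preproj k Λ c)ᵐᵒᵖ] TermQ ι c X :=
  TermP.desc (universalDerivation ι c X (TensorAlg.incl k Λ W c)) fun a x => by
    have h : baseToT W ι a * TensorAlg.incl k Λ W c = TensorAlg.incl k Λ W c * baseToT W ι a := by
      change TensorAlg.of k Λ W (ι a) * _ = _ * TensorAlg.of k Λ W (ι a)
      rw [← TensorAlg.incl_smul_left, ← TensorAlg.incl_smul_right, hc]
    have h1 := isDerivation_universalDerivation (ι := ι) (c := c) (baseToT W ι a)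
      (TensorAlg.incl k Λ W c) x
    have h2 := isDerivation_universalDerivation (ι := ι) (c := c) (TensorAlg.incl k Λ W c)
      (baseToT W ι a) x
    rw [universalDerivation_base, LinearMap.zero_apply, smul_zero, zero_add, h] at h1
    rw [universalDerivation_base, LinearMap.zero_apply, add_zero, h1] at h2
    exact h2

theorem standardD₀_elem (x : X) (p : Preproj k Λ c) :
    standardD₀ ι c X (elemP ι c x p) = op p • x := rfl

theorem standardD₁_elem (x : X) (t : TensorAlg k Λ W) (p : Preproj k Λ c) :
    standardD₁ ι c X (elemQ ι c x (Omega.d (baseToT W ι) t) p) =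
      elemP ι c x (toPreproj k Λ c t * p) - elemP ι c (op (toPreproj k Λ c t) • x) p := by
  rw [standardD₁, TermQ.desc_elem, innerDerivation_apply, smul_sub, smul_elemP, smul_elemP, one_mul]

theorem standardD₂_elem (hc : ∀ a, ι a • c = op (ι a) • c) (x : X) (p : Preproj k Λ c) :
    standardD₂ X hc (elemP ι c x p) =
      elemQ ι c x (Omega.d (baseToT W ι) (TensorAlg.incl k Λ W c)) p := by
  change op p • elemQ ι c x (Omega.d (baseToT W ι) (TensorAlg.incl k Λ W c)) 1 = _
  rw [smul_elemQ, one_mul]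

theorem standardD₀_surjective : Function.Surjective (standardD₀ ι c X) := fun x =>
  ⟨elemP ι c x 1, by rw [standardD₀_elem, op_one, one_smul]⟩

/-- Modulo the image of `d₁`, every `z` is congruent to `d₀(z) ⊗ 1`. -/
theorem exact_standardD₁_standardD₀ :
    Function.Exact (standardD₁ ι c X) (standardD₀ ι c X) := by
  have h10 (z : TermQ ι c X) : standardD₀ ι c X (standardD₁ ι c X z) = 0 := by
    induction z using TermQ.induction with
    | h0 => rw [map_zero, map_zero]
    | ht x t p =>
      rw [standardD₁_elem, map_sub, standardD₀_elem, standardD₀_elem, op_mul, mul_smul, sub_self]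
    | ha a b ha hb => rw [map_add, map_add, ha, hb, add_zero]
  have h (z : TermP ι c X) : z - elemP ι c (standardD₀ ι c X z) 1 ∈
      LinearMap.range (standardD₁ ι c X) := by
    induction z using TermP.induction with
    | h0 =>
      rw [map_zero, zero_sub, show elemP ι c (0 : X) 1 = 0 from BT.zero_tmul _, neg_zero]
      exact zero_mem _
    | ht x p =>
      obtain ⟨t, rfl⟩ := toPreproj_surjective p
      exact ⟨_, by rw [standardD₁_elem x t 1, standardD₀_elem, mul_one]⟩
    | ha a b ha hb =>
      rw [map_add, elemP_add_left, add_sub_add_comm]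
      exact add_mem ha hb
  intro z
  refine ⟨fun hz => ?_, ?_⟩
  · have := h z
    rwa [hz, show elemP ι c (0 : X) 1 = 0 from BT.zero_tmul _, sub_zero] at this
  · rintro ⟨y, rfl⟩
    exact h10 y

/-- A derivation on `T` which vanishes on `c` descends to `Π`. -/
theorem IsDerivation.exists_preproj {D : TensorAlg k Λ W →ₗ[k] X →ₗ[k] Y}
    (hD : IsDerivation (toPreproj k Λ c) D) (hc : D (TensorAlg.incl k Λ W c) = 0) :
    ∃ D' : Preproj k Λ c →ₗ[k] X →ₗ[k] Y, IsDerivation (AlgHom.id k _) D' ∧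
      ∀ t, D' (toPreproj k Λ c t) = D t := by
  have hle : bimodSpan k Λ c ≤ LinearMap.ker (D ∘ₗ TensorAlg.incl k Λ W) := by
    refine Submodule.span_le.2 ?_
    rintro _ ⟨l, m, rfl⟩
    refine LinearMap.ext fun x => ?_
    rw [LinearMap.comp_apply, TensorAlg.incl_smul_left, TensorAlg.incl_smul_right, hD, hD, hc,
      map_mul, toPreproj_incl_self]
    simp
  let ε : PiOne k Λ c →ₗ[k] X →ₗ[k] Y := (bimodSpan k Λ c).liftQ (D ∘ₗ TensorAlg.incl k Λ W) hle
  obtain ⟨D', hD', h1, h2⟩ := TensorAlg.exists_derivation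
    (AlgHom.id k (Preproj k Λ c) : TensorAlg k Λ (PiOne k Λ c) →ₐ[k] Preproj k Λ c)
    (D ∘ₗ (TensorAlg.of k Λ W).toLinearMap) ε
    (fun l m x => by
      change D (TensorAlg.of k Λ W (l * m)) x = _
      rw [map_mul, hD, toPreproj_of, toPreproj_of]
      rfl)
    (fun l b x => by
      obtain ⟨u, rfl⟩ := PiOne.mk_surjective b
      change D (TensorAlg.incl k Λ W (l • u)) x = _
      rw [TensorAlg.incl_smul_left, hD, toPreproj_of, toPreproj_incl]
      rfl)
    (fun l b x => by
      obtain ⟨u, rfl⟩ := PiOne.mk_surjective b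
      change D (TensorAlg.incl k Λ W (op l • u)) x = _
      rw [TensorAlg.incl_smul_right, hD, toPreproj_of, toPreproj_incl]
      rfl)
  refine ⟨D', hD', fun t => ?_⟩
  have hcomp : IsDerivation (toPreproj k Λ c) (D' ∘ₗ (toPreproj k Λ c).toLinearMap) :=
    IsDerivation.comp hD' (toPreproj k Λ c)
  refine LinearMap.congr_fun (TensorAlg.derivation_ext hcomp hD (fun l => ?_) fun u => ?_) t
  · change D' (toPreproj k Λ c (TensorAlg.of k Λ W l)) = _
    rw [toPreproj_of]
    exact h1 l
  · change D' (toPreproj k Λ c (TensorAlg.incl k Λ W u)) = _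
    rw [toPreproj_incl]
    exact h2 _

/-- The derivation `t ↦ (x ↦ x ⊗ dt ⊗ 1)` with values in the cokernel of `d₂` descends to `Π`, and
this yields a left inverse of the map induced by `d₁` on that cokernel. -/
theorem exact_standardD₂_standardD₁ (hc : ∀ a, ι a • c = op (ι a) • c) :
    Function.Exact (standardD₂ X hc) (standardD₁ ι c X) := by
  have h21 (z : TermP ι c X) : standardD₁ ι c X (standardD₂ X hc z) = 0 := by
    induction z using TermP.induction with
    | h0 => rw [map_zero, map_zero]
    | ht x p =>
      rw [standardD₂_elem, standardD₁_elem, toPreproj_incl_self, zero_mul, op_zero, zero_smul,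
        show elemP ι c (0 : X) p = 0 from BT.zero_tmul _,
        show elemP ι c x 0 = 0 from BT.tmul_zero _, sub_zero]
    | ha a b ha hb => rw [map_add, map_add, ha, hb, add_zero]
  let N := LinearMap.range (standardD₂ X hc)
  let D : TensorAlg k Λ W →ₗ[k] X →ₗ[k] TermQ ι c X ⧸ N :=
    (universalDerivation ι c X).compr₂ (N.mkQ.restrictScalars k)
  have hDapp (t : TensorAlg k Λ W) (x : X) :
      D t x = N.mkQ (elemQ ι c x (Omega.d (baseToT W ι) t) 1) := rfl
  have hD : IsDerivation (toPreproj k Λ c) D := fun s t x => by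
    have := congrArg N.mkQ (isDerivation_universalDerivation (ι := ι) (c := c) s t x)
    rwa [map_add, map_smul] at this
  obtain ⟨D', hD', h⟩ := hD.exists_preproj <| LinearMap.ext fun x => by
    rw [hDapp, LinearMap.zero_apply, Submodule.mkQ_apply, Submodule.Quotient.mk_eq_zero]
    exact ⟨elemP ι c x 1, standardD₂_elem hc x 1⟩
  let s : TermP ι c X →ₗ[k] TermQ ι c X ⧸ N := BT.lift D'.flip fun x a p => by
    have h1 := hD' (baseToPi ι c a) p x
    have h2 : D' (baseToPi ι c a) x = 0 := by
      change D' (toPreproj k Λ c (baseToT W ι a)) x = 0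
      rw [h, hDapp, Omega.d_base, elemQ_zero_mid, map_zero]
    rw [h2, smul_zero, zero_add] at h1
    exact h1.symm
  have hs (x : X) (p : Preproj k Λ c) : s (elemP ι c x p) = D' p x := rfl
  have key (z : TermQ ι c X) : s (standardD₁ ι c X z) = N.mkQ z := by
    induction z using TermQ.induction with
    | h0 => simp
    | ht x t p =>
      rw [standardD₁_elem, map_sub, hs, hs, hD', h, hDapp, AlgHom.id_apply, AlgHom.id_apply,
        add_sub_cancel_right, ← map_smul, smul_elemQ, one_mul]
    | ha a b ha hb => rw [map_add, map_add, map_add, ha, hb]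
  intro z
  refine ⟨fun hz => ?_, ?_⟩
  · have := key z
    rw [hz, map_zero] at this
    exact (Submodule.Quotient.mk_eq_zero N).1 this.symm
  · rintro ⟨y, rfl⟩
    exact h21 y

end StandardComplex

/-! ### Projectivity of induced modules -/

section Semisimple

variable {k C S Q : Type*} [CommRing k] [Ring C] [Ring S] [Ring Q]
  [Algebra k C] [Algebra k S] [Algebra k Q]
  {X Y Z : Type*} [AddCommGroup X] [Module k X] [Module Sᵐᵒᵖ X] [IsScalarTower k Sᵐᵒᵖ X]
  [AddCommGroup Y] [Module k Y] [Module Qᵐᵒᵖ Y] [IsScalarTower k Qᵐᵒᵖ Y]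
  [AddCommGroup Z] [Module k Z] [Module Qᵐᵒᵖ Z] [IsScalarTower k Qᵐᵒᵖ Z]

/-- Over a semisimple algebra `C`, homomorphisms of right `C`-modules lift along surjections. -/
theorem IsSemisimpleRing.exists_lift [IsSemisimpleRing C] (f : C →ₐ[k] S) (g : C →ₐ[k] Q)
    (π : Y →ₗ[Qᵐᵒᵖ] Z) (hπ : Function.Surjective π) (h : X →ₗ[k] Z)
    (hC : ∀ c x, h (op (f c) • x) = op (g c) • h x) :
    ∃ h' : X →ₗ[k] Y, (∀ c x, h' (op (f c) • x) = op (g c) • h' x) ∧ ∀ x, π (h' x) = h x := by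
  let : Module Cᵐᵒᵖ X := Module.compHom X f.toRingHom.op
  let : Module Cᵐᵒᵖ Y := Module.compHom Y g.toRingHom.op
  let : Module Cᵐᵒᵖ Z := Module.compHom Z g.toRingHom.op
  have hX (c : C) (x : X) : op c • x = op (f c) • x := rfl
  have hY (c : C) (y : Y) : op c • y = op (g c) • y := rfl
  have hZ (c : C) (z : Z) : op c • z = op (g c) • z := rfl
  have := Module.projective_of_isSemisimpleRing Cᵐᵒᵖ X
  let π' : Y →ₗ[Cᵐᵒᵖ] Z :=
    { toFun := π, map_add' := map_add π, map_smul' := fun c y => map_smul π (op (g c.unop)) y }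
  let h₁ : X →ₗ[Cᵐᵒᵖ] Z :=
    { toFun := h, map_add' := map_add h, map_smul' := fun c x => hC c.unop x }
  obtain ⟨h', hh⟩ := Module.projective_lifting_property π' h₁ hπ
  refine ⟨{ toFun := h', map_add' := map_add h', map_smul' := fun r x => ?_ },
    fun c x => map_smul h' (op c) x, fun x => LinearMap.congr_fun hh x⟩
  have h1 : op (f (algebraMap k C r)) • x = r • x := by
    rw [AlgHom.commutes, Algebra.algebraMap_eq_smul_one, op_smul, smul_assoc, op_one, one_smul]
  have h2 (y : Y) : op (g (algebraMap k C r)) • y = r • y := by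
    rw [AlgHom.commutes, Algebra.algebraMap_eq_smul_one, op_smul, smul_assoc, op_one, one_smul]
  rw [RingHom.id_apply, ← h1, ← h2]
  exact map_smul h' (op (algebraMap k C r)) x

theorem BT.projective_of_isSemisimpleRing [IsSemisimpleRing C] (f : C →ₐ[k] S) (g : C →ₐ[k] Q) :
    Module.Projective Qᵐᵒᵖ (BT f g X Q) := by
  refine Module.Projective.of_lifting_property'' fun π hπ => ?_
  obtain ⟨h, hC, hh⟩ := IsSemisimpleRing.exists_lift f g π hπ
    (LinearMap.mk₂ k (fun q x => BT.tmul f g x q) (fun _ _ _ => BT.tmul_add _ _ _)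
      (fun _ _ _ => BT.tmul_smulk _ _ _) (fun _ _ _ => BT.add_tmul _ _ _)
      (fun _ _ _ => BT.smulk_tmul _ _ _) 1 : X →ₗ[k] BT f g X Q)
    (fun c x => by
      rw [LinearMap.mk₂_apply, LinearMap.mk₂_apply, BT.tmul_balanced, BT.smul_tmul_right]
      simp)
  refine ⟨BT.induce g h hC, BT.hom_ext_right fun x q => ?_⟩
  rw [LinearMap.comp_apply, BT.induce_tmul, map_smul, hh, LinearMap.mk₂_apply,
    BT.smul_tmul_right]
  simp

end Semisimple

/-! ### The standard presentation -/

section Presentation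

variable {k Λ W A : Type*} [Field k] [Ring Λ] [Algebra k Λ]
  [AddCommGroup W] [Module k W] [Module Λ W] [Module Λᵐᵒᵖ W]
  [IsScalarTower k Λ W] [IsScalarTower k Λᵐᵒᵖ W] [SMulCommClass Λ Λᵐᵒᵖ W]
  [Ring A] [Algebra k A] {ι : A →ₐ[k] Λ} {c : W}

theorem projective_termP [IsSemisimpleRing A] (X : Type w) [AddCommGroup X] [Module k X]
    [Module (Preproj k Λ c)ᵐᵒᵖ X] [IsScalarTower k (Preproj k Λ c)ᵐᵒᵖ X] :
    Module.Projective (Preproj k Λ c)ᵐᵒᵖ (TermP ι c X) :=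
  BT.projective_of_isSemisimpleRing (baseToPi ι c) (baseToPi ι c)

/-- The standard presentation, for an element `c` commuting with the semisimple algebra `A` such
that the modules `X ⊗_T Ω̃ ⊗_T Π` are projective. -/
def standardPresentation [IsSemisimpleRing A] (hc : ∀ a, ι a • c = op (ι a) • c)
    (hQ : ∀ X : ModuleCat.{w} (Preproj k Λ c)ᵐᵒᵖ,
      Module.Projective (Preproj k Λ c)ᵐᵒᵖ (TermQ ι c X)) : PresentationPi.{w} ι c where
  d₂ X := standardD₂ X hc
  d₁ X := standardD₁ ι c X
  d₀ X := standardD₀ ι c X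
  exact₁ _ := exact_standardD₂_standardD₁ hc
  exact₀ _ := exact_standardD₁_standardD₀
  surjective _ := standardD₀_surjective
  projective_P X := projective_termP X
  projective_Q := hQ
  natural₂ X Y φ := LinearMap.ext fun z => by
    induction z using TermP.induction with
    | h0 => rw [map_zero, map_zero]
    | ht x p =>
      change standardD₂ Y hc (elemP ι c (φ x) p) = mapQ ι c φ (standardD₂ X hc (elemP ι c x p))
      rw [standardD₂_elem, standardD₂_elem]
      rfl
    | ha a b ha hb => rw [map_add, map_add, ha, hb]
  natural₁ X Y φ := LinearMap.ext fun z => by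
    induction z using TermQ.induction with
    | h0 => rw [map_zero, map_zero]
    | ht x t p =>
      change standardD₁ ι c Y (elemQ ι c (φ x) (Omega.d (baseToT W ι) t) p) =
        mapP ι c φ (standardD₁ ι c X (elemQ ι c x (Omega.d (baseToT W ι) t) p))
      rw [standardD₁_elem, standardD₁_elem, map_sub, ← map_smul]
      rfl
    | ha a b ha hb => rw [map_add, map_add, ha, hb]
  natural₀ X Y φ := LinearMap.ext fun z => by
    induction z using TermP.induction with
    | h0 => rw [map_zero, map_zero]
    | ht x p => exact (map_smul φ (op p) x).symm
    | ha a b ha hb => rw [map_add, map_add, ha, hb]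

theorem standardPresentation_isStandard [IsSemisimpleRing A]
    (hc : ∀ a, ι a • c = op (ι a) • c)
    (hQ : ∀ X : ModuleCat.{w} (Preproj k Λ c)ᵐᵒᵖ,
      Module.Projective (Preproj k Λ c)ᵐᵒᵖ (TermQ ι c X)) :
    (standardPresentation hc hQ).IsStandard where
  d₂_elem _ x := standardD₂_elem hc x 1
  d₁_elem _ x t p := standardD₁_elem x t p
  d₀_elem _ _ _ := rfl

end Presentation

/-! ### Dual bases and symmetrising elements -/

section DualBases

variable {k A M : Type*} [Field k] [Ring A] [Algebra k A] [FiniteDimensional k A]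
  [AddCommGroup M] [Module k M] [Module A M] [Module Aᵐᵒᵖ M]
  [IsScalarTower k A M] [IsScalarTower k Aᵐᵒᵖ M] [SMulCommClass A Aᵐᵒᵖ M]
  {σ : SymmetrisingElement k A} {r s : ℕ} {m : Fin r → M} {μ : Fin r → KDual k M}
  {ν : Fin s → KDual k M} {n : Fin s → M}

/-- The functionals `μᵢ` generate the left `A`-module `DM`, with coordinates evaluated at `mᵢ`. -/
theorem RepresentsRightId.sum_rmod_smul (h : RepresentsRightId σ m μ) (ξ : KDual k M) :
    ∑ i, σ.rmod (AlgHom.id k A) ξ (m i) • μ i = ξ := by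
  ext x
  have h1 (i : Fin r) : (σ.rmod (AlgHom.id k A) ξ (m i) • μ i) x =
      ξ (op (σ.rmod (AlgHom.id k A) (μ i) x) • m i) := by
    have e1 := σ.apply_rmod_mul (AlgHom.id k A) (μ i) x (σ.rmod (AlgHom.id k A) ξ (m i))
    have e2 := σ.apply_rmod_mul (AlgHom.id k A) ξ (m i) (σ.rmod (AlgHom.id k A) (μ i) x)
    rw [AlgHom.id_apply] at e1 e2
    rw [KDual.left_smul_apply, ← e1, ← e2, σ.symm]
  have h2 : (∑ i, σ.rmod (AlgHom.id k A) ξ (m i) • μ i : KDual k M) x =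
      ∑ i, (σ.rmod (AlgHom.id k A) ξ (m i) • μ i) x :=
    LinearMap.sum_apply (M := M) (M₂ := k) _
      (fun i => (σ.rmod (AlgHom.id k A) ξ (m i) • μ i).toLin) x
  rw [h2, Finset.sum_congr rfl fun i _ => h1 i, ← map_sum, h x]

/-- The functionals `νⱼ` generate the right `A`-module `DM`, with coordinates evaluated at `nⱼ`. -/
theorem RepresentsLeftId.sum_lmod_smul (h : RepresentsLeftId σ ν n) (ξ : KDual k M) :
    ∑ j, op (σ.lmod (AlgHom.id k A) ξ (n j)) • ν j = ξ := by
  ext x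
  have h1 (j : Fin s) : (op (σ.lmod (AlgHom.id k A) ξ (n j)) • ν j) x =
      ξ (σ.lmod (AlgHom.id k A) (ν j) x • n j) := by
    have e1 := σ.apply_mul_lmod (AlgHom.id k A) (ν j) x (σ.lmod (AlgHom.id k A) ξ (n j))
    have e2 := σ.apply_mul_lmod (AlgHom.id k A) ξ (n j) (σ.lmod (AlgHom.id k A) (ν j) x)
    rw [AlgHom.id_apply] at e1 e2
    rw [KDual.right_smul_apply, ← e1, ← e2, σ.symm]
  have h2 : (∑ j, op (σ.lmod (AlgHom.id k A) ξ (n j)) • ν j : KDual k M) x =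
      ∑ j, (op (σ.lmod (AlgHom.id k A) ξ (n j)) • ν j) x :=
    LinearMap.sum_apply (M := M) (M₂ := k) _
      (fun j => (op (σ.lmod (AlgHom.id k A) ξ (n j)) • ν j).toLin) x
  rw [h2, Finset.sum_congr rfl fun i _ => h1 i, ← map_sum, h x]

theorem SymmetrisingElement.rmod_op_smul (ξ : KDual k M) (a : A) (x : M) :
    σ.rmod (AlgHom.id k A) (op a • ξ) x = σ.rmod (AlgHom.id k A) ξ (a • x) := by
  rw [σ.ext_iff]
  intro b
  rw [σ.symm, σ.symm b, σ.apply_rmod_mul, σ.apply_rmod_mul, KDual.right_smul_apply,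
    smul_comm a (op _)]

theorem SymmetrisingElement.lmod_smul_dual (ξ : KDual k M) (a : A) (x : M) :
    σ.lmod (AlgHom.id k A) (a • ξ) x = σ.lmod (AlgHom.id k A) ξ (op a • x) := by
  rw [σ.ext_iff]
  intro b
  rw [σ.apply_mul_lmod, σ.apply_mul_lmod, KDual.left_smul_apply, AlgHom.id_apply,
    smul_comm b (op a)]

end DualBases

/-! ### The case of a tensor algebra -/

section TensorCase

variable {k A M : Type*} [Field k] [Ring A] [Algebra k A]
  [AddCommGroup M] [Module k M] [Module A M] [Module Aᵐᵒᵖ M]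
  [IsScalarTower k A M] [IsScalarTower k Aᵐᵒᵖ M] [SMulCommClass A Aᵐᵒᵖ M]

namespace MhoT

theorem smul_elem (l x : TensorAlg k A M) (μ : KDual k M) (y : TensorAlg k A M) :
    l • elem x μ y = elem (l * x) μ y := rfl

theorem op_smul_elem (l x : TensorAlg k A M) (μ : KDual k M) (y : TensorAlg k A M) :
    op l • elem x μ y = elem x μ (y * l) := rfl

theorem elem_mul_of (x : TensorAlg k A M) (a : A) (μ : KDual k M) (y : TensorAlg k A M) :
    elem (x * TensorAlg.of k A M a) μ y = elem x (a • μ) y := by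
  have := BT.tmul_balanced (f := TensorAlg.of k A M) (g := AlgHom.id k A) x a μ
  rw [AlgHom.id_apply] at this
  unfold elem
  rw [← this]
  rfl

theorem elem_of_mul (x : TensorAlg k A M) (μ : KDual k M) (a : A) (y : TensorAlg k A M) :
    elem x μ (TensorAlg.of k A M a * y) = elem x (op a • μ) y := by
  have := BT.tmul_balanced (f := AlgHom.id k A) (g := TensorAlg.of k A M)
    (BT.tmul (TensorAlg.of k A M) (AlgHom.id k A) x μ) a y
  rw [AlgHom.id_apply] at this
  exact this.symm

theorem elem_add_left (x x' : TensorAlg k A M) (μ : KDual k M) (y : TensorAlg k A M) :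
    elem (x + x') μ y = elem x μ y + elem x' μ y := by
  unfold elem
  rw [BT.add_tmul, BT.add_tmul]
  rfl

theorem elem_add_mid (x : TensorAlg k A M) (μ μ' : KDual k M) (y : TensorAlg k A M) :
    elem x (μ + μ') y = elem x μ y + elem x μ' y := by
  unfold elem
  rw [BT.tmul_add, BT.add_tmul]
  rfl

theorem elem_smulk_mid (r : k) (x : TensorAlg k A M) (μ : KDual k M) (y : TensorAlg k A M) :
    elem x (r • μ) y = r • elem x μ y := by
  unfold elem
  rw [BT.tmul_smulk, BT.smulk_tmul]
  rfl

theorem elem_add_right (x : TensorAlg k A M) (μ : KDual k M) (y y' : TensorAlg k A M) :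
    elem x μ (y + y') = elem x μ y + elem x μ y' := BT.tmul_add _ y y'

variable (k A M) in
/-- The element `x ⊗ μ ⊗ 1`, as an additive function of `x`. -/
def elemLeft (μ : KDual k M) : TensorAlg k A M →+ MhoT k A M where
  toFun x := elem x μ 1
  map_zero' := by
    have := elem_add_left (0 : TensorAlg k A M) 0 μ 1
    rwa [add_zero, left_eq_add] at this
  map_add' x y := elem_add_left x y μ 1

variable (k A M) in
/-- The element `1 ⊗ μ ⊗ y`, as an additive function of `y`. -/
def elemRight (μ : KDual k M) : TensorAlg k A M →+ MhoT k A M where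
  toFun y := elem 1 μ y
  map_zero' := by
    have := elem_add_right (1 : TensorAlg k A M) μ 0 0
    rwa [add_zero, left_eq_add] at this
  map_add' x y := elem_add_right 1 μ x y

variable (k A M) in
/-- The element `x ⊗ μ ⊗ y`, as an additive function of `μ`. -/
def elemMid (x y : TensorAlg k A M) : KDual k M →+ MhoT k A M where
  toFun μ := elem x μ y
  map_zero' := by
    have := elem_add_mid x (0 : KDual k M) 0 y
    rwa [add_zero, left_eq_add] at this
  map_add' μ μ' := elem_add_mid x μ μ' y

@[elab_as_elim]
theorem induction {p : MhoT k A M → Prop} (z : MhoT k A M) (h0 : p 0)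
    (ht : ∀ x μ y, p (elem x μ y)) (ha : ∀ a b, p a → p b → p (a + b)) : p z := by
  refine BT.induction (p := p) z h0 (fun z y => ?_) ha
  induction z using BT.induction with
  | h0 => rw [BT.zero_tmul]; exact h0
  | ht x μ => exact ht x μ y
  | ha a b hx hy => rw [BT.add_tmul]; exact ha _ _ hx hy

end MhoT

/-- The two summands of `c̄` separately commute with `A`. -/
theorem cbarT_comm [FiniteDimensional k A] {σ : SymmetrisingElement k A} {r s : ℕ} {m : Fin r → M}
    {μ : Fin r → KDual k M} {ν : Fin s → KDual k M} {n : Fin s → M}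
    (h₁ : RepresentsRightId σ m μ) (h₂ : RepresentsLeftId σ ν n) (a : A) :
    TensorAlg.of k A M a • (cbarT m μ ν n : MhoT k A M) =
      op (TensorAlg.of k A M a) • cbarT m μ ν n := by
  unfold cbarT
  rw [smul_sub, smul_sub, Finset.smul_sum, Finset.smul_sum, Finset.smul_sum, Finset.smul_sum]
  congr 1
  · have e1 (i : Fin r) : TensorAlg.of k A M a • MhoT.elem (TensorAlg.incl k A M (m i)) (μ i) 1 =
        ∑ j, MhoT.elem (TensorAlg.incl k A M (m j))
          (σ.rmod (AlgHom.id k A) (op a • μ j) (m i) • μ i) 1 := by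
      rw [MhoT.smul_elem, ← TensorAlg.incl_smul_left]
      conv_lhs => rw [← h₁ (a • m i)]
      rw [map_sum]
      refine (map_sum (MhoT.elemLeft k A M (μ i)) _ _).trans (Finset.sum_congr rfl fun j _ => ?_)
      change MhoT.elem (TensorAlg.incl k A M (op _ • m j)) (μ i) 1 = _
      rw [TensorAlg.incl_smul_right, MhoT.elem_mul_of, SymmetrisingElement.rmod_op_smul]
    rw [Finset.sum_congr rfl fun i _ => e1 i, Finset.sum_comm]
    refine Finset.sum_congr rfl fun j _ => ?_
    refine (map_sum (MhoT.elemMid k A M (TensorAlg.incl k A M (m j)) 1) _ _).symm.trans ?_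
    rw [h₁.sum_rmod_smul]
    change MhoT.elem _ (op a • μ j) 1 = _
    rw [← MhoT.elem_of_mul, MhoT.op_smul_elem, mul_one, one_mul]
  · have e1 (j : Fin s) :
        op (TensorAlg.of k A M a) • MhoT.elem 1 (ν j) (TensorAlg.incl k A M (n j)) =
        ∑ i, MhoT.elem 1 (op (σ.lmod (AlgHom.id k A) (a • ν i) (n j)) • ν j)
          (TensorAlg.incl k A M (n i)) := by
      rw [MhoT.op_smul_elem, ← TensorAlg.incl_smul_right]
      conv_lhs => rw [← h₂ (op a • n j)]
      rw [map_sum]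
      refine (map_sum (MhoT.elemRight k A M (ν j)) _ _).trans (Finset.sum_congr rfl fun i _ => ?_)
      change MhoT.elem 1 (ν j) (TensorAlg.incl k A M (_ • n i)) = _
      rw [TensorAlg.incl_smul_left, MhoT.elem_of_mul, SymmetrisingElement.lmod_smul_dual]
    rw [Finset.sum_congr rfl fun i _ => e1 i, Finset.sum_comm]
    refine Finset.sum_congr rfl fun j _ => Eq.symm ?_
    refine (map_sum (MhoT.elemMid k A M 1 (TensorAlg.incl k A M (n j))) _ _).symm.trans ?_
    rw [h₂.sum_lmod_smul]
    change MhoT.elem 1 (a • ν j) _ = _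
    rw [← MhoT.elem_mul_of, MhoT.smul_elem, mul_one, one_mul]

/-! ### Noncommutative 1-forms on the tensor algebra of `M ⊕ DM` -/

theorem doubleT_add (γ γ' : M × KDual k M) :
    (doubleT (γ + γ') : TensorAlg k (TensorAlg k A M) (MhoT k A M)) =
      doubleT γ + doubleT γ' := by
  simp only [doubleT, Prod.fst_add, Prod.snd_add, map_add, MhoT.elem_add_mid]
  abel

theorem doubleT_smulk (r : k) (γ : M × KDual k M) :
    (doubleT (r • γ) : TensorAlg k (TensorAlg k A M) (MhoT k A M)) = r • doubleT γ := by
  simp only [doubleT, Prod.smul_fst, Prod.smul_snd, map_smul, MhoT.elem_smulk_mid, smul_add]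

variable (k A M) in
/-- The inclusion `M ⊕ DM → T` as a linear map. -/
def doubleTLin : M × KDual k M →ₗ[k] TensorAlg k (TensorAlg k A M) (MhoT k A M) where
  toFun := doubleT
  map_add' := doubleT_add
  map_smul' := doubleT_smulk

theorem doubleT_smul (a : A) (γ : M × KDual k M) :
    doubleT (a • γ) = baseToT (MhoT k A M) (TensorAlg.of k A M) a * doubleT γ := by
  simp only [doubleT, Prod.smul_fst, Prod.smul_snd]
  rw [← MhoT.elem_mul_of, one_mul, TensorAlg.incl_smul_left, map_mul, mul_add]
  have h : MhoT.elem (TensorAlg.of k A M a) γ.2 1 =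
      TensorAlg.of k A M a • MhoT.elem 1 γ.2 1 := by rw [MhoT.smul_elem, mul_one]
  rw [h, TensorAlg.incl_smul_left]
  rfl

theorem doubleT_op_smul (a : A) (γ : M × KDual k M) :
    doubleT (op a • γ) = doubleT γ * baseToT (MhoT k A M) (TensorAlg.of k A M) a := by
  simp only [doubleT, Prod.smul_fst, Prod.smul_snd]
  rw [← MhoT.elem_of_mul, mul_one, TensorAlg.incl_smul_right, map_mul, add_mul]
  have h : MhoT.elem 1 γ.2 (TensorAlg.of k A M a) =
      op (TensorAlg.of k A M a) • MhoT.elem 1 γ.2 1 := by rw [MhoT.op_smul_elem, one_mul]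
  rw [h, TensorAlg.incl_smul_right]
  rfl

theorem doubleT_left (m : M) : doubleT (m, (0 : KDual k M)) =
    TensorAlg.of k (TensorAlg k A M) (MhoT k A M) (TensorAlg.incl k A M m) := by
  have := map_zero (MhoT.elemMid k A M 1 1)
  change MhoT.elem 1 0 1 = 0 at this
  rw [doubleT, this, map_zero, add_zero]

theorem doubleT_right (μ : KDual k M) : doubleT ((0 : M), μ) =
    TensorAlg.incl k (TensorAlg k A M) (MhoT k A M) (MhoT.elem 1 μ 1) := by
  rw [doubleT, map_zero, map_zero, zero_add]

theorem incl_elem (x : TensorAlg k A M) (μ : KDual k M) (y : TensorAlg k A M) :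
    TensorAlg.incl k (TensorAlg k A M) (MhoT k A M) (MhoT.elem x μ y) =
      TensorAlg.of k (TensorAlg k A M) (MhoT k A M) x * doubleT (0, μ) *
        TensorAlg.of k (TensorAlg k A M) (MhoT k A M) y := by
  rw [doubleT_right, ← TensorAlg.incl_smul_left, ← TensorAlg.incl_smul_right, MhoT.smul_elem,
    MhoT.op_smul_elem, mul_one, one_mul]

/-- `T` is generated by `A` and `M ⊕ DM`. -/
@[elab_as_elim]
theorem double_induction {p : TensorAlg k (TensorAlg k A M) (MhoT k A M) → Prop}
    (hA : ∀ a, p (baseToT (MhoT k A M) (TensorAlg.of k A M) a)) (hdouble : ∀ γ, p (doubleT γ))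
    (hadd : ∀ s t, p s → p t → p (s + t)) (hmul : ∀ s t, p s → p t → p (s * t))
    (t : TensorAlg k (TensorAlg k A M) (MhoT k A M)) : p t := by
  have hΛ (x : TensorAlg k A M) : p (TensorAlg.of k (TensorAlg k A M) (MhoT k A M) x) := by
    induction x using TensorAlg.induction with
    | hof a => exact hA a
    | hincl m =>
      rw [← doubleT_left]
      exact hdouble _
    | hadd s t hs ht => rw [map_add]; exact hadd _ _ hs ht
    | hmul s t hs ht => rw [map_mul]; exact hmul _ _ hs ht
  induction t using TensorAlg.induction with
  | hof x => exact hΛ x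
  | hincl u =>
    induction u using MhoT.induction with
    | h0 =>
      rw [map_zero, ← map_zero (doubleTLin k A M)]
      exact hdouble 0
    | ht x μ y =>
      rw [incl_elem]
      exact hmul _ _ (hmul _ _ (hΛ x) (hdouble _)) (hΛ y)
    | ha a b hx hy => rw [map_add]; exact hadd _ _ hx hy
  | hadd s t hs ht => exact hadd s t hs ht
  | hmul s t hs ht => exact hmul s t hs ht

/-- The universal property of `T = T_A(M ⊕ DM)`: an algebra homomorphism from `A` and a compatible
homomorphism of bimodules from `M ⊕ DM` extend to `T`. -/
theorem exists_doubleT_lift {E : Type*} [Ring E] [Algebra k E] (F : A →ₐ[k] E)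
    (g : M × KDual k M →ₗ[k] E) (hl : ∀ a γ, g (a • γ) = F a * g γ)
    (hr : ∀ (a : A) γ, g (op a • γ) = g γ * F a) :
    ∃ φ : TensorAlg k (TensorAlg k A M) (MhoT k A M) →ₐ[k] E,
      (∀ a, φ (baseToT (MhoT k A M) (TensorAlg.of k A M) a) = F a) ∧
        ∀ γ, φ (doubleT γ) = g γ := by
  let G : TensorAlg k A M →ₐ[k] E := TensorAlg.lift F (g ∘ₗ LinearMap.inl k M (KDual k M))
    (fun a m => by
      rw [LinearMap.comp_apply, LinearMap.comp_apply, ← hl, LinearMap.inl_apply,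
        LinearMap.inl_apply, Prod.smul_mk, smul_zero])
    (fun a m => by
      rw [LinearMap.comp_apply, LinearMap.comp_apply, ← hr, LinearMap.inl_apply,
        LinearMap.inl_apply, Prod.smul_mk, smul_zero])
  have Gof (a : A) : G (TensorAlg.of k A M a) = F a := TensorAlg.lift_of _ _ _ _ a
  have Gincl (m : M) : G (TensorAlg.incl k A M m) = g (m, 0) := TensorAlg.lift_incl _ _ _ _ m
  let h₁ : BT (TensorAlg.of k A M) (AlgHom.id k A) (TensorAlg k A M) (KDual k M) →ₗ[k] E :=
    BT.lift (LinearMap.mk₂ k (fun x μ => G x * g (0, μ))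
      (fun _ _ _ => by rw [map_add, add_mul])
      (fun _ _ _ => by rw [map_smul, smul_mul_assoc])
      (fun _ _ _ => by rw [← mul_add, ← map_add, Prod.mk_add_mk, add_zero])
      (fun _ _ _ => by rw [← mul_smul_comm, ← map_smul, Prod.smul_mk, smul_zero]))
      (fun x a μ => by
        change G (x * TensorAlg.of k A M a) * g (0, μ) = G x * g (0, a • μ)
        rw [map_mul, Gof, mul_assoc, ← hl, Prod.smul_mk, smul_zero])
  have h₁_smul (a : A) (z : BT (TensorAlg.of k A M) (AlgHom.id k A) (TensorAlg k A M)
      (KDual k M)) : h₁ (op a • z) = h₁ z * F a := by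
    induction z using BT.induction with
    | h0 => simp
    | ht x μ =>
      change G x * g (0, op a • μ) = G x * g (0, μ) * F a
      rw [mul_assoc, ← hr, Prod.smul_mk, smul_zero]
    | ha a b ha hb => rw [smul_add, map_add, ha, hb, map_add, add_mul]
  let h : MhoT k A M →ₗ[k] E :=
    BT.lift (LinearMap.mk₂ k (fun z y => h₁ z * G y)
      (fun _ _ _ => by rw [map_add, add_mul])
      (fun _ _ _ => by rw [map_smul, smul_mul_assoc])
      (fun _ _ _ => by rw [map_add, mul_add])
      (fun _ _ _ => by rw [map_smul G, mul_smul_comm]))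
      (fun z a y => by
        change h₁ (op a • z) * G y = h₁ z * G (TensorAlg.of k A M a * y)
        rw [h₁_smul, map_mul, Gof, mul_assoc])
  have h_elem (x : TensorAlg k A M) (μ : KDual k M) (y : TensorAlg k A M) :
      h (MhoT.elem x μ y) = G x * g (0, μ) * G y := rfl
  let φ : TensorAlg k (TensorAlg k A M) (MhoT k A M) →ₐ[k] E := TensorAlg.lift G h
    (fun l u => by
      induction u using MhoT.induction with
      | h0 => simp
      | ht x μ y => rw [MhoT.smul_elem, h_elem, h_elem, map_mul, mul_assoc, mul_assoc, mul_assoc]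
      | ha a b ha hb => rw [smul_add, map_add, ha, hb, map_add, mul_add])
    (fun l u => by
      induction u using MhoT.induction with
      | h0 => simp
      | ht x μ y => rw [MhoT.op_smul_elem, h_elem, h_elem, map_mul, mul_assoc _ (G y)]
      | ha a b ha hb => rw [smul_add, map_add, ha, hb, map_add, add_mul])
  have φof (x : TensorAlg k A M) :
      φ (TensorAlg.of k (TensorAlg k A M) (MhoT k A M) x) = G x := TensorAlg.lift_of _ _ _ _ x
  refine ⟨φ, fun a => (φof _).trans (Gof a), fun γ => ?_⟩
  rw [doubleT, map_add, φof, Gincl]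
  have : φ (TensorAlg.incl k (TensorAlg k A M) (MhoT k A M) (MhoT.elem 1 γ.2 1)) = g (0, γ.2) := by
    refine (TensorAlg.lift_incl _ _ _ _ _).trans ?_
    rw [h_elem, map_one, one_mul, mul_one]
  rw [this, ← map_add, Prod.mk_add_mk, add_zero, zero_add]

section Iso

variable {c : MhoT k A M} {X : Type w} [AddCommGroup X] [Module k X]
  [Module (Preproj k (TensorAlg k A M) c)ᵐᵒᵖ X]
  [IsScalarTower k (Preproj k (TensorAlg k A M) c)ᵐᵒᵖ X]

theorem elemM_add_left (x y : X) (γ : M × KDual k M) (p : Preproj k (TensorAlg k A M) c) :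
    elemM c (x + y) γ p = elemM c x γ p + elemM c y γ p := by
  unfold elemM elemXM
  rw [BT.add_tmul]
  exact BT.add_tmul _ _ _

theorem elemM_add_mid (x : X) (γ γ' : M × KDual k M) (p : Preproj k (TensorAlg k A M) c) :
    elemM c x (γ + γ') p = elemM c x γ p + elemM c x γ' p := by
  unfold elemM elemXM
  rw [BT.tmul_add]
  exact BT.add_tmul _ _ _

theorem elemM_smulk_left (r : k) (x : X) (γ : M × KDual k M)
    (p : Preproj k (TensorAlg k A M) c) : elemM c (r • x) γ p = r • elemM c x γ p := by
  unfold elemM elemXM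
  rw [BT.smulk_tmul]
  exact BT.smulk_tmul _ _ _

theorem elemM_smulk_mid (r : k) (x : X) (γ : M × KDual k M)
    (p : Preproj k (TensorAlg k A M) c) : elemM c x (r • γ) p = r • elemM c x γ p := by
  unfold elemM elemXM
  rw [BT.tmul_smulk]
  exact BT.smulk_tmul _ _ _

theorem smul_elemM (x : X) (γ : M × KDual k M) (p q : Preproj k (TensorAlg k A M) c) :
    op q • elemM c x γ p = elemM c x γ (p * q) := rfl

theorem elemM_smul (x : X) (a : A) (γ : M × KDual k M) (p : Preproj k (TensorAlg k A M) c) :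
    elemM c x (a • γ) p = elemM c (op (baseToPi (TensorAlg.of k A M) c a) • x) γ p := by
  unfold elemM elemXM
  rw [BT.tmul_balanced]
  rfl

theorem elemM_op_smul (x : X) (a : A) (γ : M × KDual k M)
    (p : Preproj k (TensorAlg k A M) c) :
    elemM c x (op a • γ) p = elemM c x γ (baseToPi (TensorAlg.of k A M) c a * p) :=
  BT.tmul_balanced (f := AlgHom.id k A) (g := baseToPi (TensorAlg.of k A M) c)
    (elemXM c x γ) a p

@[elab_as_elim]
theorem TermXM.induction {p : TermXM c X → Prop} (z : TermXM c X) (h0 : p 0)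
    (ht : ∀ x γ, p (elemXM c x γ)) (ha : ∀ a b, p a → p b → p (a + b)) : p z :=
  BT.induction z h0 ht ha

/-- The tensor `ζ ⊗ p` of `ζ ∈ X ⊗_A (M ⊕ DM)` with `p ∈ Π`. -/
def tmulM (z : TermXM c X) (p : Preproj k (TensorAlg k A M) c) : TermM c X :=
  BT.tmul (AlgHom.id k A) (baseToPi (TensorAlg.of k A M) c) z p

@[elab_as_elim]
theorem TermM.induction {q : TermM c X → Prop} (z : TermM c X) (h0 : q 0)
    (ht : ∀ x γ p, q (elemM c x γ p)) (ha : ∀ a b, q a → q b → q (a + b)) : q z := by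
  refine BT.induction (p := q) z h0 (fun y p => ?_) ha
  change q (tmulM y p)
  induction y using TermXM.induction with
  | h0 => rwa [show tmulM (0 : TermXM c X) p = 0 from BT.zero_tmul p]
  | ht x γ => exact ht x γ p
  | ha a b hx hy =>
    rw [show tmulM (a + b) p = tmulM a p + tmulM b p from BT.add_tmul a b p]
    exact ha _ _ hx hy

theorem projective_termM [IsSemisimpleRing A] :
    Module.Projective (Preproj k (TensorAlg k A M) c)ᵐᵒᵖ (TermM c X) :=
  BT.projective_of_isSemisimpleRing (AlgHom.id k A) (baseToPi (TensorAlg.of k A M) c)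

variable (c X) in
/-- The map `x ⊗ γ ↦ x ⊗ dγ ⊗ 1`. -/
def termXMToQ : TermXM c X →ₗ[k] TermQ (TensorAlg.of k A M) c X :=
  BT.lift ((universalDerivation (TensorAlg.of k A M) c X).flip.compl₂ (doubleTLin k A M))
    fun x a γ => by
      have h := isDerivation_universalDerivation (ι := TensorAlg.of k A M) (c := c)
        (baseToT (MhoT k A M) (TensorAlg.of k A M) a) (doubleT γ) x
      rw [universalDerivation_base, LinearMap.zero_apply, smul_zero, zero_add,
        ← doubleT_smul] at h
      exact h.symm

theorem termXMToQ_elem (x : X) (γ : M × KDual k M) : termXMToQ c X (elemXM c x γ) =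
    universalDerivation (TensorAlg.of k A M) c X (doubleT γ) x := rfl

theorem termXMToQ_smul (a : A) (z : TermXM c X) :
    termXMToQ c X (op a • z) = op (baseToPi (TensorAlg.of k A M) c a) • termXMToQ c X z := by
  induction z using TermXM.induction with
  | h0 => rw [smul_zero, map_zero, smul_zero]
  | ht x γ =>
    have h := isDerivation_universalDerivation (ι := TensorAlg.of k A M) (c := c)
      (doubleT γ) (baseToT (MhoT k A M) (TensorAlg.of k A M) a) x
    rw [universalDerivation_base, LinearMap.zero_apply, add_zero, ← doubleT_op_smul] at h
    exact h
  | ha a b ha hb => rw [smul_add, map_add, ha, hb, map_add, smul_add]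

variable (c X) in
/-- The homomorphism `x ⊗ γ ⊗ p ↦ x ⊗ dγ ⊗ p`. -/
def termMToQ : TermM c X →ₗ[(Preproj k (TensorAlg k A M) c)ᵐᵒᵖ]
    TermQ (TensorAlg.of k A M) c X :=
  BT.induce (f := AlgHom.id k A) (baseToPi (TensorAlg.of k A M) c) (termXMToQ c X)
    termXMToQ_smul

theorem termMToQ_elem (x : X) (γ : M × KDual k M) (p : Preproj k (TensorAlg k A M) c) :
    termMToQ c X (elemM c x γ p) = elemQ (TensorAlg.of k A M) c x
      (Omega.d (baseToT (MhoT k A M) (TensorAlg.of k A M)) (doubleT γ)) p := by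
  refine (BT.induce_tmul _ _ _ _ _).trans ?_
  rw [termXMToQ_elem, universalDerivation_apply, smul_elemQ, one_mul]

variable (c X) in
/-- The derivation on `T = T_A(M ⊕ DM)` which vanishes on `A` and sends `γ ∈ M ⊕ DM` to
`x ↦ x ⊗ γ ⊗ 1`. -/
theorem exists_double_derivation :
    ∃ D : TensorAlg k (TensorAlg k A M) (MhoT k A M) →ₗ[k] X →ₗ[k] TermM c X,
      IsDerivation (toPreproj k (TensorAlg k A M) c) D ∧
      (∀ a, D (baseToT (MhoT k A M) (TensorAlg.of k A M) a) = 0) ∧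
      ∀ γ x, D (doubleT γ) x = elemM c x γ 1 := by
  let π := toPreproj k (TensorAlg k A M) c
  let δ : M × KDual k M →ₗ[k] X →ₗ[k] TermM c X :=
    LinearMap.mk₂ k (fun γ x => elemM c x γ 1)
      (fun _ _ _ => elemM_add_mid _ _ _ _) (fun _ _ _ => elemM_smulk_mid _ _ _ _)
      (fun _ _ _ => elemM_add_left _ _ _ _) (fun _ _ _ => elemM_smulk_left _ _ _ _)
  let F : A →ₐ[k] (Module.End k (X × TermM c X))ᵐᵒᵖ := AlgHom.ofLinearMap
    (triangularMap (baseToPi (TensorAlg.of k A M) c).toLinearMap 0)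
    (by
      change triangular (baseToPi (TensorAlg.of k A M) c 1) 0 = 1
      rw [map_one, triangular_one])
    (fun a b => by
      change triangular (baseToPi (TensorAlg.of k A M) c (a * b)) 0 =
        triangular (baseToPi (TensorAlg.of k A M) c a) 0 *
          triangular (baseToPi (TensorAlg.of k A M) c b) 0
      rw [map_mul]
      exact (triangular_mul fun x => by simp).symm)
  let g : M × KDual k M →ₗ[k] (Module.End k (X × TermM c X))ᵐᵒᵖ :=
    triangularMap (π.toLinearMap ∘ₗ doubleTLin k A M) δ
  obtain ⟨φ, hA, hγ⟩ := exists_doubleT_lift F g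
    (fun a γ => by
      change triangular (π (doubleT (a • γ))) (δ (a • γ)) =
        triangular (π (baseToT _ _ a)) 0 * triangular (π (doubleT γ)) (δ γ)
      rw [doubleT_smul, map_mul]
      refine (triangular_mul fun x => ?_).symm
      rw [LinearMap.zero_apply, smul_zero, zero_add]
      exact elemM_smul x a γ 1)
    (fun a γ => by
      change triangular (π (doubleT (op a • γ))) (δ (op a • γ)) =
        triangular (π (doubleT γ)) (δ γ) * triangular (π (baseToT _ _ a)) 0
      rw [doubleT_op_smul, map_mul]
      refine (triangular_mul fun x => ?_).symm
      rw [LinearMap.zero_apply, add_zero]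
      refine (elemM_op_smul x a γ 1).trans ?_
      rw [mul_one]
      change _ = op (baseToPi (TensorAlg.of k A M) c a) • elemM c x γ 1
      rw [smul_elemM, one_mul])
  have hφA (a : A) : φ (baseToT _ _ a) = triangular (π (baseToT _ _ a)) 0 := hA a
  have hφγ (γ : M × KDual k M) : φ (doubleT γ) = triangular (π (doubleT γ)) (δ γ) := hγ γ
  obtain ⟨D, hD, h⟩ := exists_derivation_of_triangular π φ fun t => by
    induction t using double_induction with
    | hA a => exact ⟨_, hφA a⟩
    | hdouble γ => exact ⟨_, hφγ γ⟩
    | hadd s t hs ht => exact exists_triangular_add hs ht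
    | hmul s t hs ht => exact exists_triangular_mul hs ht
  exact ⟨D, hD, fun a => triangular_injective ((h _).symm.trans (hφA a)),
    fun γ x => LinearMap.congr_fun (triangular_injective ((h _).symm.trans (hφγ γ))) x⟩

variable (c X) in
/-- The isomorphism `X ⊗_A (M ⊕ DM) ⊗_A Π ≅ X ⊗_T Ω̃ ⊗_T Π`, `x ⊗ γ ⊗ p ↦ x ⊗ dγ ⊗ p`. -/
theorem exists_termM_equiv_termQ :
    ∃ e : TermM c X ≃ₗ[(Preproj k (TensorAlg k A M) c)ᵐᵒᵖ] TermQ (TensorAlg.of k A M) c X,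
      ∀ x γ p, e (elemM c x γ p) = elemQ (TensorAlg.of k A M) c x
        (Omega.d (baseToT (MhoT k A M) (TensorAlg.of k A M)) (doubleT γ)) p := by
  obtain ⟨D, hD, hA, hγ⟩ := exists_double_derivation c X
  have h (t : TensorAlg k (TensorAlg k A M) (MhoT k A M)) (x : X) :
      termMToQ c X (D t x) = universalDerivation (TensorAlg.of k A M) c X t x := by
    induction t using double_induction generalizing x with
    | hA a =>
      rw [hA, universalDerivation_base, LinearMap.zero_apply, LinearMap.zero_apply, map_zero]
    | hdouble γ => rw [hγ, termMToQ_elem, universalDerivation_apply]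
    | hadd s t hs ht =>
      rw [map_add, map_add, LinearMap.add_apply, LinearMap.add_apply, map_add, hs, ht]
    | hmul s t hs ht =>
      rw [hD, isDerivation_universalDerivation, map_add, map_smul, hs, ht]
  refine ⟨LinearEquiv.ofLinearMap (termMToQ c X) (TermQ.desc D hD hA) (LinearMap.ext fun z => ?_)
    (LinearMap.ext fun z => ?_), termMToQ_elem⟩
  · induction z using TermQ.induction with
    | h0 => rw [map_zero, map_zero]
    | ht x t p =>
      rw [LinearMap.comp_apply, TermQ.desc_elem, map_smul, h, universalDerivation_apply,
        smul_elemQ, one_mul, LinearMap.id_apply]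
    | ha a b ha hb => rw [map_add, map_add, ha, hb]
  · induction z using TermM.induction with
    | h0 => rw [map_zero, map_zero]
    | ht x γ p =>
      rw [LinearMap.comp_apply, termMToQ_elem, TermQ.desc_elem, hγ, smul_elemM, one_mul,
        LinearMap.id_apply]
    | ha a b ha hb => rw [map_add, map_add, ha, hb]

end Iso

end TensorCase

section TensorCase

variable {k A M : Type*} [Field k] [Ring A] [Algebra k A]
  [AddCommGroup M] [Module k M] [Module A M] [Module Aᵐᵒᵖ M]
  [IsScalarTower k A M] [IsScalarTower k Aᵐᵒᵖ M] [SMulCommClass A Aᵐᵒᵖ M]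

section Terms

variable {c : MhoT k A M} {X : Type w} [AddCommGroup X] [Module k X]
  [Module (Preproj k (TensorAlg k A M) c)ᵐᵒᵖ X]
  [IsScalarTower k (Preproj k (TensorAlg k A M) c)ᵐᵒᵖ X]

/-- The value of the universal derivation on a product `γ γ'` of elements of `M ⊕ DM`. -/
theorem termMToQ_add_elemM (x : X) (γ γ' : M × KDual k M) :
    termMToQ c X (elemM c (op (doublePi c γ) • x) γ' 1 + elemM c x γ (doublePi c γ')) =
      universalDerivation (TensorAlg.of k A M) c X (doubleT γ * doubleT γ') x := by
  rw [isDerivation_universalDerivation, map_add, termMToQ_elem, termMToQ_elem,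
    universalDerivation_apply, universalDerivation_apply, smul_elemQ, one_mul, add_comm]
  rfl

theorem universalDerivation_cbarT {r s : ℕ} (m : Fin r → M) (μ : Fin r → KDual k M)
    (ν : Fin s → KDual k M) (n : Fin s → M) (x : X) :
    universalDerivation (TensorAlg.of k A M) c X
        (TensorAlg.incl k (TensorAlg k A M) (MhoT k A M) (cbarT m μ ν n)) x =
      termMToQ c X (
        ∑ i, (elemM c (op (doublePi c (m i, 0)) • x) (0, μ i) 1 +
              elemM c x (m i, 0) (doublePi c (0, μ i))) -
        ∑ j, (elemM c (op (doublePi c (0, ν j)) • x) (n j, 0) 1 +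
              elemM c x (0, ν j) (doublePi c (n j, 0)))) := by
  have h1 (i : Fin r) : TensorAlg.incl k (TensorAlg k A M) (MhoT k A M)
      (MhoT.elem (TensorAlg.incl k A M (m i)) (μ i) 1) = doubleT (m i, 0) * doubleT (0, μ i) := by
    rw [incl_elem, map_one, mul_one, doubleT_left]
  have h2 (j : Fin s) : TensorAlg.incl k (TensorAlg k A M) (MhoT k A M)
      (MhoT.elem 1 (ν j) (TensorAlg.incl k A M (n j))) = doubleT (0, ν j) * doubleT (n j, 0) := by
    rw [incl_elem, map_one, one_mul, doubleT_left]
  simp only [cbarT, map_sub, map_sum, h1, h2, LinearMap.sub_apply, LinearMap.sum_apply,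
    termMToQ_add_elemM]

end Terms

/-- The presentation through `X ⊗_A (M ⊕ DM) ⊗_A Π` obtained by transport along the isomorphisms
`x ⊗ γ ⊗ p ↦ x ⊗ dγ ⊗ p`. -/
def doublePresentation {c : MhoT k A M} (P : PresentationPi.{w} (TensorAlg.of k A M) c)
    (e : ∀ X : ModuleCat.{w} (Preproj k (TensorAlg k A M) c)ᵐᵒᵖ,
      TermM c X ≃ₗ[(Preproj k (TensorAlg k A M) c)ᵐᵒᵖ] TermQ (TensorAlg.of k A M) c X)
    (he : ∀ X x γ p, e X (elemM c x γ p) = elemQ (TensorAlg.of k A M) c x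
      (Omega.d (baseToT (MhoT k A M) (TensorAlg.of k A M)) (doubleT γ)) p) :
    PresentationDouble.{w} c :=
  have hnat (X Y : ModuleCat.{w} (Preproj k (TensorAlg k A M) c)ᵐᵒᵖ)
      (φ : X →ₗ[(Preproj k (TensorAlg k A M) c)ᵐᵒᵖ] Y) (z : TermM c X) :
      e Y (mapM c φ z) = mapQ (TensorAlg.of k A M) c φ (e X z) := by
    induction z using TermM.induction with
    | h0 => rw [map_zero, map_zero, map_zero, map_zero]
    | ht x γ p =>
      change e Y (elemM c (φ x) γ p) = _
      rw [he, he]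
      rfl
    | ha a b ha hb => rw [map_add, map_add, ha, hb, map_add, map_add]
  { d₂ := fun X => (e X).symm.toLinearMap ∘ₗ P.d₂ X
    d₁ := fun X => P.d₁ X ∘ₗ (e X).toLinearMap
    d₀ := P.d₀
    exact₁ := fun X z => by
      refine (P.exact₁ X (e X z)).trans (exists_congr fun y => ?_)
      exact (LinearEquiv.symm_apply_eq (e X)).symm
    exact₀ := fun X z => by
      refine (P.exact₀ X z).trans ⟨?_, ?_⟩
      · rintro ⟨y, rfl⟩
        exact ⟨(e X).symm y, congrArg (P.d₁ X) ((e X).apply_symm_apply y)⟩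
      · rintro ⟨y, rfl⟩
        exact ⟨e X y, rfl⟩
    surjective := P.surjective
    projective_P := P.projective_P
    projective_Q := fun X =>
      have := P.projective_Q X
      Module.Projective.of_equiv' (e X).symm
    natural₂ := fun X Y φ => LinearMap.ext fun z => by
      refine (LinearEquiv.symm_apply_eq (e Y)).2 ?_
      refine Eq.trans (LinearMap.congr_fun (P.natural₂ X Y φ) z) ?_
      refine Eq.trans ?_ (hnat X Y φ _).symm
      exact congrArg _ ((e X).apply_symm_apply _).symm
    natural₁ := fun X Y φ => LinearMap.ext fun z => by
      refine Eq.trans (congrArg (P.d₁ Y) (hnat X Y φ z)) ?_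
      exact LinearMap.congr_fun (P.natural₁ X Y φ) (e X z)
    natural₀ := P.natural₀ }

theorem exists_presentation_tensorAlg [FiniteDimensional k A] [IsSemisimpleRing A]
    (σ : SymmetrisingElement k A) (r s : ℕ)
    (m : Fin r → M) (μ : Fin r → KDual k M) (ν : Fin s → KDual k M) (n : Fin s → M)
    (h₁ : RepresentsRightId σ m μ) (h₂ : RepresentsLeftId σ ν n)
    (c : MhoT k A M) (hc : c = cbarT m μ ν n) :
    ∃ (P : PresentationPi.{w} (TensorAlg.of k A M) c) (P' : PresentationDouble.{w} c)
      (e : ∀ X : ModuleCat.{w} (Preproj k (TensorAlg k A M) c)ᵐᵒᵖ,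
        TermM c X ≃ₗ[(Preproj k (TensorAlg k A M) c)ᵐᵒᵖ] TermQ (TensorAlg.of k A M) c X),
      P.IsStandard ∧
      (∀ (X : ModuleCat.{w} (Preproj k (TensorAlg k A M) c)ᵐᵒᵖ) (x : X) (γ : M × KDual k M)
        (p : Preproj k (TensorAlg k A M) c),
        e X (elemM c x γ p) = elemQ (TensorAlg.of k A M) c x
          (Omega.d (baseToT (MhoT k A M) (TensorAlg.of k A M)) (doubleT γ)) p) ∧
      (∀ X z, e X (P'.d₂ X z) = P.d₂ X z) ∧
      (∀ X z, P'.d₁ X z = P.d₁ X (e X z)) ∧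
      (∀ X z, P'.d₀ X z = P.d₀ X z) ∧
      (∀ (X : ModuleCat.{w} (Preproj k (TensorAlg k A M) c)ᵐᵒᵖ) (x : X),
        P'.d₂ X (elemP (TensorAlg.of k A M) c x 1) =
          ∑ i, (elemM c (op (doublePi c (m i, 0)) • x) (0, μ i) 1 +
                elemM c x (m i, 0) (doublePi c (0, μ i))) -
          ∑ j, (elemM c (op (doublePi c (0, ν j)) • x) (n j, 0) 1 +
                elemM c x (0, ν j) (doublePi c (n j, 0)))) ∧
      (∀ (X : ModuleCat.{w} (Preproj k (TensorAlg k A M) c)ᵐᵒᵖ) (x : X) (γ : M × KDual k M)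
        (p : Preproj k (TensorAlg k A M) c),
        P'.d₁ X (elemM c x γ p) =
          elemP (TensorAlg.of k A M) c x (doublePi c γ * p) -
            elemP (TensorAlg.of k A M) c (op (doublePi c γ) • x) p) := by
  have hcomm (a : A) : TensorAlg.of k A M a • c = op (TensorAlg.of k A M a) • c := by
    rw [hc]
    exact cbarT_comm h₁ h₂ a
  choose e he using fun X : ModuleCat.{w} (Preproj k (TensorAlg k A M) c)ᵐᵒᵖ =>
    exists_termM_equiv_termQ c X
  let P := standardPresentation.{w} hcomm fun X =>
    have := projective_termM (c := c) (X := X)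
    Module.Projective.of_equiv' (e X)
  have hP : P.IsStandard := standardPresentation_isStandard _ _
  refine ⟨P, doublePresentation P e he, e, hP, he, fun X z => (e X).apply_symm_apply _,
    fun _ _ => rfl, fun _ _ => rfl, fun X x => ?_, fun X x γ p => ?_⟩
  · refine (LinearEquiv.symm_apply_eq (e X)).2 ((hP.d₂_elem X x).trans ?_)
    have heq : (e X).toLinearMap = termMToQ c X := LinearMap.ext fun z => by
      induction z using TermM.induction with
      | h0 => rw [map_zero, map_zero]
      | ht x γ p => exact (he X x γ p).trans (termMToQ_elem x γ p).symm
      | ha a b ha hb => rw [map_add, map_add, ha, hb]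
    refine Eq.trans ?_ (LinearMap.congr_fun heq _).symm
    rw [← universalDerivation_cbarT, ← hc]
    rfl
  · refine (congrArg (P.d₁ X) (he X x γ p)).trans ?_
    exact hP.d₁_elem X x (doubleT γ) p

end TensorCase

/-! ### Spaces of `k`-linear maps as right modules -/

section HomK

/-- `Hom_k(N, E)` for a left `Λ`-module `N`, regarded as a right `Λ`-module by
`(g λ)(n) = g(λ n)`. -/
def HomK (k N E : Type*) [CommRing k] [AddCommGroup N] [Module k N] [AddCommGroup E]
    [Module k E] : Type _ := N →ₗ[k] E

namespace HomK

variable {k Λ N E : Type*} [CommRing k] [Ring Λ] [Algebra k Λ] [AddCommGroup N] [Module k N]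
  [Module Λ N] [IsScalarTower k Λ N] [AddCommGroup E] [Module k E]

instance : AddCommGroup (HomK k N E) := inferInstanceAs (AddCommGroup (N →ₗ[k] E))
instance : Module k (HomK k N E) := inferInstanceAs (Module k (N →ₗ[k] E))
instance : FunLike (HomK k N E) N E := inferInstanceAs (FunLike (N →ₗ[k] E) N E)
instance : LinearMapClass (HomK k N E) k N E :=
  inferInstanceAs (LinearMapClass (N →ₗ[k] E) k N E)

@[ext] theorem ext {g h : HomK k N E} (H : ∀ x, g x = h x) : g = h := LinearMap.ext H

@[simp] theorem add_apply (g h : HomK k N E) (x : N) : (g + h) x = g x + h x := rfl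
@[simp] theorem zero_apply (x : N) : (0 : HomK k N E) x = 0 := rfl
@[simp] theorem smulk_apply (r : k) (g : HomK k N E) (x : N) : (r • g) x = r • g x := rfl

instance rightModule : Module Λᵐᵒᵖ (HomK k N E) where
  smul l g := LinearMap.comp (show N →ₗ[k] E from g) (Algebra.lsmul k k N l.unop)
  one_smul g := by ext x; change g ((1 : Λ) • x) = g x; rw [one_smul]
  mul_smul l m g := by
    ext x; change g ((m.unop * l.unop) • x) = g (m.unop • l.unop • x); rw [mul_smul]
  smul_zero l := by ext x; rfl
  smul_add l g h := by ext x; rfl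
  add_smul l m g := by
    ext x; change g ((l.unop + m.unop) • x) = g (l.unop • x) + g (m.unop • x)
    rw [add_smul, map_add]
  zero_smul g := by ext x; change g ((0 : Λ) • x) = 0; rw [zero_smul, map_zero]

@[simp] theorem smul_apply (l : Λᵐᵒᵖ) (g : HomK k N E) (x : N) : (l • g) x = g (l.unop • x) := rfl

instance : IsScalarTower k Λᵐᵒᵖ (HomK k N E) where
  smul_assoc r l g := by
    ext x
    rw [smul_apply, smulk_apply, smul_apply, unop_smul, smul_assoc, map_smul]

end HomK

end HomK

/-! ### Submodules of projective modules over a hereditary algebra -/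

section Hereditary

variable {k Λ : Type*} [Field k] [Ring Λ] [Algebra k Λ]

variable (Λ) in
/-- `Λ`, as a right module over itself, is the free module `Λᵐᵒᵖ` of rank one over `Λᵐᵒᵖ`. -/
def opSelfEquiv : Λ ≃ₗ[Λᵐᵒᵖ] Λᵐᵒᵖ :=
  { opAddEquiv with map_smul' := fun _ _ => rfl }

theorem IsHereditaryRing.projective_ideal_op (h : IsHereditaryRing Λ) (I : Ideal Λᵐᵒᵖ) :
    Module.Projective Λᵐᵒᵖ I := by
  let J : Submodule Λᵐᵒᵖ Λ := Submodule.comap (opSelfEquiv Λ).toLinearMap I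
  have := h.2 J
  exact Module.Projective.of_equiv' ((opSelfEquiv Λ).submoduleMap J |>.trans
    (LinearEquiv.ofEq _ _ (Submodule.map_comap_eq_of_surjective (opSelfEquiv Λ).surjective I)))

variable {F : Type*} [AddCommGroup F] [Module k F]

/-- The coinduced right module `Hom_k(Λ, F)` satisfies Baer's criterion, and so do its quotients
when `Λ` is hereditary, since homomorphisms from a projective right ideal lift. -/
theorem IsHereditaryRing.baer_quotient_homK (h : IsHereditaryRing Λ)
    (Z : Submodule Λᵐᵒᵖ (HomK k Λ F)) : Module.Baer Λᵐᵒᵖ (HomK k Λ F ⧸ Z) := by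
  intro I g
  have := h.projective_ideal_op I
  obtain ⟨g', hg'⟩ := Module.projective_lifting_property Z.mkQ g Z.mkQ_surjective
  let e : I.restrictScalars k →ₗ[k] F :=
    { toFun := fun x => g' x 1
      map_add' := fun x y => congrArg (fun G : HomK k Λ F => G 1) (map_add g' x y)
      map_smul' := fun r x => congrArg (fun G : HomK k Λ F => G 1)
        (map_smul (g'.restrictScalars k) r x) }
  obtain ⟨e', he'⟩ := e.exists_extend
  let G : Λᵐᵒᵖ →ₗ[Λᵐᵒᵖ] HomK k Λ F :=
    { toFun := fun r => e' ∘ₗ LinearMap.mulRight k r ∘ₗ (opLinearEquiv k).toLinearMap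
      map_add' := fun r s => HomK.ext fun x => by
        change e' (op x * (r + s)) = e' (op x * r) + e' (op x * s)
        rw [mul_add, map_add]
      map_smul' := fun l r => HomK.ext fun x => by
        change e' (op x * (l * r)) = e' (op (l.unop * x) * r)
        rw [op_mul, op_unop, mul_assoc] }
  refine ⟨Z.mkQ ∘ₗ G, fun x hx => ?_⟩
  rw [← hg', LinearMap.comp_apply, LinearMap.comp_apply]
  congr 1
  refine HomK.ext fun s => ?_
  have h1 : e' (op s * x) = e ⟨op s * x, I.mul_mem_left _ hx⟩ :=
    LinearMap.congr_fun he' ⟨op s * x, I.mul_mem_left _ hx⟩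
  refine h1.trans ?_
  change g' (op s • (⟨x, hx⟩ : I)) 1 = g' ⟨x, hx⟩ s
  rw [map_smul, HomK.smul_apply, unop_op, smul_eq_mul, mul_one]

/-- Right modules which embed into projective modules over a hereditary algebra are projective.
Let `π : F → K` be surjective with `F` free, and embed `F` into the injective module `Hom_k(Λ, F)`.
As the quotient `Hom_k(Λ, F) / ker π` is injective, the map from `K` to it extends to `P`, and
as `P` is projective the extension lifts to `P → Hom_k(Λ, F)`. The restriction of the lift to `K`
takes values in `F` and is a section of `π`. -/
theorem IsHereditaryRing.projective_of_injective (h : IsHereditaryRing Λ) {K P : Type*}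
    [AddCommGroup K] [Module k K] [Module Λᵐᵒᵖ K] [IsScalarTower k Λᵐᵒᵖ K]
    [AddCommGroup P] [Module Λᵐᵒᵖ P] [Module.Projective Λᵐᵒᵖ P]
    (i : K →ₗ[Λᵐᵒᵖ] P) (hi : Function.Injective i) : Module.Projective Λᵐᵒᵖ K := by
  refine Module.Projective.of_lifting_property'' fun π hπ => ?_
  let j : (K →₀ Λᵐᵒᵖ) →ₗ[Λᵐᵒᵖ] HomK k Λ (K →₀ Λᵐᵒᵖ) :=
    { toFun := fun y => ((Algebra.lsmul k k (K →₀ Λᵐᵒᵖ)).toLinearMap.flip y) ∘ₗ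
          (opLinearEquiv k).toLinearMap
      map_add' := fun y z => HomK.ext fun s => smul_add (op s) y z
      map_smul' := fun l y => HomK.ext fun s => by
        change op s • l • y = op (l.unop * s) • y
        rw [op_mul, op_unop, mul_smul] }
  have hj (y : K →₀ Λᵐᵒᵖ) (s : Λ) : j y s = op s • y := rfl
  have hj_inj : Function.Injective j := fun y z hyz => by
    have := congrArg (fun g : HomK k Λ (K →₀ Λᵐᵒᵖ) => g 1) hyz
    simpa [hj] using this
  let Z := (LinearMap.ker π).map j
  obtain ⟨φ, hφ⟩ : ∃ φ : K →ₗ[Λᵐᵒᵖ] HomK k Λ (K →₀ Λᵐᵒᵖ) ⧸ Z, φ ∘ₗ π = Z.mkQ ∘ₗ j := by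
    have hle : LinearMap.ker π ≤ LinearMap.ker (Z.mkQ ∘ₗ j) := fun y hy =>
      (Submodule.Quotient.mk_eq_zero Z).2 ⟨y, hy, rfl⟩
    refine ⟨(LinearMap.ker π).liftQ (Z.mkQ ∘ₗ j) hle ∘ₗ
      (π.quotKerEquivOfSurjective hπ).symm.toLinearMap, LinearMap.ext fun y => ?_⟩
    have : (π.quotKerEquivOfSurjective hπ).symm (π y) = Submodule.Quotient.mk y :=
      (LinearEquiv.symm_apply_eq _).2 rfl
    change (LinearMap.ker π).liftQ _ hle ((π.quotKerEquivOfSurjective hπ).symm (π y)) = _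
    rw [this]
    rfl
  obtain ⟨ψ, hψ⟩ := (h.baer_quotient_homK Z).extension_property i hi φ
  obtain ⟨χ, hχ⟩ := Module.projective_lifting_property Z.mkQ ψ Z.mkQ_surjective
  have key (y : K →₀ Λᵐᵒᵖ) : ∃ y', π y' = π y ∧ χ (i (π y)) = j y' := by
    have h1 : Z.mkQ (χ (i (π y))) = Z.mkQ (j y) := by
      rw [← LinearMap.comp_apply Z.mkQ χ, hχ, ← LinearMap.comp_apply ψ i, hψ,
        ← LinearMap.comp_apply φ π, hφ]
      rfl
    obtain ⟨y₀, hy₀, h2⟩ := (Submodule.Quotient.eq Z).1 h1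
    refine ⟨y + y₀, ?_, ?_⟩
    · rw [map_add, LinearMap.mem_ker.1 hy₀, add_zero]
    · rw [map_add, h2, add_sub_cancel]
  let ρ : K →ₗ[Λᵐᵒᵖ] LinearMap.range j := (χ ∘ₗ i).codRestrict _ fun κ => by
    obtain ⟨y, rfl⟩ := hπ κ
    obtain ⟨y', -, h'⟩ := key y
    exact ⟨y', h'.symm⟩
  refine ⟨(LinearEquiv.ofInjective j hj_inj).symm.toLinearMap ∘ₗ ρ, LinearMap.ext fun κ => ?_⟩
  obtain ⟨y, rfl⟩ := hπ κ
  obtain ⟨y', h1, h2⟩ := key y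
  have : (LinearEquiv.ofInjective j hj_inj).symm (ρ (π y)) = y' :=
    (LinearEquiv.symm_apply_eq _).2 (Subtype.ext h2)
  change π ((LinearEquiv.ofInjective j hj_inj).symm (ρ (π y))) = π y
  rw [this, h1]

/-- The element of a finite dimensional space with prescribed values under all functionals. -/
theorem KDual.exists_eval {V : Type*} [AddCommGroup V] [Module k V] [FiniteDimensional k V]
    (Φ : KDual k V →ₗ[k] k) : ∃ v : V, ∀ ξ : KDual k V, ξ v = Φ ξ :=
  ⟨(Module.evalEquiv k V).symm Φ, fun ξ =>
    LinearMap.congr_fun ((Module.evalEquiv k V).apply_symm_apply Φ) ξ⟩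

theorem KDual.eval_injective {V : Type*} [AddCommGroup V] [Module k V] {v v' : V}
    (h : ∀ ξ : KDual k V, ξ v = ξ v') : v = v' :=
  sub_eq_zero.1 <| (Module.forall_dual_apply_eq_zero_iff k _).1 fun ξ => by
    rw [map_sub, sub_eq_zero]
    exact h ξ

/-- For a finite dimensional algebra, `Hom_k(DΛ, F)` is a direct sum of copies of `D DΛ = Λ`; here
it is embedded into such a sum. -/
theorem IsHereditaryRing.projective_homK_dual [FiniteDimensional k Λ] (h : IsHereditaryRing Λ) :
    Module.Projective Λᵐᵒᵖ (HomK k (KDual k Λ) F) := by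
  let b := Module.Basis.ofVectorSpace k F
  have hΦ (g : HomK k (KDual k Λ) F) (β : Module.Basis.ofVectorSpaceIndex k F) :=
    KDual.exists_eval (k := k) (V := Λ)
      ((b.coord β) ∘ₗ (show KDual k Λ →ₗ[k] F from g))
  choose Ψ hΨ using hΦ
  replace hΨ (g : HomK k (KDual k Λ) F) (β) (ξ : KDual k Λ) :
    ξ (Ψ g β) = b.coord β (g ξ) := hΨ g β ξ
  -- `DΛ` is finite dimensional, so that only finitely many coordinates occur in the values of `g`
  have hfin (g : HomK k (KDual k Λ) F) : (Function.support (Ψ g)).Finite := by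
    have : FiniteDimensional k (KDual k Λ) := inferInstanceAs (FiniteDimensional k (Λ →ₗ[k] k))
    let e := Module.finBasis k (KDual k Λ)
    refine (Set.finite_iUnion fun i =>
      (b.repr (g (e i))).support.finite_toSet).subset fun β hβ => ?_
    by_contra hcon
    refine hβ (KDual.eval_injective (k := k) fun ξ => ?_)
    rw [hΨ, map_zero]
    have : (b.coord β) ∘ₗ (show KDual k Λ →ₗ[k] F from g) = 0 := e.ext fun i => by
      by_contra hi
      exact hcon (Set.mem_iUnion.2 ⟨i, Finset.mem_coe.2 (Finsupp.mem_support_iff.2 hi)⟩)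
    exact LinearMap.congr_fun this ξ
  have : Module.Free Λᵐᵒᵖ Λ := Module.Free.of_equiv (opSelfEquiv Λ).symm
  let i : HomK k (KDual k Λ) F →ₗ[Λᵐᵒᵖ] (Module.Basis.ofVectorSpaceIndex k F →₀ Λ) :=
    { toFun := fun g => Finsupp.ofSupportFinite (Ψ g) (hfin g)
      map_add' := fun g g' => Finsupp.ext fun β => KDual.eval_injective (k := k) fun ξ => by
        change ξ (Ψ (g + g') β) = ξ (Ψ g β + Ψ g' β)
        rw [map_add, hΨ, hΨ, hΨ, HomK.add_apply, map_add]
      map_smul' := fun l g => Finsupp.ext fun β => KDual.eval_injective (k := k) fun ξ => by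
        change ξ (Ψ (l • g) β) = ξ (l • Ψ g β)
        rw [hΨ, HomK.smul_apply, ← hΨ, KDual.left_smul_apply, op_unop] }
  refine h.projective_of_injective (k := k) i ((injective_iff_map_eq_zero i).2 fun g hg => ?_)
  refine HomK.ext fun ξ => b.repr.injective (Finsupp.ext fun β => ?_)
  have h0 : Ψ g β = 0 := DFunLike.congr_fun hg β
  change b.coord β (g ξ) = b.coord β 0
  rw [← hΨ, h0, map_zero, map_zero]

end Hereditary

/-! ### Lifting derivations on a hereditary algebra -/

section LiftDerivation

variable {k A Λ : Type*} [Field k] [Ring A] [Algebra k A] [Ring Λ] [Algebra k Λ]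
  {ι : A →ₐ[k] Λ}
  {X Y Z : Type*} [AddCommGroup X] [Module k X] [Module Λᵐᵒᵖ X] [IsScalarTower k Λᵐᵒᵖ X]
  [AddCommGroup Y] [Module k Y] [Module Λᵐᵒᵖ Y] [IsScalarTower k Λᵐᵒᵖ Y]
  [AddCommGroup Z] [Module k Z] [Module Λᵐᵒᵖ Z] [IsScalarTower k Λᵐᵒᵖ Z]

theorem Omega.d_one : Omega.d ι 1 = 0 := by
  rw [← map_one ι, Omega.d_base]

variable (ι X) in
/-- The map `x ⊗ t ↦ x ⊗ dt` from `X ⊗_A Λ` to `X ⊗_Λ Ω`. -/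
def tensorD : BT ι ι X Λ →ₗ[k] BT (AlgHom.id k Λ) (AlgHom.id k Λ) X (Omega ι) :=
  BT.lift
    (LinearMap.mk₂ k (fun x t => BT.tmul _ _ x (Omega.dLin ι t))
      (fun _ _ _ => BT.add_tmul _ _ _) (fun _ _ _ => BT.smulk_tmul _ _ _)
      (fun _ _ _ => by rw [map_add, BT.tmul_add])
      (fun _ _ _ => by rw [map_smul, BT.tmul_smulk]))
    (fun x a t => by
      change BT.tmul _ _ (op (ι a) • x) (Omega.d ι t) = BT.tmul _ _ x (Omega.d ι (ι a * t))
      rw [Omega.d_mul, Omega.d_base, smul_zero, add_zero]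
      exact BT.tmul_balanced (f := AlgHom.id k Λ) (g := AlgHom.id k Λ) x (ι a) _)

variable (ι X) in
/-- The derivation `t ↦ (x ↦ x ⊗ t - x t ⊗ 1)` with values in `X ⊗_A Λ`. -/
def tensorInner : Λ →ₗ[k] X →ₗ[k] BT ι ι X Λ :=
  LinearMap.mk₂ k (fun t x => BT.tmul ι ι x t - BT.tmul ι ι (op t • x) 1)
    (fun _ _ _ => by rw [BT.tmul_add, op_add, add_smul, BT.add_tmul]; abel)
    (fun _ _ _ => by rw [BT.tmul_smulk, op_smul, smul_assoc, BT.smulk_tmul, smul_sub])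
    (fun _ _ _ => by rw [BT.add_tmul, smul_add, BT.add_tmul]; abel)
    (fun _ _ _ => by rw [BT.smulk_tmul, smul_comm, BT.smulk_tmul, smul_sub])

theorem isDerivation_tensorInner : IsDerivation (AlgHom.id k Λ) (tensorInner ι X) := fun s t x => by
  simp only [tensorInner, LinearMap.mk₂_apply, AlgHom.id_apply, smul_sub, BT.smul_tmul_right,
    op_smul_eq_mul, one_mul, op_mul, mul_smul]
  abel

theorem tensorInner_base (a : A) : tensorInner ι X (ι a) = 0 := LinearMap.ext fun x => by
  rw [tensorInner, LinearMap.mk₂_apply, BT.tmul_balanced, smul_eq_mul, mul_one, sub_self,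
    LinearMap.zero_apply]

/-- `X ⊗_Λ Ω` embeds into the projective module `X ⊗_A Λ`, with `x ⊗ t ↦ x ⊗ dt` as a retraction. -/
theorem IsHereditaryRing.projective_tensor_omega [IsSemisimpleRing A] (h : IsHereditaryRing Λ) :
    Module.Projective Λᵐᵒᵖ (BT (AlgHom.id k Λ) (AlgHom.id k Λ) X (Omega ι)) := by
  let i : BT (AlgHom.id k Λ) (AlgHom.id k Λ) X (Omega ι) →ₗ[Λᵐᵒᵖ] BT ι ι X Λ :=
    BT.liftRight ((derivationForm (AlgHom.id k Λ) (tensorInner ι X) isDerivation_tensorInner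
      tensorInner_base).compl₂ (Omega.val ι))
      (fun x l _ => (derivationForm_smul_left isDerivation_tensorInner tensorInner_base x l _).symm)
      (fun x l z => derivationForm_val_smul_right isDerivation_tensorInner tensorInner_base x
        l.unop z)
  have hi (z) : tensorD ι X (i z) = z := by
    induction z using BT.induction with
    | h0 => rw [map_zero, map_zero]
    | ht x z =>
      induction z using Omega.induction with
      | h0 => rw [BT.tmul_zero, map_zero, map_zero]
      | ht s t =>
        have h1 : BT.tmul (AlgHom.id k Λ) (AlgHom.id k Λ) x (s • Omega.d ι t) =
            BT.tmul (AlgHom.id k Λ) (AlgHom.id k Λ) (op s • x) (Omega.d ι t) :=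
          (BT.tmul_balanced (f := AlgHom.id k Λ) (g := AlgHom.id k Λ) x s _).symm
        have h2 : i (BT.tmul (AlgHom.id k Λ) (AlgHom.id k Λ) (op s • x) (Omega.d ι t)) =
            tensorInner ι X t (op s • x) :=
          derivationForm_d isDerivation_tensorInner tensorInner_base _ t
        rw [h1, h2, tensorInner, LinearMap.mk₂_apply, map_sub]
        change BT.tmul _ _ (op s • x) (Omega.d ι t) - BT.tmul _ _ _ (Omega.d ι 1) = _
        rw [Omega.d_one, BT.tmul_zero, sub_zero]
      | ha a b ha hb => rw [BT.tmul_add, map_add, map_add, ha, hb]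
    | ha a b ha hb => rw [map_add, map_add, ha, hb]
  have := BT.projective_of_isSemisimpleRing (X := X) ι ι
  exact h.projective_of_injective (k := k) i (Function.LeftInverse.injective hi)

/-- Over a hereditary algebra, derivations `Λ → Hom_k(X, Z)` lift along surjections `Y → Z`. -/
theorem IsHereditaryRing.exists_lift_derivation [IsSemisimpleRing A] (h : IsHereditaryRing Λ)
    (π : Y →ₗ[Λᵐᵒᵖ] Z) (hπ : Function.Surjective π) (δ' : Λ →ₗ[k] X →ₗ[k] Z)
    (hδ' : IsDerivation (AlgHom.id k Λ) δ') (hA : ∀ a, δ' (ι a) = 0) :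
    ∃ δ : Λ →ₗ[k] X →ₗ[k] Y, IsDerivation (AlgHom.id k Λ) δ ∧ (∀ a, δ (ι a) = 0) ∧
      ∀ t x, π (δ t x) = δ' t x := by
  have := h.projective_tensor_omega (ι := ι) (X := X)
  let g : BT (AlgHom.id k Λ) (AlgHom.id k Λ) X (Omega ι) →ₗ[Λᵐᵒᵖ] Z :=
    BT.liftRight ((derivationForm (AlgHom.id k Λ) δ' hδ' hA).compl₂ (Omega.val ι))
      (fun x l _ => (derivationForm_smul_left hδ' hA x l _).symm)
      (fun x l z => derivationForm_val_smul_right hδ' hA x l.unop z)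
  obtain ⟨h, hh⟩ := Module.projective_lifting_property π g hπ
  let δ : Λ →ₗ[k] X →ₗ[k] Y := LinearMap.mk₂ k
    (fun t x => h (BT.tmul _ _ x (Omega.dLin ι t)))
    (fun _ _ _ => by rw [map_add, BT.tmul_add, map_add])
    (fun r _ _ => by
      rw [map_smul (Omega.dLin ι), BT.tmul_smulk]
      exact map_smul (h.restrictScalars k) r _)
    (fun _ _ _ => by rw [BT.add_tmul, map_add])
    (fun r _ _ => by
      rw [BT.smulk_tmul]
      exact map_smul (h.restrictScalars k) r _)
  have hδ (t : Λ) (x : X) : δ t x = h (BT.tmul _ _ x (Omega.d ι t)) := rfl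
  refine ⟨δ, fun s t x => ?_, fun a => LinearMap.ext fun x => ?_, fun t x => ?_⟩
  · rw [hδ, hδ, hδ, Omega.d_mul, BT.tmul_add, map_add, add_comm, ← map_smul, AlgHom.id_apply,
      BT.smul_tmul_right, BT.tmul_balanced]
    rfl
  · rw [hδ, Omega.d_base, BT.tmul_zero, map_zero, LinearMap.zero_apply]
  · rw [hδ, ← LinearMap.comp_apply, hh]
    exact derivationForm_d hδ' hA x t

end LiftDerivation

/-! ### The bimodule `℧` as a space of homomorphisms -/

section HatMap

variable {k A Λ : Type*} [Field k] [Ring A] [Algebra k A] [Ring Λ] [Algebra k Λ]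

/-- The bimodule `DΛ ⊗_Λ Ω`. -/
abbrev DualOmega (ι : A →ₐ[k] Λ) : Type _ :=
  BT (AlgHom.id k Λ) (AlgHom.id k Λ) (KDual k Λ) (Omega ι)

variable {ι : A →ₐ[k] Λ}

/-- The element `n ⊗ φ` of `DΛ ⊗_Λ Ω ⊗_Λ DΛ`. -/
def PreMho.tmul (n : DualOmega ι) (φ : KDual k Λ) : PreMho ι :=
  BT.tmul (AlgHom.id k Λ) (AlgHom.id k Λ) n φ

theorem Mho.ext {u v : Mho ι} (h : ∀ n φ, u.eval (PreMho.tmul n φ) = v.eval (PreMho.tmul n φ)) :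
    u = v := BT.hom_ext h

theorem Mho.eval_smul (l : Λ) (u : Mho ι) (n : DualOmega ι) (φ : KDual k Λ) :
    (l • u).eval (PreMho.tmul n φ) = u.eval (PreMho.tmul n (op l • φ)) := rfl

theorem Mho.eval_op_smul (l : Λ) (u : Mho ι) (n : DualOmega ι) (φ : KDual k Λ) :
    (op l • u).eval (PreMho.tmul n φ) = u.eval (PreMho.tmul (l • n) φ) := rfl

theorem PreMho.tmul_op_smul (l : Λ) (n : DualOmega ι) (φ : KDual k Λ) :
    PreMho.tmul (op l • n) φ = PreMho.tmul n (l • φ) :=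
  BT.tmul_balanced (f := AlgHom.id k Λ) (g := AlgHom.id k Λ) n l φ

variable [FiniteDimensional k Λ]

/-- The homomorphism `û : DΛ ⊗_Λ Ω → Λ` of right `Λ`-modules attached to `u ∈ ℧`. It is determined
by `φ(û(n)) = u(n ⊗ φ)` for `φ ∈ DΛ`. -/
noncomputable def Mho.hat (u : Mho ι) : DualOmega ι →ₗ[k] Λ :=
  let F : DualOmega ι →ₗ[k] KDual k Λ →ₗ[k] k :=
    LinearMap.mk₂ k (fun n φ => u.eval (PreMho.tmul n φ))
      (fun n n' φ => (congrArg u.eval (BT.add_tmul n n' φ)).trans (map_add (KDual.toLin u) _ _))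
      (fun r n φ => (congrArg u.eval (BT.smulk_tmul r n φ)).trans (map_smul (KDual.toLin u) _ _))
      (fun n φ φ' => (congrArg u.eval (BT.tmul_add n φ φ')).trans (map_add (KDual.toLin u) _ _))
      (fun r n φ => (congrArg u.eval (BT.tmul_smulk r n φ)).trans (map_smul (KDual.toLin u) _ _))
  (Module.evalEquiv k Λ).symm.toLinearMap ∘ₗ
    (show DualOmega ι →ₗ[k] Module.Dual k (Module.Dual k Λ) from F)

theorem Mho.apply_hat (u : Mho ι) (n : DualOmega ι) (φ : KDual k Λ) :
    φ (u.hat n) = u.eval (PreMho.tmul n φ) :=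
  LinearMap.congr_fun ((Module.evalEquiv k Λ).apply_symm_apply _) φ

theorem Mho.hat_smul (l : Λ) (u : Mho ι) (n : DualOmega ι) : (l • u).hat n = l * u.hat n :=
  KDual.eval_injective (k := k) fun φ => by
    rw [Mho.apply_hat, Mho.eval_smul, ← Mho.apply_hat, KDual.right_smul_apply, smul_eq_mul]

theorem Mho.hat_op_smul (l : Λ) (u : Mho ι) (n : DualOmega ι) : (op l • u).hat n = u.hat (l • n) :=
  KDual.eval_injective (k := k) fun φ => by
    rw [Mho.apply_hat, Mho.eval_op_smul, ← Mho.apply_hat]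

theorem Mho.hat_apply_op_smul (l : Λ) (u : Mho ι) (n : DualOmega ι) :
    u.hat (op l • n) = u.hat n * l :=
  KDual.eval_injective (k := k) fun φ => by
    rw [Mho.apply_hat, PreMho.tmul_op_smul, ← Mho.apply_hat, KDual.left_smul_apply, op_smul_eq_mul]

theorem Mho.hat_add (u v : Mho ι) (n : DualOmega ι) : (u + v).hat n = u.hat n + v.hat n :=
  KDual.eval_injective (k := k) fun φ => by
    rw [map_add, Mho.apply_hat, Mho.apply_hat, Mho.apply_hat]; rfl

theorem Mho.hat_smulk (r : k) (u : Mho ι) (n : DualOmega ι) : (r • u).hat n = r • u.hat n :=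
  KDual.eval_injective (k := k) fun φ => by
    rw [map_smul, Mho.apply_hat, Mho.apply_hat]; rfl

theorem Mho.hat_injective {u v : Mho ι} (h : ∀ n, u.hat n = v.hat n) : u = v :=
  Mho.ext fun n φ => by rw [← Mho.apply_hat, ← Mho.apply_hat, h]

theorem Mho.exists_hat_eq (g : DualOmega ι →ₗ[Λᵐᵒᵖ] Λ) : ∃ u : Mho ι, ∀ n, u.hat n = g n := by
  let u : Mho ι := BT.lift
    (LinearMap.mk₂ k (fun n (φ : KDual k Λ) => φ (g n))
      (fun n n' φ => by rw [map_add, map_add])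
      (fun r n φ => (congrArg φ (map_smul (g.restrictScalars k) r n)).trans (map_smul φ r _))
      (fun n φ φ' => rfl) (fun r n φ => rfl))
    (fun n l φ => congrArg φ (map_smul g (op l) n))
  exact ⟨u, fun n => KDual.eval_injective (k := k) fun φ => u.apply_hat n φ⟩

theorem Mho.hat_sum_smul {N : ℕ} (l : Fin N → Λ) (u : Fin N → Mho ι) (n : DualOmega ι) :
    (∑ i, l i • u i).hat n = ∑ i, l i * (u i).hat n := by
  let e : Mho ι →+ Λ :=
    AddMonoidHom.mk' (fun u => u.hat n) fun u v => Mho.hat_add u v n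
  refine (map_sum e _ _).trans (Finset.sum_congr rfl fun i _ => Mho.hat_smul _ _ _)

theorem finite_dualOmega : Module.Finite k (DualOmega ι) := by
  have h1 : Module.Finite k (KDual k Λ) := inferInstanceAs (Module.Finite k (Λ →ₗ[k] k))
  have h2 : Module.Finite k (BT ι ι Λ Λ) := Module.Finite.of_surjective (BT.mk ι ι) BT.mk_surjective
  have h3 : Module.Finite k (Omega ι) :=
    Module.Finite.of_injective (Omega.val ι) Omega.val_injective
  exact Module.Finite.of_surjective (BT.mk _ _) BT.mk_surjective

/-- A dual basis of the finitely generated projective right `Λ`-module `DΛ ⊗_Λ Ω`. -/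
theorem IsHereditaryRing.exists_dualBasis [IsSemisimpleRing A] (h : IsHereditaryRing Λ) :
    ∃ (N : ℕ) (n : Fin N → DualOmega ι) (u : Fin N → Mho ι),
      ∀ z : DualOmega ι, ∑ i, op ((u i).hat z) • n i = z := by
  have := h.projective_tensor_omega (ι := ι) (X := KDual k Λ)
  have := finite_dualOmega (ι := ι)
  have : Module.Finite Λᵐᵒᵖ (DualOmega ι) := Module.Finite.of_restrictScalars_finite k Λᵐᵒᵖ _
  obtain ⟨N, f, hf⟩ := Module.Finite.exists_fin' Λᵐᵒᵖ (DualOmega ι)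
  obtain ⟨s, hs⟩ := Module.projective_lifting_property f LinearMap.id hf
  choose u hu using fun i => Mho.exists_hat_eq
    ((opSelfEquiv Λ).symm.toLinearMap ∘ₗ LinearMap.proj i ∘ₗ s)
  refine ⟨N, fun i => f (Pi.single i 1), u, fun z => ?_⟩
  have h1 (i : Fin N) : op ((u i).hat z) = s z i := by
    rw [hu]; rfl
  calc ∑ i, op ((u i).hat z) • f (Pi.single i 1) = f (∑ i, s z i • Pi.single i 1) := by
        rw [map_sum]
        exact Finset.sum_congr rfl fun i _ => by rw [h1, map_smul]
    _ = f (s z) := by rw [← pi_eq_sum_univ' (s z)]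
    _ = z := LinearMap.congr_fun hs z

end HatMap

/-! ### Actions of `℧` and the functor `Hom_Λ(DΛ ⊗_Λ Ω, -)` -/

section Action

variable {k A Λ : Type*} [Field k] [Ring A] [Algebra k A] [Ring Λ] [Algebra k Λ]
  {ι : A →ₐ[k] Λ}
  {V V' : Type*} [AddCommGroup V] [Module k V] [Module Λᵐᵒᵖ V] [IsScalarTower k Λᵐᵒᵖ V]
  [AddCommGroup V'] [Module k V'] [Module Λᵐᵒᵖ V'] [IsScalarTower k Λᵐᵒᵖ V']

variable (ι V) in
/-- `Hom_Λ(DΛ ⊗_Λ Ω, V)` for a right `Λ`-module `V`, a right `Λ`-module through the left action on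
`DΛ`. For a finite dimensional hereditary algebra it is isomorphic to `V ⊗_Λ ℧`. -/
def RHom : Submodule Λᵐᵒᵖ (HomK k (DualOmega ι) V) where
  carrier := {g | ∀ (l : Λ) (n : DualOmega ι), g (op l • n) = op l • g n}
  add_mem' hg hg' l n := by rw [HomK.add_apply, HomK.add_apply, hg, hg', smul_add]
  zero_mem' l n := by rw [HomK.zero_apply, HomK.zero_apply, smul_zero]
  smul_mem' l' g hg l n := by
    rw [HomK.smul_apply, HomK.smul_apply, smul_comm, hg]

namespace RHom

theorem ext {g g' : RHom ι V} (h : ∀ n, g.1 n = g'.1 n) : g = g' := Subtype.ext (HomK.ext h)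

/-- Composition with a homomorphism `V → V'`. -/
def map (φ : V →ₗ[Λᵐᵒᵖ] V') : RHom ι V →ₗ[Λᵐᵒᵖ] RHom ι V' where
  toFun g := ⟨(φ.restrictScalars k) ∘ₗ (show DualOmega ι →ₗ[k] V from g.1), fun l n =>
    (congrArg φ (g.2 l n)).trans (map_smul φ (op l) _)⟩
  map_add' _ _ := ext fun _ => map_add φ _ _
  map_smul' _ _ := rfl

/-- `g ↦ (ξ ↦ (ω ↦ g(ξ ⊗ ω)))` embeds this module into the projective module
`Hom_k(DΛ, Hom_k(Ω, V))`. -/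
theorem projective [FiniteDimensional k Λ] (h : IsHereditaryRing Λ) :
    Module.Projective Λᵐᵒᵖ (RHom ι V) := by
  let j : RHom ι V →ₗ[Λᵐᵒᵖ] HomK k (KDual k Λ) (Omega ι → V) :=
    { toFun := fun g =>
        { toFun := fun ξ ω => g.1 (BT.tmul _ _ ξ ω)
          map_add' := fun ξ ξ' => funext fun ω =>
            (congrArg g.1 (BT.add_tmul ξ ξ' ω)).trans (map_add g.1 _ _)
          map_smul' := fun r ξ => funext fun ω =>
            (congrArg g.1 (BT.smulk_tmul r ξ ω)).trans (map_smul g.1 r _) }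
      map_add' := fun _ _ => rfl
      map_smul' := fun _ _ => rfl }
  have := h.projective_homK_dual (F := Omega ι → V) (k := k)
  refine h.projective_of_injective (k := k) j fun g g' hg => ext fun n => ?_
  induction n using BT.induction with
  | h0 => rw [map_zero, map_zero]
  | ht ξ ω => exact congrFun (congrArg (fun G : HomK k (KDual k Λ) (Omega ι → V) => G ξ) hg) ω
  | ha a b ha hb => rw [map_add, map_add, ha, hb]

theorem map_surjective [IsSemisimpleRing A] (h : IsHereditaryRing Λ) {φ : V →ₗ[Λᵐᵒᵖ] V'}
    (hφ : Function.Surjective φ) : Function.Surjective (map (ι := ι) φ) := fun g => by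
  have := h.projective_tensor_omega (ι := ι) (X := KDual k Λ)
  let g' : DualOmega ι →ₗ[Λᵐᵒᵖ] V' := 
    { toFun := g.1, map_add' := map_add g.1, map_smul' := fun l n => g.2 l.unop n }
  obtain ⟨G, hG⟩ := Module.projective_lifting_property φ g' hφ
  exact ⟨⟨G.restrictScalars k, fun l n => map_smul G (op l) n⟩,
    ext fun n => LinearMap.congr_fun hG n⟩

variable [FiniteDimensional k Λ]

/-- The homomorphism `n ↦ v û(n)`, corresponding to `v ⊗ u ∈ V ⊗_Λ ℧`. -/
noncomputable def outer : V →ₗ[k] Mho ι →ₗ[k] RHom ι V :=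
  LinearMap.mk₂ k
    (fun v u => ⟨((Algebra.lsmul k k V).toLinearMap.flip v) ∘ₗ (opLinearEquiv k).toLinearMap ∘ₗ
      u.hat, fun l n => by
        change op (u.hat (op l • n)) • v = op l • op (u.hat n) • v
        rw [Mho.hat_apply_op_smul, op_mul, mul_smul]⟩)
    (fun v v' u => ext fun n => smul_add (op (u.hat n)) v v')
    (fun r v u => ext fun n => smul_comm (op (u.hat n)) r v)
    (fun v u u' => ext fun n => by
      change op ((u + u').hat n) • v = op (u.hat n) • v + op (u'.hat n) • v
      rw [Mho.hat_add, op_add, add_smul])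
    (fun r v u => ext fun n => by
      change op ((r • u).hat n) • v = r • op (u.hat n) • v
      rw [Mho.hat_smulk, op_smul, smul_assoc])

theorem outer_apply (v : V) (u : Mho ι) (n : DualOmega ι) :
    (outer v u).1 n = op (u.hat n) • v := rfl

theorem outer_smul (v : V) (l : Λ) (u : Mho ι) : outer v (l • u) = outer (op l • v) u :=
  ext fun n => by rw [outer_apply, outer_apply, Mho.hat_smul, op_mul, mul_smul]

theorem outer_op_smul (v : V) (l : Λ) (u : Mho ι) : outer v (op l • u) = op l • outer v u :=
  ext fun n => by
    rw [outer_apply, Mho.hat_op_smul]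
    rfl

theorem map_outer (φ : V →ₗ[Λᵐᵒᵖ] V') (v : V) (u : Mho ι) : map φ (outer v u) = outer (φ v) u :=
  ext fun _ => map_smul φ _ _

theorem eq_sum_outer {N : ℕ} {n : Fin N → DualOmega ι} {u : Fin N → Mho ι}
    (hn : ∀ z : DualOmega ι, ∑ i, op ((u i).hat z) • n i = z) (g : RHom ι V) :
    g = ∑ i, outer (g.1 (n i)) (u i) := ext fun z => by
  let e : RHom ι V →+ V := AddMonoidHom.mk' (fun g => g.1 z) fun _ _ => rfl
  conv_lhs => rw [← hn z, map_sum]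
  exact (Finset.sum_congr rfl fun i _ => g.2 _ _).trans
    (map_sum e (fun i => outer (g.1 (n i)) (u i)) Finset.univ).symm

theorem hom_ext [IsSemisimpleRing A] (h : IsHereditaryRing Λ) {H H' : RHom ι V →ₗ[Λᵐᵒᵖ] V'}
    (hH : ∀ v u, H (outer v u) = H' (outer v u)) : H = H' := LinearMap.ext fun g => by
  obtain ⟨N, n, u, hn⟩ := h.exists_dualBasis (ι := ι)
  rw [eq_sum_outer hn g, map_sum, map_sum]
  exact Finset.sum_congr rfl fun i _ => hH _ _

/-- A bilinear map on `V × ℧` which is balanced over `Λ` and compatible with the right actions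
factors through `Hom_Λ(DΛ ⊗_Λ Ω, V) ≅ V ⊗_Λ ℧`. -/
theorem exists_factor [IsSemisimpleRing A] (h : IsHereditaryRing Λ) (a : V →ₗ[k] Mho ι →ₗ[k] V')
    (hl : ∀ v (l : Λ) u, a v (l • u) = a (op l • v) u)
    (hr : ∀ v (l : Λ) u, a v (op l • u) = op l • a v u) :
    ∃ H : RHom ι V →ₗ[Λᵐᵒᵖ] V', ∀ v u, H (outer v u) = a v u := by
  obtain ⟨N, n, u, hn⟩ := h.exists_dualBasis (ι := ι)
  let H : RHom ι V →+ V' := AddMonoidHom.mk' (fun g => ∑ i, a (g.1 (n i)) (u i)) fun g g' => by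
    rw [← Finset.sum_add_distrib]
    exact Finset.sum_congr rfl fun i _ => LinearMap.map_add₂ a _ _ _
  have hH (v : V) (w : Mho ι) : H (outer v w) = a v w := by
    have hw : ∑ i, w.hat (n i) • u i = w := Mho.hat_injective fun z => by
      rw [Mho.hat_sum_smul]
      conv_rhs => rw [← hn z, map_sum]
      exact Finset.sum_congr rfl fun i _ => (Mho.hat_apply_op_smul _ _ _).symm
    calc H (outer v w) = ∑ i, a (op (w.hat (n i)) • v) (u i) := rfl
      _ = ∑ i, a v (w.hat (n i) • u i) := Finset.sum_congr rfl fun i _ => (hl _ _ _).symm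
      _ = a v w := by rw [← map_sum, hw]
  refine ⟨{ toFun := H, map_add' := map_add H, map_smul' := fun l g => ?_ }, hH⟩
  obtain ⟨l, rfl⟩ := op_surjective l
  rw [eq_sum_outer hn g, Finset.smul_sum, map_sum, map_sum, RingHom.id_apply, Finset.smul_sum]
  refine Finset.sum_congr rfl fun i _ => ?_
  rw [hH, ← hr, ← hH, outer_op_smul]

end RHom

end Action

section Extension

variable {k A Λ : Type*} [Field k] [Ring A] [Algebra k A] [IsSemisimpleRing A]
  [Ring Λ] [Algebra k Λ] [FiniteDimensional k Λ] {ι : A →ₐ[k] Λ}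

/-- Given an exact sequence `0 → Y → E → X → 0` of right `Λ`-modules with `℧`-actions on `X` and
`Y`, and a surjection `E → E'` onto a module over `X` with a compatible `℧`-action, the action
lifts to `E`. The actions are written as homomorphisms on `Hom_Λ(DΛ ⊗_Λ Ω, -)`; this functor
is exact and has projective values, so that the sequence splits after applying it. -/
theorem IsHereditaryRing.exists_lift_action (h : IsHereditaryRing Λ)
    {X Y E E' : Type*} [AddCommGroup X] [Module k X] [Module Λᵐᵒᵖ X] [IsScalarTower k Λᵐᵒᵖ X]
    [AddCommGroup Y] [Module k Y] [Module Λᵐᵒᵖ Y] [IsScalarTower k Λᵐᵒᵖ Y]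
    [AddCommGroup E] [Module k E] [Module Λᵐᵒᵖ E] [IsScalarTower k Λᵐᵒᵖ E]
    [AddCommGroup E'] [Module k E'] [Module Λᵐᵒᵖ E'] [IsScalarTower k Λᵐᵒᵖ E']
    {i : Y →ₗ[Λᵐᵒᵖ] E} {p : E →ₗ[Λᵐᵒᵖ] X} {q : E →ₗ[Λᵐᵒᵖ] E'} {p' : E' →ₗ[Λᵐᵒᵖ] X}
    (hi : Function.Injective i) (hp : Function.Surjective p) (hq : Function.Surjective q)
    (hip : Function.Exact i p) (hpq : ∀ e, p' (q e) = p e)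
    {HX : RHom ι X →ₗ[Λᵐᵒᵖ] X} {HY : RHom ι Y →ₗ[Λᵐᵒᵖ] Y} {HE' : RHom ι E' →ₗ[Λᵐᵒᵖ] E'}
    (hX : ∀ G, p' (HE' G) = HX (RHom.map p' G))
    (hY : ∀ G, q (i (HY G)) = HE' (RHom.map q (RHom.map i G))) :
    ∃ HE : RHom ι E →ₗ[Λᵐᵒᵖ] E, (∀ G, p (HE G) = HX (RHom.map p G)) ∧
      (∀ G, HE (RHom.map i G) = i (HY G)) ∧ ∀ G, q (HE G) = HE' (RHom.map q G) := by
  have := RHom.projective (ι := ι) (V := X) h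
  obtain ⟨s, hs⟩ := Module.projective_lifting_property (RHom.map (ι := ι) p) LinearMap.id
    (RHom.map_surjective h hp)
  replace hs (G) : RHom.map p (s G) = G := LinearMap.congr_fun hs G
  obtain ⟨g, hg⟩ := Module.projective_lifting_property q (HE' ∘ₗ RHom.map q ∘ₗ s) hq
  replace hg (G) : q (g G) = HE' (RHom.map q (s G)) := LinearMap.congr_fun hg G
  have hi' : Function.Injective (RHom.map (ι := ι) i) := fun G G' hG =>
    RHom.ext fun n => hi (congrArg (fun G : RHom ι E => G.1 n) hG)
  have hpi (G : RHom ι Y) : RHom.map p (RHom.map i G) = 0 :=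
    RHom.ext fun n => hip.apply_apply_eq_zero _
  have hker (G : RHom ι E) (hG : RHom.map p G = 0) : ∃ G', RHom.map i G' = G := by
    have h1 (n) : ∃ y, i y = G.1 n :=
      (hip _).1 (congrArg (fun G : RHom ι X => G.1 n) hG)
    choose y hy using h1
    refine ⟨⟨({ toFun := y, map_add' := fun n n' => hi ?_, map_smul' := fun r n => hi ?_ } :
      DualOmega ι →ₗ[k] Y), fun l n => hi ?_⟩, RHom.ext hy⟩
    · rw [map_add, hy, hy, hy, map_add]
    · rw [hy, map_smul, ← hy]
      exact (map_smul (i.restrictScalars k) r _).symm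
    · change i (y _) = i (op l • y n)
      rw [map_smul, hy, hy, G.2]
  -- `R` is the projection onto the subfunctor along the section `s`
  have hr (G : RHom ι E) : ∃ G', RHom.map i G' = G - s (RHom.map p G) :=
    hker _ (by rw [map_sub, hs, sub_self])
  choose r hr using hr
  let R : RHom ι E →ₗ[Λᵐᵒᵖ] RHom ι Y :=
    { toFun := r
      map_add' := fun G G' => hi' (by rw [map_add, hr, hr, hr, map_add, map_add]; abel)
      map_smul' := fun l G => hi' (by
        rw [RingHom.id_apply, map_smul, hr, hr, map_smul, map_smul, smul_sub]) }
  have hR (G) : RHom.map i (R G) = G - s (RHom.map p G) := hr G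
  -- the action is the given one on the image of `Y`, and `g`, which lifts the action on `E'`, on
  -- the image of `s`
  have hqE (G) : q (i (HY (R G)) + g (RHom.map p G)) = HE' (RHom.map q G) := by
    rw [map_add, hY, hg, ← map_add, ← map_add, hR, sub_add_cancel]
  refine ⟨i ∘ₗ HY ∘ₗ R + g ∘ₗ RHom.map p, fun G => ?_, fun G => ?_, hqE⟩
  · rw [← hpq]
    refine (congrArg p' (hqE G)).trans ((hX _).trans (congrArg HX (RHom.ext fun n => ?_)))
    exact hpq _
  · have h1 : R (RHom.map i G) = G := hi' (by rw [hR, hpi, map_zero, sub_zero])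
    rw [LinearMap.add_apply, LinearMap.comp_apply, LinearMap.comp_apply, LinearMap.comp_apply, h1,
      hpi, map_zero, add_zero]

end Extension

/-! ### Twisted products and maps on `℧` -/

section TwistedProduct

variable {k Λ : Type*} [Field k] [Ring Λ] [Algebra k Λ]
  {X Y Z : Type*} [AddCommGroup X] [Module k X] [Module Λᵐᵒᵖ X] [IsScalarTower k Λᵐᵒᵖ X]
  [AddCommGroup Y] [Module k Y] [Module Λᵐᵒᵖ Y] [IsScalarTower k Λᵐᵒᵖ Y]
  [AddCommGroup Z] [Module k Z] [Module Λᵐᵒᵖ Z] [IsScalarTower k Λᵐᵒᵖ Z]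

/-- The extension `X × Y` of `X` by `Y` given by a derivation `δ : Λ → Hom_k(X, Y)`, with the action
`(x, y) l = (x l, δ(l)(x) + y l)`. -/
def TwistedProd {δ : Λ →ₗ[k] X →ₗ[k] Y} (_ : IsDerivation (AlgHom.id k Λ) δ) : Type _ := X × Y

namespace TwistedProd

variable {δ : Λ →ₗ[k] X →ₗ[k] Y} (hδ : IsDerivation (AlgHom.id k Λ) δ)

instance : AddCommGroup (TwistedProd hδ) := inferInstanceAs (AddCommGroup (X × Y))
instance : Module k (TwistedProd hδ) := inferInstanceAs (Module k (X × Y))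

instance : Module Λᵐᵒᵖ (TwistedProd hδ) where
  smul l z := (l • z.1, δ l.unop z.1 + l • z.2)
  one_smul z := Prod.ext (one_smul _ z.1) <| by
    change δ (1 : Λ) z.1 + (1 : Λᵐᵒᵖ) • z.2 = z.2
    rw [hδ.map_one, zero_add, one_smul]
  mul_smul l m z := Prod.ext (mul_smul l m z.1) <| by
    change δ (m.unop * l.unop) z.1 + (l * m) • z.2 =
      δ l.unop (m • z.1) + l • (δ m.unop z.1 + m • z.2)
    rw [hδ, AlgHom.id_apply, AlgHom.id_apply, op_unop, op_unop, smul_add, mul_smul]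
    abel
  smul_zero l := Prod.ext (smul_zero l) <| by
    change δ l.unop 0 + l • (0 : Y) = 0
    rw [map_zero, smul_zero, add_zero]
  smul_add l z z' := Prod.ext (smul_add l z.1 z'.1) <| by
    change δ l.unop (z.1 + z'.1) + l • (z.2 + z'.2) =
      (δ l.unop z.1 + l • z.2) + (δ l.unop z'.1 + l • z'.2)
    rw [map_add, smul_add]
    abel
  add_smul l m z := Prod.ext (add_smul l m z.1) <| by
    change δ (l.unop + m.unop) z.1 + (l + m) • z.2 =
      (δ l.unop z.1 + l • z.2) + (δ m.unop z.1 + m • z.2)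
    rw [map_add, LinearMap.add_apply, add_smul]
    abel
  zero_smul z := Prod.ext (zero_smul _ z.1) <| by
    change δ (0 : Λ) z.1 + (0 : Λᵐᵒᵖ) • z.2 = 0
    rw [map_zero, LinearMap.zero_apply, zero_smul, add_zero]

instance : IsScalarTower k Λᵐᵒᵖ (TwistedProd hδ) where
  smul_assoc r l z := Prod.ext (smul_assoc r l z.1) <| by
    change δ (r • l.unop) z.1 + (r • l) • z.2 = r • (δ l.unop z.1 + l • z.2)
    rw [map_smul, LinearMap.smul_apply, smul_add, smul_assoc]

/-- The submodule `Y`. -/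
def inr : Y →ₗ[Λᵐᵒᵖ] TwistedProd hδ where
  toFun y := (0, y)
  map_add' y y' := Prod.ext (add_zero 0).symm rfl
  map_smul' l y := Prod.ext (smul_zero l).symm <| by
    change l • y = δ l.unop 0 + l • y
    rw [map_zero, zero_add]

/-- The projection onto `X`. -/
def fst : TwistedProd hδ →ₗ[Λᵐᵒᵖ] X where
  toFun z := z.1
  map_add' _ _ := rfl
  map_smul' _ _ := rfl

variable {δ' : Λ →ₗ[k] X →ₗ[k] Z} (hδ' : IsDerivation (AlgHom.id k Λ) δ')

/-- The map `id × π`. -/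
def map (π : Y →ₗ[Λᵐᵒᵖ] Z) (h : ∀ t x, π (δ t x) = δ' t x) :
    TwistedProd hδ →ₗ[Λᵐᵒᵖ] TwistedProd hδ' where
  toFun z := (z.1, π z.2)
  map_add' z z' := Prod.ext rfl (map_add π z.2 z'.2)
  map_smul' l z := Prod.ext rfl <| by
    change π (δ l.unop z.1 + l • z.2) = δ' l.unop z.1 + l • π z.2
    rw [map_add, h, map_smul]

end TwistedProd

end TwistedProduct

section LiftEpsilon

variable {k A Λ : Type*} [Field k] [Ring A] [Algebra k A] [IsSemisimpleRing A]
  [Ring Λ] [Algebra k Λ] [FiniteDimensional k Λ] {ι : A →ₐ[k] Λ}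
  {X Y Z : Type*} [AddCommGroup X] [Module k X] [Module Λᵐᵒᵖ X] [IsScalarTower k Λᵐᵒᵖ X]
  [AddCommGroup Y] [Module k Y] [Module Λᵐᵒᵖ Y] [IsScalarTower k Λᵐᵒᵖ Y]
  [AddCommGroup Z] [Module k Z] [Module Λᵐᵒᵖ Z] [IsScalarTower k Λᵐᵒᵖ Z]

/-- Given right `Λ`-modules `X`, `Y`, `Z` with actions of `℧`, a surjection `π : Y → Z` and a lift
`δ` of a derivation `δ'` along `π`, the maps `ε'` on `℧` compatible with `δ'` lift to maps compatible
with `δ`: such a map is the off-diagonal part of an action of `℧` on the twisted product, and these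
actions lift. -/
theorem IsHereditaryRing.exists_lift_incl (h : IsHereditaryRing Λ)
    {aX : X →ₗ[k] Mho ι →ₗ[k] X} {aY : Y →ₗ[k] Mho ι →ₗ[k] Y} {aZ : Z →ₗ[k] Mho ι →ₗ[k] Z}
    (hXl : ∀ x (l : Λ) u, aX x (l • u) = aX (op l • x) u)
    (hXr : ∀ x (l : Λ) u, aX x (op l • u) = op l • aX x u)
    (hYl : ∀ y (l : Λ) u, aY y (l • u) = aY (op l • y) u)
    (hYr : ∀ y (l : Λ) u, aY y (op l • u) = op l • aY y u)
    (hZl : ∀ z (l : Λ) u, aZ z (l • u) = aZ (op l • z) u)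
    (hZr : ∀ z (l : Λ) u, aZ z (op l • u) = op l • aZ z u)
    {π : Y →ₗ[Λᵐᵒᵖ] Z} (hπ : Function.Surjective π) (hπa : ∀ y u, π (aY y u) = aZ (π y) u)
    {δ : Λ →ₗ[k] X →ₗ[k] Y} (hδ : IsDerivation (AlgHom.id k Λ) δ)
    {δ' : Λ →ₗ[k] X →ₗ[k] Z} (hδ' : IsDerivation (AlgHom.id k Λ) δ')
    (hδδ' : ∀ t x, π (δ t x) = δ' t x)
    {ε' : Mho ι →ₗ[k] X →ₗ[k] Z}
    (hl' : ∀ (l : Λ) u x, ε' (l • u) x = aZ (δ' l x) u + ε' u (op l • x))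
    (hr' : ∀ (l : Λ) u x, ε' (op l • u) x = op l • ε' u x + δ' l (aX x u)) :
    ∃ ε : Mho ι →ₗ[k] X →ₗ[k] Y,
      (∀ (l : Λ) u x, ε (l • u) x = aY (δ l x) u + ε u (op l • x)) ∧
      (∀ (l : Λ) u x, ε (op l • u) x = op l • ε u x + δ l (aX x u)) ∧
      ∀ u x, π (ε u x) = ε' u x := by
  let aE' : TwistedProd hδ' →ₗ[k] Mho ι →ₗ[k] TwistedProd hδ' :=
    LinearMap.mk₂ k (fun z u => (aX z.1 u, ε' u z.1 + aZ z.2 u))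
      (fun z z' u => Prod.ext (LinearMap.map_add₂ aX z.1 z'.1 u) <| by
        change ε' u (z.1 + z'.1) + aZ (z.2 + z'.2) u =
          (ε' u z.1 + aZ z.2 u) + (ε' u z'.1 + aZ z'.2 u)
        rw [map_add, map_add, LinearMap.add_apply]
        abel)
      (fun r z u => Prod.ext (LinearMap.map_smul₂ aX r z.1 u) <| by
        change ε' u (r • z.1) + aZ (r • z.2) u = r • (ε' u z.1 + aZ z.2 u)
        rw [map_smul, map_smul, LinearMap.smul_apply, smul_add])
      (fun z u u' => Prod.ext (map_add (aX z.1) u u') <| by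
        change ε' (u + u') z.1 + aZ z.2 (u + u') =
          (ε' u z.1 + aZ z.2 u) + (ε' u' z.1 + aZ z.2 u')
        rw [map_add, map_add, LinearMap.add_apply]
        abel)
      (fun r z u => Prod.ext (map_smul (aX z.1) r u) <| by
        change ε' (r • u) z.1 + aZ z.2 (r • u) = r • (ε' u z.1 + aZ z.2 u)
        rw [map_smul, map_smul, LinearMap.smul_apply, smul_add])
  obtain ⟨HX, hHX⟩ := RHom.exists_factor h aX hXl hXr
  obtain ⟨HY, hHY⟩ := RHom.exists_factor h aY hYl hYr
  obtain ⟨HE', hHE'⟩ := RHom.exists_factor h aE'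
    (fun z l u => Prod.ext (hXl z.1 l u) <| by
      change ε' (l • u) z.1 + aZ z.2 (l • u) =
        ε' u (op l • z.1) + aZ (δ' l z.1 + op l • z.2) u
      rw [hl', hZl, map_add, LinearMap.add_apply]
      abel)
    (fun z l u => Prod.ext (hXr z.1 l u) <| by
      change ε' (op l • u) z.1 + aZ z.2 (op l • u) =
        δ' l (aX z.1 u) + op l • (ε' u z.1 + aZ z.2 u)
      rw [hr', hZr, smul_add]
      abel)
  obtain ⟨HE, hp, hi, hq⟩ := h.exists_lift_action (ι := ι) (i := TwistedProd.inr hδ)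
    (p := TwistedProd.fst hδ) (q := TwistedProd.map hδ hδ' π hδδ') (p' := TwistedProd.fst hδ')
    (HX := HX) (HY := HY) (HE' := HE')
    (fun y y' hy => congrArg Prod.snd hy) (fun x => ⟨(x, 0), rfl⟩)
    (fun z => ⟨(z.1, (hπ z.2).choose), Prod.ext rfl (hπ z.2).choose_spec⟩)
    (fun z => ⟨fun hz => ⟨z.2, Prod.ext (Eq.symm hz) rfl⟩, by rintro ⟨y, rfl⟩; rfl⟩)
    (fun _ => rfl)
    (LinearMap.congr_fun (RHom.hom_ext h
      (H := TwistedProd.fst hδ' ∘ₗ HE') (H' := HX ∘ₗ RHom.map (TwistedProd.fst hδ'))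
      fun z u => by
        rw [LinearMap.comp_apply, LinearMap.comp_apply, RHom.map_outer, hHE', hHX]
        rfl))
    (LinearMap.congr_fun (RHom.hom_ext h
      (H := TwistedProd.map hδ hδ' π hδδ' ∘ₗ TwistedProd.inr hδ ∘ₗ HY)
      (H' := HE' ∘ₗ RHom.map (TwistedProd.map hδ hδ' π hδδ') ∘ₗ RHom.map (TwistedProd.inr hδ))
      fun y u => by
        rw [LinearMap.comp_apply, LinearMap.comp_apply, LinearMap.comp_apply, LinearMap.comp_apply,
          RHom.map_outer, RHom.map_outer, hHE', hHY]
        refine Prod.ext ?_ ?_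
        · change (0 : X) = aX 0 u
          rw [map_zero, LinearMap.zero_apply]
        · change π (aY y u) = ε' u 0 + aZ (π y) u
          rw [map_zero, zero_add, hπa]))
  let j : X →ₗ[k] TwistedProd hδ := LinearMap.inl k X Y
  let s : TwistedProd hδ →ₗ[k] Y := LinearMap.snd k X Y
  let ε : Mho ι →ₗ[k] X →ₗ[k] Y :=
    ((RHom.outer ∘ₗ j).compr₂ (s ∘ₗ HE.restrictScalars k)).flip
  have hε (u : Mho ι) (x : X) : ε u x = (HE (RHom.outer (j x) u)).2 := rfl
  have hfst (u : Mho ι) (x : X) : (HE (RHom.outer (j x) u)).1 = aX x u :=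
    (hp _).trans (by rw [RHom.map_outer, hHX]; rfl)
  refine ⟨ε, fun l u x => ?_, fun l u x => ?_, fun u x => ?_⟩
  · have h1 : op l • j x = TwistedProd.inr hδ (δ l x) + j (op l • x) := by
      refine Prod.ext ?_ ?_
      · exact (zero_add _).symm
      · change δ l x + op l • (0 : Y) = δ l x + 0
        rw [smul_zero]
    rw [hε, RHom.outer_smul, h1, map_add, LinearMap.add_apply, map_add, ← RHom.map_outer, hi, hHY]
    rfl
  · rw [hε, RHom.outer_op_smul, map_smul]
    change δ l (HE (RHom.outer (j x) u)).1 + op l • (HE (RHom.outer (j x) u)).2 = _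
    rw [hfst, ← hε, add_comm]
  · have h1 := congrArg Prod.snd (hq (RHom.outer (j x) u))
    rw [RHom.map_outer, hHE'] at h1
    refine h1.trans ?_
    change ε' u x + aZ (π 0) u = ε' u x
    rw [map_zero, map_zero, LinearMap.zero_apply, add_zero]

end LiftEpsilon

/-! ### The case of a finite dimensional hereditary algebra -/

section HereditaryPresentation

variable {k A Λ : Type*} [Field k] [Ring A] [Algebra k A] [IsSemisimpleRing A]
  [Ring Λ] [Algebra k Λ] [FiniteDimensional k Λ] {ι : A →ₐ[k] Λ}

/-- The action of `℧` on a right module over an algebra to which `T_Λ(℧)` maps. -/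
def mhoAction {S : Type*} [Ring S] [Algebra k S] (f : TensorAlg k Λ (Mho ι) →ₐ[k] S)
    (V : Type*) [AddCommGroup V] [Module k V] [Module Sᵐᵒᵖ V] [IsScalarTower k Sᵐᵒᵖ V] :
    V →ₗ[k] Mho ι →ₗ[k] V :=
  ((Algebra.lsmul k k V).toLinearMap ∘ₗ (opLinearEquiv k).toLinearMap ∘ₗ f.toLinearMap ∘ₗ
    TensorAlg.incl k Λ (Mho ι)).flip

section MhoAction

variable {S V : Type*} [Ring S] [Algebra k S] (f : TensorAlg k Λ (Mho ι) →ₐ[k] S)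
  [AddCommGroup V] [Module k V] [Module Sᵐᵒᵖ V] [IsScalarTower k Sᵐᵒᵖ V]

theorem mhoAction_smul (v : V) (l : Λ) (u : Mho ι) : mhoAction f V v (l • u) =
    mhoAction f V (op (f (TensorAlg.of k Λ (Mho ι) l)) • v) u := by
  change op (f (TensorAlg.incl k Λ (Mho ι) (l • u))) • v =
    op (f (TensorAlg.incl k Λ (Mho ι) u)) • op (f (TensorAlg.of k Λ (Mho ι) l)) • v
  rw [TensorAlg.incl_smul_left, map_mul, op_mul, mul_smul]

theorem mhoAction_op_smul (v : V) (l : Λ) (u : Mho ι) : mhoAction f V v (op l • u) =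
    op (f (TensorAlg.of k Λ (Mho ι) l)) • mhoAction f V v u := by
  change op (f (TensorAlg.incl k Λ (Mho ι) (op l • u))) • v =
    op (f (TensorAlg.of k Λ (Mho ι) l)) • op (f (TensorAlg.incl k Λ (Mho ι) u)) • v
  rw [TensorAlg.incl_smul_right, map_mul, op_mul, mul_smul]

end MhoAction

/-- For a hereditary algebra, derivations `T_Λ(℧) → Hom_k(X, Z)` over `A` lift along surjections
`Y → Z`. -/
theorem IsHereditaryRing.exists_lift_derivation_tensorAlg (h : IsHereditaryRing Λ)
    {S : Type*} [Ring S] [Algebra k S] (f : TensorAlg k Λ (Mho ι) →ₐ[k] S) {X Y Z : Type*}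
    [AddCommGroup X] [Module k X] [Module Sᵐᵒᵖ X] [IsScalarTower k Sᵐᵒᵖ X]
    [AddCommGroup Y] [Module k Y] [Module Sᵐᵒᵖ Y] [IsScalarTower k Sᵐᵒᵖ Y]
    [AddCommGroup Z] [Module k Z] [Module Sᵐᵒᵖ Z] [IsScalarTower k Sᵐᵒᵖ Z]
    {π : Y →ₗ[Sᵐᵒᵖ] Z} (hπ : Function.Surjective π)
    {D' : TensorAlg k Λ (Mho ι) →ₗ[k] X →ₗ[k] Z} (hD' : IsDerivation f D')
    (hA : ∀ a, D' (baseToT (Mho ι) ι a) = 0) :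
    ∃ D : TensorAlg k Λ (Mho ι) →ₗ[k] X →ₗ[k] Y, IsDerivation f D ∧
      (∀ a, D (baseToT (Mho ι) ι a) = 0) ∧ ∀ t x, π (D t x) = D' t x := by
  -- restriction of scalars along `Λ → T_Λ(℧) → S`
  let ρ : Λᵐᵒᵖ →ₐ[k] Sᵐᵒᵖ := AlgHom.op (f.comp (TensorAlg.of k Λ (Mho ι)))
  let _ : Module Λᵐᵒᵖ X := Module.compHom X ρ.toRingHom
  let _ : Module Λᵐᵒᵖ Y := Module.compHom Y ρ.toRingHom
  let _ : Module Λᵐᵒᵖ Z := Module.compHom Z ρ.toRingHom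
  have : IsScalarTower k Λᵐᵒᵖ X := ⟨fun r l x => by
    change ρ (r • l) • x = r • ρ l • x
    rw [map_smul, smul_assoc]⟩
  have : IsScalarTower k Λᵐᵒᵖ Y := ⟨fun r l x => by
    change ρ (r • l) • x = r • ρ l • x
    rw [map_smul, smul_assoc]⟩
  have : IsScalarTower k Λᵐᵒᵖ Z := ⟨fun r l x => by
    change ρ (r • l) • x = r • ρ l • x
    rw [map_smul, smul_assoc]⟩
  let π' : Y →ₗ[Λᵐᵒᵖ] Z :=
    { toFun := π, map_add' := map_add π, map_smul' := fun l y => map_smul π (ρ l) y }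
  obtain ⟨δ, hδ, hδA, hδδ'⟩ := h.exists_lift_derivation (ι := ι) π' hπ
    (D' ∘ₗ (TensorAlg.of k Λ (Mho ι)).toLinearMap) (fun l m x => hD'.comp _ l m x) hA
  obtain ⟨ε, hl, hr, hεε'⟩ := h.exists_lift_incl
    (aX := mhoAction f X) (aY := mhoAction f Y) (aZ := mhoAction f Z)
    (fun x l u => mhoAction_smul f x l u) (fun x l u => mhoAction_op_smul f x l u)
    (fun x l u => mhoAction_smul f x l u) (fun x l u => mhoAction_op_smul f x l u)
    (fun x l u => mhoAction_smul f x l u) (fun x l u => mhoAction_op_smul f x l u)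
    (π := π') hπ (fun y u => map_smul π _ y) hδ
    (δ' := D' ∘ₗ (TensorAlg.of k Λ (Mho ι)).toLinearMap) (fun l m x => hD'.comp _ l m x) hδδ'
    (ε' := D' ∘ₗ TensorAlg.incl k Λ (Mho ι))
    (fun l u x => by
      rw [LinearMap.comp_apply, TensorAlg.incl_smul_left, hD']
      rfl)
    (fun l u x => by
      rw [LinearMap.comp_apply, TensorAlg.incl_smul_right, hD']
      rfl)
  obtain ⟨D, hD, hDof, hDincl⟩ := TensorAlg.exists_derivation f δ ε hδ hl hr
  refine ⟨D, hD, fun a => (hDof _).trans (hδA a), fun t x => ?_⟩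
  have h1 : IsDerivation f (D.compr₂ (π.restrictScalars k)) := fun s t x => by
    change π (D (s * t) x) = op (f t) • π (D s x) + π (D t (op (f s) • x))
    rw [hD, map_add, map_smul]
  have h2 : D.compr₂ (π.restrictScalars k) = D' := TensorAlg.derivation_ext h1 hD'
    (fun l => LinearMap.ext fun x => (congrArg (fun d => π (d x)) (hDof l)).trans (hδδ' l x))
    (fun u => LinearMap.ext fun x => (congrArg (fun d => π (d x)) (hDincl u)).trans (hεε' u x))
  exact LinearMap.congr_fun (LinearMap.congr_fun h2 t) x

/-- The universal derivation lifts along every surjection onto `X ⊗_T Ω̃ ⊗_T Π`, and the lift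
induces a section. -/
theorem IsHereditaryRing.projective_termQ (h : IsHereditaryRing Λ) (c : Mho ι) (X : Type w)
    [AddCommGroup X] [Module k X] [Module (Preproj k Λ c)ᵐᵒᵖ X]
    [IsScalarTower k (Preproj k Λ c)ᵐᵒᵖ X] :
    Module.Projective (Preproj k Λ c)ᵐᵒᵖ (TermQ ι c X) := by
  refine Module.Projective.of_lifting_property'' fun π hπ => ?_
  obtain ⟨D, hD, hA, hDD'⟩ := h.exists_lift_derivation_tensorAlg (toPreproj k Λ c) hπ
    (isDerivation_universalDerivation (ι := ι) (c := c) (X := X)) universalDerivation_base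
  refine ⟨TermQ.desc D hD hA, LinearMap.ext fun z => ?_⟩
  induction z using TermQ.induction with
  | h0 => rw [map_zero, map_zero]
  | ht x t p =>
    rw [LinearMap.comp_apply, TermQ.desc_elem, map_smul, hDD', universalDerivation_apply,
      smul_elemQ, one_mul]
    rfl
  | ha a b ha hb => rw [map_add, map_add, ha, hb]

/-- By the symmetry of `σ`, the value `θ(x lmod_φ(y))` does not change when `a` is moved from `φ`
to `θ`. -/
theorem cbar_comm [FiniteDimensional k A] (σ : SymmetrisingElement k A) (a : A) :
    ι a • cbar σ ι = op (ι a) • cbar σ ι := by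
  have h1 (θ φ : KDual k Λ) : barForm σ ι θ (op (ι a) • φ) = barForm σ ι (ι a • θ) φ :=
    BT.hom_ext fun x y => by
      have h2 : σ.lmod ι (op (ι a) • φ) y = σ.lmod ι φ y * a := by
        rw [σ.ext_iff]
        intro b
        rw [σ.apply_mul_lmod, ← mul_assoc, σ.symm, ← mul_assoc, σ.apply_mul_lmod,
          KDual.right_smul_apply, map_mul, mul_smul]
      rw [barForm_tmul, barForm_tmul, h2, map_mul ι, KDual.left_smul_apply, op_smul_eq_mul,
        mul_assoc]
  refine Mho.ext fun n φ => ?_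
  rw [Mho.eval_smul, Mho.eval_op_smul]
  change barBi σ ι n (op (ι a) • φ) = barBi σ ι (ι a • n) φ
  induction n using BT.induction with
  | h0 => rw [smul_zero, map_zero]; rfl
  | ht θ ω => exact LinearMap.congr_fun (h1 θ φ) _
  | ha m n hm hn =>
    rw [smul_add, map_add, map_add, LinearMap.add_apply, LinearMap.add_apply, hm, hn]

end HereditaryPresentation

theorem mainTheorem4 (k : Type*) [Field k] :
    -- finite dimensional hereditary algebras `Λ = A ⊕ J`
    (∀ (Λ : Type*) [Ring Λ] [Algebra k Λ] [FiniteDimensional k Λ] (_ : IsHereditaryRing Λ)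
      (A : Subalgebra k Λ) [IsSemisimpleRing A]
      (_ : IsCompl (Subalgebra.toSubmodule A) ((Ring.jacobson Λ).restrictScalars k))
      (σ : SymmetrisingElement k A),
      ∃ P : PresentationPi.{w} A.val (cbar σ A.val), P.IsStandard) ∧
    -- locally finite hereditary tensor algebras `Λ = T_A(M)`
    (∀ (A : Type*) [Ring A] [Algebra k A] [FiniteDimensional k A] [IsSemisimpleRing A]
      (M : Type*) [AddCommGroup M] [Module k M] [FiniteDimensional k M]
      [Module A M] [Module Aᵐᵒᵖ M] [IsScalarTower k A M] [IsScalarTower k Aᵐᵒᵖ M]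
      [SMulCommClass A Aᵐᵒᵖ M]
      (σ : SymmetrisingElement k A) (r s : ℕ)
      (m : Fin r → M) (μ : Fin r → KDual k M) (ν : Fin s → KDual k M) (n : Fin s → M)
      (_ : RepresentsRightId σ m μ) (_ : RepresentsLeftId σ ν n)
      (c : MhoT k A M) (_ : c = cbarT m μ ν n),
      ∃ (P : PresentationPi.{w} (TensorAlg.of k A M) c) (P' : PresentationDouble.{w} c)
        (e : ∀ X : ModuleCat.{w} (Preproj k (TensorAlg k A M) c)ᵐᵒᵖ,
          TermM c X ≃ₗ[(Preproj k (TensorAlg k A M) c)ᵐᵒᵖ] TermQ (TensorAlg.of k A M) c X),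
        P.IsStandard ∧
        -- `e` is the identification `x ⊗ γ ⊗ p ↦ x ⊗ dγ ⊗ p`, under which `P` becomes `P'`
        (∀ (X : ModuleCat.{w} (Preproj k (TensorAlg k A M) c)ᵐᵒᵖ) (x : X) (γ : M × KDual k M)
          (p : Preproj k (TensorAlg k A M) c),
          e X (elemM c x γ p) = elemQ (TensorAlg.of k A M) c x
            (Omega.d (baseToT (MhoT k A M) (TensorAlg.of k A M)) (doubleT γ)) p) ∧
        (∀ X z, e X (P'.d₂ X z) = P.d₂ X z) ∧
        (∀ X z, P'.d₁ X z = P.d₁ X (e X z)) ∧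
        (∀ X z, P'.d₀ X z = P.d₀ X z) ∧
        -- the explicit form of the left hand map and of the middle map
        (∀ (X : ModuleCat.{w} (Preproj k (TensorAlg k A M) c)ᵐᵒᵖ) (x : X),
          P'.d₂ X (elemP (TensorAlg.of k A M) c x 1) =
            ∑ i, (elemM c (op (doublePi c (m i, 0)) • x) (0, μ i) 1 +
                  elemM c x (m i, 0) (doublePi c (0, μ i))) -
            ∑ j, (elemM c (op (doublePi c (0, ν j)) • x) (n j, 0) 1 +
                  elemM c x (0, ν j) (doublePi c (n j, 0)))) ∧
        (∀ (X : ModuleCat.{w} (Preproj k (TensorAlg k A M) c)ᵐᵒᵖ) (x : X) (γ : M × KDual k M)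
          (p : Preproj k (TensorAlg k A M) c),
          P'.d₁ X (elemM c x γ p) =
            elemP (TensorAlg.of k A M) c x (doublePi c γ * p) -
              elemP (TensorAlg.of k A M) c (op (doublePi c γ) • x) p)) := by
  refine ⟨?_, ?_⟩
  · intro Λ _ _ _ hΛ A _ _ σ
    have hQ (X : ModuleCat.{w} (Preproj k Λ (cbar σ A.val))ᵐᵒᵖ) :
        Module.Projective (Preproj k Λ (cbar σ A.val))ᵐᵒᵖ (TermQ A.val (cbar σ A.val) X) :=
      hΛ.projective_termQ _ _
    exact ⟨standardPresentation (cbar_comm σ) hQ,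
      standardPresentation_isStandard (cbar_comm σ) hQ⟩
  · intro A _ _ _ _ M _ _ _ _ _ _ _ _ σ r s m μ ν n h₁ h₂ c hc
    exact exists_presentation_tensorAlg σ r s m μ ν n h₁ h₂ c hc
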